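/- **Setting.** All functions are real valued. $H^1=H^1(\mathbb R)$ carries the inner product $\langle u,v\rangle=\int(uv+u'v')\,dx$ and the norm $\|\cdot\|$. For locally integrable $W$ let $\|W\|_{BS}=\sup_{t}\int_t^{t+1}|W|\,dx$, and let $BS$ be the space of those $W$ with $\|W\|_{BS}<\infty$. $W\in BS$ is *Stepanov almost periodic* if every sequence of shifts $W(\cdot+z_k)$ has a subsequence converging in $BS$. For a Carathéodory function $g(x,s)$ (continuous in $s$ for a.e. $x$, measurable in $x$ for every $s$) put $\|g\|_R=\big\|\sup_{|s|\le R}|g(\cdot,s)|\big\|_{BS}$; $g$ is *strictly Stepanov almost periodic* if $\|g\|_R<\infty$ for all $R>0$ and for every sequence $z_k$ there are a subsequence $z_{k'}$ and a Carathéodory function $g_h$ with $\|g_h\|_R<\infty$ and $\|g(\cdot+z_{k'},\cdot)-g_h\|_R\to0$ for all $R>0$. Let $\chi\in\{1,-1\}$, $V:\mathbb R\to\mathbb R$, $f:\mathbb R\times\mathbb R\to\mathbb R$, $F(x,u)=\int_0^uf(x,s)\,ds$, and let $L=-\frac{d^2}{dx^2}+V$ be the self-adjoint operator in $L^2(\mathbb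 R)$ defined by the form $(Lu,v)=\int(u'v'+Vuv)\,dx$ with form domain $H^1$. Assume: 1. $V$ is Stepanov almost periodic and $0\notin\sigma(L)$; if $\chi=-1$, then also $\sigma(L)\cap(-\infty,0)\ne\emptyset$. 2. For a.e. $x$, $f(x,\cdot)$ is continuously differentiable; $F$, $f$ and $f_u$ are strictly Stepanov almost periodic; for every $u\neq0$ there is $\delta>0$ with $F(x,u)\ge\delta$ for a.e. $x$. 3. $f(x,0)=f_u(x,0)=0$ for a.e. $x$, and for every $R>0$ there is $\mu(R)>0$ with $|f_u(x,u)-f_u(x,v)|\le\mu(R)|u-v|$ for a.e. $x$ and all $|u|,|v|\le R$. 4. There is $\theta\in(0,1)$ such that $0<f(x,u)u\le\theta f_u(x,u)u^2$ for a.e. $x$ and all $u\ne0$. Let $E^+$ and $E^-$ be the positive and negative subspaces of the form $(Lu,u)$ in $H^1$, that is, the intersections of $H^1$ with the spectral subspaces of $L$ for $(0,\infty)$ and $(-\infty,0)$. If $\chi=1$, put $E=E^-$ and $$J(u)=\tfrac12(Lu,u)-\int_{\mathbb R}F(x,u(x))\,dx,\qquad u\in H^1;$$ if $\chi=-1$,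 put $E=E^+$ and $J(u)=-\tfrac12(Lu,u)-\int_{\mathbb R}F(x,u(x))\,dx$ (the negative of the functional $\frac12(Lu,u)-\chi\int F(x,u)\,dx$ associated with $-u''+Vu=\chi f(x,u)$). Let $$\mathcal N=\{u\in H^1\setminus\{0\}:\ J'(u)u=0,\ J'(u)v=0\ \ \forall v\in E\},\qquad m=\inf_{\mathcal N}J .$$ For $u\in\mathcal N$ let $\nabla_\tau J(u)$ be the $H^1$-orthogonal projection of the gradient $\nabla J(u)\in H^1$ to the tangent space of $\mathcal N$ at $u$. A *Palais–Smale sequence for $J$ at level $c$* is a sequence $u_n\in H^1$ with $J(u_n)\to c$ and $J'(u_n)\to0$ in $H^{-1}$, the dual of $H^1$; a *Palais–Smale sequence for $J|_{\mathcal N}$ at level $c$* is a sequence $u_n\in\mathcal N$ with $J(u_n)\to c$ and $\nabla_\tau J(u_n)\to0$ in $H^1$. **Proposition.** $J$ is differentiable on $H^1$, $\mathcal N\neq\emptyset$, and $m$ is finite. For every $\varepsilon>0$ there are $c\in[m,m+\varepsilon]$ and a sequence $(u_n)$ that is a Palais–Smale sequence for $J|_{\mathcal N}$ at level $c$ and also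 a Palais–Smale sequence for $J$ at level $c$, and that satisfies $$\lim_{n\to\infty}\|u_{n+1}-u_n\|=0 .$$ Moreover, $u_n=\zeta(t_n)$ for a sequence $t_n\ge0$ with $t_n\to\infty$ and a solution $\zeta:[0,\infty)\to\mathcal N$ of the negative tangential gradient flow $\zeta'(t)=-\nabla_\tau J(\zeta(t))$, $t\ge0$. -/

import Mathlib

open MeasureTheory Filter Set
open scoped Topology ENNReal

noncomputable section

namespace GapSoliton

/-! ### Stepanov boundedness and almost periodicity -/

/-- `sup_t ∫_t^{t+1} w`, as an extended nonnegative number. -/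
def bsNorm (w : ℝ → ℝ≥0∞) : ℝ≥0∞ :=
  ⨆ t : ℝ, ∫⁻ x in Icc t (t + 1), w x

/-- The space `BS(ℝ)` of Stepanov bounded functions. -/
def StepanovBounded (W : ℝ → ℝ) : Prop :=
  LocallyIntegrable W volume ∧ bsNorm (fun x => ‖W x‖ₑ) < ∞

/-- `W` is Stepanov almost periodic: `W ∈ BS(ℝ)`, and every sequence of shifts of `W` has a
subsequence that converges in `BS(ℝ)`. -/
def StepanovAlmostPeriodic (W : ℝ → ℝ) : Prop :=
  StepanovBounded W ∧
    ∀ z : ℕ → ℝ, ∃ φ : ℕ → ℕ, StrictMono φ ∧ ∃ Wh : ℝ → ℝ, StepanovBounded Wh ∧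
      Tendsto (fun k => bsNorm (fun x => ‖W (x + z (φ k)) - Wh x‖ₑ)) atTop (𝓝 0)

/-- Carathéodory functions `g(x, s)`. -/
def Caratheodory (g : ℝ → ℝ → ℝ) : Prop :=
  (∀ᵐ x : ℝ, Continuous (g x)) ∧ ∀ s : ℝ, AEMeasurable (fun x => g x s) volume

/-- `‖g‖_R`, the `BS`-norm of `x ↦ sup_{|s| ≤ R} |g(x, s)|`. -/
def bsSupNorm (R : ℝ) (g : ℝ → ℝ → ℝ) : ℝ≥0∞ :=
  bsNorm (fun x => ⨆ s ∈ Icc (-R) R, ‖g x s‖ₑ)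

/-- `g(x, s)` is strictly Stepanov almost periodic in `x`. -/
def StrictlyStepanovAlmostPeriodic (g : ℝ → ℝ → ℝ) : Prop :=
  Caratheodory g ∧ (∀ R : ℝ, 0 < R → bsSupNorm R g < ∞) ∧
    ∀ z : ℕ → ℝ, ∃ φ : ℕ → ℕ, StrictMono φ ∧ ∃ gh : ℝ → ℝ → ℝ,
      Caratheodory gh ∧ (∀ R : ℝ, 0 < R → bsSupNorm R gh < ∞) ∧
      ∀ R : ℝ, 0 < R →
        Tendsto (fun k => bsSupNorm R (fun x s => g (x + z (φ k)) s - gh x s)) atTop (𝓝 0)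

/-! ### The Sobolev space `H¹(ℝ)` -/

/-- The real space `L²(ℝ)`. -/
abbrev L2 : Type := Lp ℝ 2 (volume : Measure ℝ)

/-- `g` is the weak derivative of `u`. -/
def IsWeakDeriv (u g : ℝ → ℝ) : Prop :=
  ∀ φ : ℝ → ℝ, ContDiff ℝ (⊤ : ℕ∞) φ → HasCompactSupport φ →
    ∫ x, u x * deriv φ x = -∫ x, g x * φ x

theorem integral_eq_inner {ψ : ℝ → ℝ} (hψ : MemLp ψ 2 (volume : Measure ℝ)) (u : L2) :
    ∫ x, u x * ψ x = inner ℝ (hψ.toLp ψ) u := by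
  rw [L2.inner_def]
  refine integral_congr_ae ?_
  filter_upwards [hψ.coeFn_toLp] with x hx
  simp [hx]

theorem isWeakDeriv_iff (u g : L2) : IsWeakDeriv u g ↔
    ∀ (φ : ℝ → ℝ) (h : ContDiff ℝ (⊤ : ℕ∞) φ) (hc : HasCompactSupport φ),
      inner ℝ (((h.continuous_deriv (by simp)).memLp_of_hasCompactSupport
          (p := 2) (μ := volume) hc.deriv).toLp (deriv φ)) u +
        inner ℝ ((h.continuous.memLp_of_hasCompactSupport (p := 2) (μ := volume) hc).toLp φ) g
        = 0 := by
  refine forall_congr' fun φ => forall_congr' fun h => forall_congr' fun hc => ?_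
  rw [← integral_eq_inner, ← integral_eq_inner, eq_neg_iff_add_eq_zero]

/-- The graph of the weak derivative in `L²(ℝ) × L²(ℝ)`: all pairs `(u, u')`. -/
def h1Submodule : Submodule ℝ (WithLp 2 (L2 × L2)) where
  carrier := {p | IsWeakDeriv p.fst p.snd}
  zero_mem' := by
    simp only [mem_ofPred_eq, isWeakDeriv_iff]
    intro φ h hc
    simp
  add_mem' := by
    intro p q hp hq
    simp only [mem_ofPred_eq, isWeakDeriv_iff] at hp hq ⊢
    intro φ h hc
    have h1 := hp φ h hc
    have h2 := hq φ h hc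
    simp only [WithLp.add_fst, WithLp.add_snd, inner_add_right]
    linarith
  smul_mem' := by
    intro c p hp
    simp only [mem_ofPred_eq, isWeakDeriv_iff] at hp ⊢
    intro φ h hc
    have h1 := hp φ h hc
    simp only [WithLp.smul_fst, WithLp.smul_snd, real_inner_smul_right]
    rw [← mul_add, h1, mul_zero]

/-- The Sobolev space `H¹(ℝ)`, realized as the graph of the weak derivative, so that
`⟪u, v⟫ = ∫ u v + ∫ u' v'`. -/
abbrev H1 : Type := h1Submodule

theorem isClosed_h1Submodule : IsClosed (h1Submodule : Set (WithLp 2 (L2 × L2))) := by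
  have : (h1Submodule : Set (WithLp 2 (L2 × L2))) =
      {p : WithLp 2 (L2 × L2) | IsWeakDeriv p.fst p.snd} := rfl
  rw [this]
  simp only [isWeakDeriv_iff, ofPred_forall]
  refine isClosed_iInter fun φ => isClosed_iInter fun h => isClosed_iInter fun hc => ?_
  have c1 : Continuous fun p : WithLp 2 (L2 × L2) => p.fst :=
    continuous_fst.comp (WithLp.prod_continuous_ofLp 2 L2 L2)
  have c2 : Continuous fun p : WithLp 2 (L2 × L2) => p.snd :=
    continuous_snd.comp (WithLp.prod_continuous_ofLp 2 L2 L2)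
  exact isClosed_eq ((continuous_const.inner c1).add (continuous_const.inner c2))
    continuous_const

instance : CompleteSpace H1 := isClosed_h1Submodule.completeSpace_coe

/-- The `L²` function underlying an element of `H¹(ℝ)`. -/
def H1.fn (u : H1) : L2 := (u : WithLp 2 (L2 × L2)).fst

/-- The weak derivative of an element of `H¹(ℝ)`. -/
def H1.der (u : H1) : L2 := (u : WithLp 2 (L2 × L2)).snd

/-! ### The Schrödinger operator `L = -d²/dx² + V` -/

/-- The quadratic (bilinear) form of `L`, with form domain `H¹(ℝ)`. -/
def schrodingerForm (V : ℝ → ℝ) (u v : H1) : ℝ :=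
  ∫ x, (u.der x * v.der x + V x * u.fn x * v.fn x)

/-- The graph of the self-adjoint operator `L` in `L²(ℝ)` associated with the form: `u` lies in
the domain of `L` and `L u = w`. -/
def SchrodingerGraph (V : ℝ → ℝ) (u w : L2) : Prop :=
  ∃ U : H1, U.fn = u ∧ ∀ v : H1, schrodingerForm V U v = inner ℝ w v.fn

/-- The real resolvent set of `L`: those `r` for which `L - r` has a bounded everywhere defined
two-sided inverse `T`. -/
def schrodingerResolventSet (V : ℝ → ℝ) : Set ℝ :=
  {r | ∃ T : L2 →L[ℝ] L2,
    (∀ w : L2, SchrodingerGraph V (T w) (w + r • T w)) ∧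
    ∀ u w : L2, SchrodingerGraph V u w → T (w - r • u) = u}

/-- The spectrum `σ(L)`. As `L` is self-adjoint and has real coefficients, its spectrum is
contained in `ℝ` and is the complement of the real resolvent set. -/
def schrodingerSpectrum (V : ℝ → ℝ) : Set ℝ := (schrodingerResolventSet V)ᶜ

/-- The elements of `H¹(ℝ)` that are `L²`-orthogonal to `X`. -/
def l2Orthogonal (X : Submodule ℝ H1) : Submodule ℝ H1 where
  carrier := {v | ∀ u ∈ X, inner ℝ u.fn v.fn = (0 : ℝ)}
  zero_mem' := by
    intro u _
    simp [H1.fn]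
  add_mem' := by
    intro v w hv hw u hu
    have h1 := hv u hu
    have h2 := hw u hu
    simp only [H1.fn, Submodule.coe_add, WithLp.add_fst, inner_add_right] at h1 h2 ⊢
    linarith
  smul_mem' := by
    intro c v hv u hu
    have h1 := hv u hu
    simp only [H1.fn, Submodule.coe_smul, WithLp.smul_fst, real_inner_smul_right] at h1 ⊢
    rw [h1, mul_zero]

/-- `X` reduces the form of `L`: `H¹(ℝ)` is the sum of `X` and its `L²`-orthogonal complement, and
the two summands are orthogonal with respect to the form. -/
def ReducesForm (V : ℝ → ℝ) (X : Submodule ℝ H1) : Prop :=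
  X ⊔ l2Orthogonal X = ⊤ ∧ ∀ u ∈ X, ∀ v ∈ l2Orthogonal X, schrodingerForm V u v = 0

/-- The subspaces `E⁺` (for `σ = 1`) and `E⁻` (for `σ = -1`) of the form `(L u, u)`: the largest
subspace of `H¹(ℝ)` that reduces the form and on which `σ (L u, u)` is positive definite. By the
spectral theorem this is the intersection of `H¹(ℝ)` with the spectral subspace of `L` for
`(0, ∞)`, respectively `(-∞, 0)`. -/
def signSubspace (V : ℝ → ℝ) (σ : ℝ) : Submodule ℝ H1 :=
  sSup {X | ReducesForm V X ∧ ∀ u ∈ X, u ≠ 0 → 0 < σ * schrodingerForm V u u}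

/-! ### The energy functional and the generalized Nehari manifold -/

/-- `F(x, s) = ∫_0^s f(x, t) dt`. -/
def primitive (f : ℝ → ℝ → ℝ) (x s : ℝ) : ℝ := ∫ t in (0 : ℝ)..s, f x t

/-- `J(u) = (1/2) (L u, u) - χ ∫ F(x, u(x)) dx`. -/
def energy (V : ℝ → ℝ) (f : ℝ → ℝ → ℝ) (χ : ℝ) (u : H1) : ℝ :=
  1 / 2 * schrodingerForm V u u - χ * ∫ x, primitive f x (u.fn x)

/-- The functional under study: `J` if `χ = 1`, and `-J` if `χ = -1`. -/
def signedEnergy (V : ℝ → ℝ) (f : ℝ → ℝ → ℝ) (χ : ℝ) (u : H1) : ℝ :=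
  χ * energy V f χ u

/-- The generalized Nehari manifold; the subspace is `E⁻` if `χ = 1`, and `E⁺` if `χ = -1`. -/
def nehariManifold (V : ℝ → ℝ) (f : ℝ → ℝ → ℝ) (χ : ℝ) : Set H1 :=
  {u | u ≠ 0 ∧ fderiv ℝ (signedEnergy V f χ) u u = 0 ∧
    ∀ v ∈ signSubspace V (-χ), fderiv ℝ (signedEnergy V f χ) u v = 0}

/-- The ground level `m`, the infimum of the functional over the Nehari manifold. -/
def groundLevel (V : ℝ → ℝ) (f : ℝ → ℝ → ℝ) (χ : ℝ) : ℝ :=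
  sInf (signedEnergy V f χ '' nehariManifold V f χ)

/-! ### Palais–Smale sequences -/

/-- The tangent space at `u` to a subset `N` of `H¹(ℝ)`: the closed linear span of all tangent
directions to `N` at `u`. For a `C¹` submanifold this is the usual tangent space. -/
def tangentSpaceAt (N : Set H1) (u : H1) : Submodule ℝ H1 :=
  (Submodule.span ℝ (tangentConeAt ℝ N u)).topologicalClosure

instance (N : Set H1) (u : H1) : CompleteSpace (tangentSpaceAt N u) :=
  (Submodule.isClosed_topologicalClosure _).completeSpace_coe

/-- The tangential gradient `∇_τ J(u)`: the orthogonal projection of `∇ J(u)` to the tangent space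
of `N` at `u`. -/
def tangentialGradient (J : H1 → ℝ) (N : Set H1) (u : H1) : H1 :=
  (tangentSpaceAt N u).starProjection (gradient J u)

/-- `u` is a Palais–Smale sequence for `J` at level `c`. -/
def IsPalaisSmale (J : H1 → ℝ) (c : ℝ) (u : ℕ → H1) : Prop :=
  Tendsto (fun n => J (u n)) atTop (𝓝 c) ∧
    Tendsto (fun n => fderiv ℝ J (u n)) atTop (𝓝 0)

/-- `u` is a Palais–Smale sequence for the restriction of `J` to `N` at level `c`. -/
def IsPalaisSmaleOn (J : H1 → ℝ) (N : Set H1) (c : ℝ) (u : ℕ → H1) : Prop :=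
  (∀ n, u n ∈ N) ∧ Tendsto (fun n => J (u n)) atTop (𝓝 c) ∧
    Tendsto (fun n => tangentialGradient J N (u n)) atTop (𝓝 0)

/-- `ζ : [0, ∞) → N` is a trajectory of the negative tangential gradient flow of `J` on `N`. -/
def IsNegativeGradientTrajectory (J : H1 → ℝ) (N : Set H1) (ζ : ℝ → H1) : Prop :=
  ∀ t : ℝ, 0 ≤ t → ζ t ∈ N ∧
    HasDerivWithinAt ζ (-tangentialGradient J N (ζ t)) (Ici 0) t

end GapSoliton

end

open GapSoliton

/-! ### Inverse square roots and the sign of a symmetric operator on a real Hilbert space -/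

/-! This is Nehari's method for a strongly indefinite functional. Let `B` be the bounded symmetric
operator on H¹ that represents χ(Lu, v). As χ² = 1, both signs lead to J(u) = ½⟨Bu, u⟩ − ∫F(x, u).
Since 0 is not in σ(L), a bounded involution `T` splits H¹ into a part on which `B` is positive
definite and the part E on which it is negative definite (`exists_form_sign`,
`exists_spectral_involution`). This involution is the sign of an operator, built from the binomial
series of (1 − x)^(-1/2).

Apart from 0, 𝒩 is the zero set of the map u ↦ (P_E ∇J(u), ⟨∇J(u), u⟩) into the Hilbert space E ⊕ ℝ.
Call its derivative Γ. Superlinearity makes J''(u) negative definite on E ⊕ ℝu at points u of 𝒩,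
uniformly below each energy level (`inner_hessian_le`, `exists_level_bounds`). This has two
consequences. First, Γ is uniformly surjective near such a part of 𝒩, so the tangent space is ker Γ,
and the projections onto ker Γ are Lipschitz. Second, 𝒩 is a natural constraint: ∇J − ∇_τJ = Γ*k for
some k = (v, s), and pairing with v + su, which is orthogonal to ∇J(u), bounds ‖k‖ and hence ‖∇J‖ by
a multiple of ‖∇_τJ‖. So a Palais–Smale sequence on 𝒩 of bounded energy is one for J.

The sequence is read off a trajectory that starts in 𝒩 with energy below m + ε
(`exists_palaisSmale_flow`). The tangential gradient, cut off away from 𝒩, extends to a globally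
bounded Lipschitz field, so the flow is global. It preserves the constraint, lowers the energy and
cannot reach 0. The energy converges to some c, and the mean value theorem gives times t_n in (n, n
+ 1) at which ‖∇_τJ‖² is the energy drop over that unit of time. The length of the trajectory
between t_n and t_{n+1} is controlled by the energy drop over a time of at most 2, so consecutive
distances tend to 0.

That 𝒩 is not empty follows by maximizing J over a half-space {su + v : s ≥ 0, v ∈ E} with Tu = u ≠
0 (`nehariSet_nonempty`): J is nonpositive for large s because F is superquadratic, positive
somewhere because F is cubically small at 0, and uniformly concave in v, which makes maximizing
sequences converge. -/

/-- The Taylor coefficients of `(1 - x)^(-1/2)`. -/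
noncomputable def invSqrtCoeff (n : ℕ) : ℝ := (n.centralBinom : ℝ) / 4 ^ n

theorem invSqrtCoeff_zero : invSqrtCoeff 0 = 1 := by simp [invSqrtCoeff]

theorem invSqrtCoeff_nonneg (n : ℕ) : 0 ≤ invSqrtCoeff n := by
  unfold invSqrtCoeff; positivity

theorem invSqrtCoeff_le_one (n : ℕ) : invSqrtCoeff n ≤ 1 := by
  unfold invSqrtCoeff
  rw [div_le_one (by positivity)]
  exact_mod_cast n.centralBinom_le_four_pow

/-- The differential equation (1 − x) y' = y / 2 of y = (1 − x)^(-1/2), read off coefficientwise. -/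
theorem succ_mul_invSqrtCoeff_succ (n : ℕ) :
    ((n : ℝ) + 1) * invSqrtCoeff (n + 1) = ((n : ℝ) + 1 / 2) * invSqrtCoeff n := by
  have h : ((n : ℝ) + 1) * ((n + 1).centralBinom : ℝ) =
      2 * (2 * (n : ℝ) + 1) * (n.centralBinom : ℝ) := by
    exact_mod_cast n.succ_mul_centralBinom_succ
  unfold invSqrtCoeff
  rw [pow_succ]
  field_simp
  linarith

/-- The square of the series is the geometric series. By symmetry, weighting the convolution by the
first index multiplies it by n / 2; together with the recursion for the coefficients this shows that
the convolution does not depend on n. -/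
theorem sum_antidiagonal_invSqrtCoeff (n : ℕ) :
    ∑ p ∈ Finset.HasAntidiagonal.antidiagonal n, invSqrtCoeff p.1 * invSqrtCoeff p.2 = 1 := by
  have key : ∀ n : ℕ, ∑ p ∈ Finset.HasAntidiagonal.antidiagonal n, (p.1 : ℝ) * (invSqrtCoeff p.1 *
      invSqrtCoeff p.2) =
      n / 2 * ∑ p ∈ Finset.HasAntidiagonal.antidiagonal n, invSqrtCoeff p.1 * invSqrtCoeff p.2 := by
    intro n
    have h1 : ∑ p ∈ Finset.HasAntidiagonal.antidiagonal n, (p.1 : ℝ) * (invSqrtCoeff p.1 * invSqrtCoeff p.2) =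
        ∑ p ∈ Finset.HasAntidiagonal.antidiagonal n, (p.2 : ℝ) * (invSqrtCoeff p.1 * invSqrtCoeff p.2) := by
      rw [← Finset.Nat.sum_antidiagonal_swap]
      refine Finset.sum_congr rfl fun p _ => ?_
      simp only [Prod.fst_swap, Prod.snd_swap]
      ring
    have h2 : ∑ p ∈ Finset.HasAntidiagonal.antidiagonal n, (p.1 : ℝ) * (invSqrtCoeff p.1 * invSqrtCoeff p.2) +
        ∑ p ∈ Finset.HasAntidiagonal.antidiagonal n, (p.2 : ℝ) * (invSqrtCoeff p.1 * invSqrtCoeff p.2) =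
        n * ∑ p ∈ Finset.HasAntidiagonal.antidiagonal n, invSqrtCoeff p.1 * invSqrtCoeff p.2 := by
      rw [← Finset.sum_add_distrib, Finset.mul_sum]
      refine Finset.sum_congr rfl fun p hp => ?_
      rw [← (Finset.HasAntidiagonal.mem_antidiagonal.1 hp)]
      push_cast
      ring
    linarith
  induction n with
  | zero => simp [invSqrtCoeff_zero]
  | succ n ih =>
    have h1 := key (n + 1)
    rw [Finset.Nat.sum_antidiagonal_succ] at h1
    have h3 : ∑ p ∈ Finset.HasAntidiagonal.antidiagonal n, ((p.1 + 1 : ℕ) : ℝ) * (invSqrtCoeff (p.1 + 1) *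
        invSqrtCoeff p.2) = ∑ p ∈ Finset.HasAntidiagonal.antidiagonal n, (p.1 : ℝ) * (invSqrtCoeff p.1 *
      invSqrtCoeff p.2) +
        1 / 2 * ∑ p ∈ Finset.HasAntidiagonal.antidiagonal n, invSqrtCoeff p.1 * invSqrtCoeff p.2 := by
      rw [Finset.mul_sum, ← Finset.sum_add_distrib]
      refine Finset.sum_congr rfl fun p _ => ?_
      have := succ_mul_invSqrtCoeff_succ p.1
      push_cast
      rw [← mul_assoc, this]
      ring
    simp only [Nat.cast_zero, zero_mul, zero_add] at h1
    rw [h3, key n, ih] at h1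
    push_cast at h1
    have : (n : ℝ) + 1 ≠ 0 := by positivity
    field_simp at h1
    linarith

section Hilbert

variable {H : Type*} [NormedAddCommGroup H] [InnerProductSpace ℝ H] [CompleteSpace H]

/-- A bounded operator is symmetric with respect to the inner product. -/
def SymmOp (T : H →L[ℝ] H) : Prop := ∀ x y, inner ℝ (T x) y = inner ℝ x (T y)

theorem SymmOp.pow {T : H →L[ℝ] H} (hT : SymmOp T) (n : ℕ) : SymmOp (T ^ n) := by
  induction n with
  | zero => intro x y; simp
  | succ n ih =>
    intro x y
    rw [pow_succ, mul_apply_eq_comp, ih, hT, ← mul_apply_eq_comp,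
      ← pow_succ', pow_succ]

/-- Split the power as T^m T^m or T^m T T^m and move one factor T^m to the other side. -/
theorem SymmOp.inner_pow_nonneg {T : H →L[ℝ] H} (hT : SymmOp T)
    (h : ∀ x, 0 ≤ inner ℝ (T x) x) (n : ℕ) (x : H) : 0 ≤ inner ℝ ((T ^ n) x) x := by
  rcases Nat.even_or_odd' n with ⟨m, rfl | rfl⟩
  · rw [two_mul, pow_add, mul_apply_eq_comp, hT.pow m]
    exact real_inner_self_nonneg
  · have : T ^ (2 * m + 1) = T ^ m * (T * T ^ m) := by
      rw [← pow_succ', ← pow_add]; congr 1; omega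
    rw [this, mul_apply_eq_comp, hT.pow m, mul_apply_eq_comp]
    exact h _

/-- A positive definite symmetric operator `M` has an inverse square root. -/
theorem exists_inverse_sqrt {M : H →L[ℝ] H} (hM : SymmOp M) {c : ℝ} (hc : 0 < c)
    (hpos : ∀ x, c * ‖x‖ ^ 2 ≤ inner ℝ (M x) x) :
    ∃ W : H →L[ℝ] H, SymmOp W ∧ (∃ d > 0, ∀ x, d * ‖x‖ ^ 2 ≤ inner ℝ (W x) x) ∧
      W * W * M = 1 ∧ ∀ T : H →L[ℝ] H, Commute T M → Commute T W := by
  -- `C ≥ ‖M‖` makes X = 1 − M/C nonnegative, and `c * C ≥ ‖M‖ ^ 2` makes it a strict contraction,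
  -- with ‖X‖² ≤ 1 − c/C, so the series in X converges.
  set C : ℝ := ‖M‖ ^ 2 / c + ‖M‖ + 1 with hC
  have hC0 : 0 < C := by positivity
  have hCM : ‖M‖ ≤ C := by
    have : 0 ≤ ‖M‖ ^ 2 / c := by positivity
    linarith
  have hCc : ‖M‖ ^ 2 ≤ c * C := by
    have h1 : ‖M‖ ^ 2 / c ≤ C := by linarith [norm_nonneg M]
    rw [div_le_iff₀ hc] at h1
    linarith
  set X : H →L[ℝ] H := 1 - C⁻¹ • M with hX
  have hXs : SymmOp X := by
    intro x y
    simp only [hX, sub_apply, one_apply_eq_self,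
      smul_apply, inner_sub_left, inner_sub_right, real_inner_smul_left,
      real_inner_smul_right, hM x y]
  have hXnn : ∀ x, 0 ≤ inner ℝ (X x) x := by
    intro x
    simp only [hX, sub_apply, one_apply_eq_self,
      smul_apply, inner_sub_left, real_inner_smul_left,
      real_inner_self_eq_norm_sq]
    have h1 : inner ℝ (M x) x ≤ C * ‖x‖ ^ 2 := by
      calc inner ℝ (M x) x ≤ ‖M x‖ * ‖x‖ := real_inner_le_norm _ _
        _ ≤ (‖M‖ * ‖x‖) * ‖x‖ := by gcongr; exact M.le_opNorm x
        _ ≤ (C * ‖x‖) * ‖x‖ := by gcongr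
        _ = _ := by ring
    have : C⁻¹ * inner ℝ (M x) x ≤ C⁻¹ * (C * ‖x‖ ^ 2) := by gcongr
    rw [inv_mul_cancel_left₀ hC0.ne'] at this
    linarith
  have hXsq : ∀ x, ‖X x‖ ^ 2 ≤ (1 - c / C) * ‖x‖ ^ 2 := by
    intro x
    have h1 : ‖X x‖ ^ 2 = ‖x‖ ^ 2 - 2 * (C⁻¹ * inner ℝ (M x) x) + C⁻¹ ^ 2 * ‖M x‖ ^ 2 := by
      simp only [hX, sub_apply, one_apply_eq_self,
        smul_apply]
      rw [norm_sub_sq_real, real_inner_smul_right, norm_smul, real_inner_comm, mul_pow]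
      simp
    have h2 : C⁻¹ * (c * ‖x‖ ^ 2) ≤ C⁻¹ * inner ℝ (M x) x := by gcongr; exact hpos x
    have h3 : ‖M x‖ ^ 2 ≤ c * C * ‖x‖ ^ 2 := by
      calc ‖M x‖ ^ 2 ≤ (‖M‖ * ‖x‖) ^ 2 := by gcongr; exact M.le_opNorm x
        _ = ‖M‖ ^ 2 * ‖x‖ ^ 2 := by ring
        _ ≤ _ := by gcongr
    have h4 : C⁻¹ ^ 2 * ‖M x‖ ^ 2 ≤ C⁻¹ ^ 2 * (c * C * ‖x‖ ^ 2) := by gcongr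
    have h5 : C⁻¹ ^ 2 * (c * C * ‖x‖ ^ 2) = C⁻¹ * (c * ‖x‖ ^ 2) := by field_simp
    have h6 : (1 - c / C) * ‖x‖ ^ 2 = ‖x‖ ^ 2 - C⁻¹ * (c * ‖x‖ ^ 2) := by field_simp
    rw [h1, h6]
    linarith
  obtain ⟨q, hq0, hq1, hXq⟩ : ∃ q : ℝ, 0 ≤ q ∧ q < 1 ∧ ‖X‖ ≤ q := by
    refine ⟨Real.sqrt (1 - c / C), Real.sqrt_nonneg _, ?_, ?_⟩
    · rw [Real.sqrt_lt' one_pos]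
      have : 0 < c / C := by positivity
      linarith
    · refine X.opNorm_le_bound (Real.sqrt_nonneg _) fun x => ?_
      rw [← Real.sqrt_sq (norm_nonneg (X x)), ← Real.sqrt_sq (norm_nonneg x),
        ← Real.sqrt_mul' _ (by positivity)]
      exact Real.sqrt_le_sqrt (hXsq x)
  have hsum : Summable fun n => ‖invSqrtCoeff n • X ^ n‖ := by
    refine Summable.of_nonneg_of_le (fun _ => norm_nonneg _) (fun n => ?_)
      (summable_geometric_of_lt_one hq0 hq1)
    rw [norm_smul, Real.norm_of_nonneg (invSqrtCoeff_nonneg n)]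
    have h1 : ‖X ^ n‖ ≤ q ^ n := by
      rcases Nat.eq_zero_or_pos n with rfl | hn
      · exact ContinuousLinearMap.norm_id_le
      · exact (norm_pow_le' X hn).trans (by gcongr)
    calc invSqrtCoeff n * ‖X ^ n‖ ≤ 1 * q ^ n := by
          gcongr
          exact invSqrtCoeff_le_one n
      _ = q ^ n := one_mul _
  have hsum' : Summable fun n => invSqrtCoeff n • X ^ n := hsum.of_norm
  set W₀ : H →L[ℝ] H := ∑' n, invSqrtCoeff n • X ^ n with hW₀
  have hsumX : Summable fun n : ℕ => X ^ n := by
    refine Summable.of_norm_bounded (summable_geometric_of_lt_one hq0 hq1) fun n => ?_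
    rcases Nat.eq_zero_or_pos n with rfl | hn
    · exact ContinuousLinearMap.norm_id_le
    · exact (norm_pow_le' X hn).trans (by gcongr)
  have hWW : W₀ * W₀ = ∑' n : ℕ, X ^ n := by
    rw [hW₀, tsum_mul_tsum_eq_tsum_sum_antidiagonal_of_summable_norm hsum hsum]
    refine tsum_congr fun n => ?_
    have : ∀ p ∈ Finset.HasAntidiagonal.antidiagonal n, (invSqrtCoeff p.1 • X ^ p.1) *
        (invSqrtCoeff p.2 • X ^ p.2) = (invSqrtCoeff p.1 * invSqrtCoeff p.2) • X ^ n := by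
      intro p hp
      rw [smul_mul_smul_comm, ← pow_add, Finset.HasAntidiagonal.mem_antidiagonal.1 hp]
    rw [Finset.sum_congr rfl this, ← Finset.sum_smul, sum_antidiagonal_invSqrtCoeff, one_smul]
  have hinv : W₀ * W₀ * (C⁻¹ • M) = 1 := by
    have : C⁻¹ • M = 1 - X := by simp [hX]
    rw [this, hWW]
    have h := hsumX.tsum_pow_mul_one_sub
    exact h
  have happ : ∀ x, HasSum (fun n => invSqrtCoeff n • (X ^ n) x) (W₀ x) := by
    intro x
    have := hsum'.hasSum.mapL (ContinuousLinearMap.apply ℝ H x)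
    simpa using this
  have hsymm : SymmOp W₀ := by
    intro x y
    have h1 := (happ x).mapL (innerSL ℝ y)
    have h2 := (happ y).mapL (innerSL ℝ x)
    simp only [innerSL_apply_apply, real_inner_smul_right] at h1 h2
    rw [real_inner_comm]
    refine h1.unique ?_
    convert h2 using 2 with n
    rw [real_inner_comm, hXs.pow n]
  -- Every term of the series is a nonnegative form since X is; the constant term alone contributes
  -- ‖x‖².
  have hpos₀ : ∀ x, ‖x‖ ^ 2 ≤ inner ℝ (W₀ x) x := by
    intro x
    have h1 := (happ x).mapL (innerSL ℝ x)
    simp only [innerSL_apply_apply, real_inner_smul_right] at h1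
    rw [real_inner_comm]
    have h2 := h1.summable.sum_le_tsum {0} (fun n _ => mul_nonneg (invSqrtCoeff_nonneg n) (by
      rw [real_inner_comm]; exact hXs.inner_pow_nonneg hXnn n x))
    rw [h1.tsum_eq] at h2
    simpa [invSqrtCoeff_zero] using h2
  -- `W₀` is the inverse square root of M/C; the factor `s` rescales it to that of M.
  set s : ℝ := Real.sqrt C⁻¹ with hs
  have hs0 : 0 < s := Real.sqrt_pos.2 (by positivity)
  have hss : s * s = C⁻¹ := Real.mul_self_sqrt (by positivity)
  refine ⟨s • W₀, ?_, ⟨s, hs0, ?_⟩, ?_, ?_⟩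
  · intro x y
    simp only [smul_apply, real_inner_smul_left, real_inner_smul_right,
      hsymm x y]
  · intro x
    simp only [smul_apply, real_inner_smul_left]
    gcongr
    exact hpos₀ x
  · rw [smul_mul_smul_comm, hss, ← hinv]
    simp
  · intro T hT
    have hTX : Commute T X := (Commute.one_right T).sub_right (hT.smul_right _)
    refine Commute.smul_right ?_ s
    rw [commute_iff_eq, hW₀, ← hsum'.tsum_mul_left, ← hsum'.tsum_mul_right]
    refine tsum_congr fun n => ?_
    exact ((hTX.pow_right n).smul_right _).eq

/-- The sign of a symmetric operator `B` that is bounded below. -/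
theorem exists_sign {B : H →L[ℝ] H} (hB : SymmOp B) {c : ℝ} (hc : 0 < c)
    (hbelow : ∀ x, c * ‖x‖ ≤ ‖B x‖) :
    ∃ S : H →L[ℝ] H, SymmOp S ∧ S * S = 1 ∧ (∃ d > 0, ∀ x, d * ‖x‖ ^ 2 ≤ inner ℝ (B (S x)) x) ∧
      ∀ T : H →L[ℝ] H, Commute T B → Commute T S := by
  have hBB : SymmOp (B * B) := by
    intro x y
    simp only [mul_apply_eq_comp]
    rw [hB, hB]
  obtain ⟨W, hWs, ⟨d, hd, hWpos⟩, hWM, hWc⟩ := exists_inverse_sqrt hBB (c := c ^ 2) (by positivity)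
    (fun x => by
      simp only [mul_apply_eq_comp]
      rw [hB, real_inner_self_eq_norm_sq, ← mul_pow]
      gcongr
      exact hbelow x)
  have hBW : Commute B W := hWc B ((Commute.refl B).mul_right (Commute.refl B))
  -- The sign is B (B²)^(-1/2). Its positivity relative to `B` is that of `W` at `B x`.
  refine ⟨B * W, ?_, ?_, ⟨d * c ^ 2, by positivity, ?_⟩, ?_⟩
  · intro x y
    rw [mul_apply_eq_comp, hB, hWs, ← mul_apply_eq_comp, ← hBW.eq]
  · rw [hBW.eq, mul_assoc, ← mul_assoc B W B, hBW.eq, mul_assoc, ← mul_assoc, hWM]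
  · intro x
    rw [mul_apply_eq_comp, hB, ← mul_apply_eq_comp, hBW.eq,
      mul_apply_eq_comp]
    calc d * c ^ 2 * ‖x‖ ^ 2 = d * (c * ‖x‖) ^ 2 := by ring
      _ ≤ d * ‖B x‖ ^ 2 := by gcongr; exact hbelow x
      _ ≤ _ := hWpos _
  · intro T hT
    exact hT.mul_right (hWc T (hT.mul_right hT))

/-- Simultaneous reduction of two symmetric forms `⟪A u, v⟫` and `⟪K u, v⟫`, the first one
nondegenerate, for which `A + l K` is positive definite: the form sign of `A` relative to `K`. -/
theorem exists_form_sign {A K : H →L[ℝ] H} (hA : SymmOp A) (hK : SymmOp K) {α l c : ℝ}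
    (hα : 0 < α) (hbelow : ∀ x, α * ‖x‖ ≤ ‖A x‖) (hc : 0 < c) (hl : l ≠ 0)
    (hpos : ∀ x, c * ‖x‖ ^ 2 ≤ inner ℝ (A x) x + l * inner ℝ (K x) x) :
    ∃ S : H →L[ℝ] H, S * S = 1 ∧ (∀ x y, inner ℝ (A (S x)) y = inner ℝ (A x) (S y)) ∧
      (∀ x y, inner ℝ (K (S x)) y = inner ℝ (K x) (S y)) ∧
      (∃ d > 0, ∀ x, d * ‖x‖ ^ 2 ≤ inner ℝ (A (S x)) x) ∧
      ∀ P : H →L[ℝ] H, (∀ x y, inner ℝ (A (P x)) y = inner ℝ (A x) (P y)) →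
        (∀ x y, inner ℝ (K (P x)) y = inner ℝ (K x) (P y)) → Commute P S := by
  set M : H →L[ℝ] H := A + l • K with hMdef
  have hM : SymmOp M := by
    intro x y
    simp only [hMdef, add_apply, smul_apply,
      inner_add_left, inner_add_right, real_inner_smul_left, real_inner_smul_right, hA x y,
      hK x y]
  obtain ⟨Q, hQs, ⟨d, hd, hQpos⟩, hQM, hQc⟩ := exists_inverse_sqrt hM hc (fun x => by
    simp only [hMdef, add_apply, smul_apply,
      inner_add_left, real_inner_smul_left]
    exact hpos x)
  have hMQ : Commute M Q := hQc M (Commute.refl M)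
  -- `R` is the inverse of `Q`.
  set R : H →L[ℝ] H := Q * M with hR
  have hQR : Q * R = 1 := by rw [hR, ← mul_assoc, hQM]
  have hRQ : R * Q = 1 := by rw [hR, mul_assoc, hMQ.eq, ← mul_assoc, hQM]
  have hRs : SymmOp R := by
    intro x y
    rw [hR, mul_apply_eq_comp, hQs, hM, ← mul_apply_eq_comp, hMQ.eq]
  have hRQx : ∀ x, R (Q x) = x := fun x => by
    rw [← mul_apply_eq_comp, hRQ, one_apply_eq_self]
  have hQRx : ∀ x, Q (R x) = x := fun x => by
    rw [← mul_apply_eq_comp, hQR, one_apply_eq_self]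
  have hQlow : ∀ x, d * ‖x‖ ≤ ‖Q x‖ := by
    intro x
    rcases eq_or_ne x 0 with rfl | hx
    · simp
    · have h1 := (hQpos x).trans (real_inner_le_norm _ _)
      have h2 : 0 < ‖x‖ := norm_pos_iff.2 hx
      rw [pow_two, ← mul_assoc] at h1
      exact le_of_mul_le_mul_right h1 h2
  -- With Q = M^(-1/2) and x = Qy, the form of M becomes the inner product and the form of A becomes
  -- that of `B`. Hence Q sign(B) Q⁻¹ is symmetric for A and for M, and therefore for K because l ≠
  -- 0.
  set B : H →L[ℝ] H := Q * (A * Q) with hBdef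
  have hB : SymmOp B := by
    intro x y
    simp only [hBdef, mul_apply_eq_comp]
    rw [hQs, hA, hQs]
  obtain ⟨S, hSs, hSS, ⟨e, he, hSpos⟩, hSc⟩ := exists_sign hB (c := d * (α * d)) (by positivity)
    (fun x => by
      simp only [hBdef, mul_apply_eq_comp]
      calc d * (α * d) * ‖x‖ = d * (α * (d * ‖x‖)) := by ring
        _ ≤ d * (α * ‖Q x‖) := by gcongr; exact hQlow x
        _ ≤ d * ‖A (Q x)‖ := by gcongr; exact hbelow _
        _ ≤ _ := hQlow _)
  have hQMQ : Q * (M * Q) = 1 := by rw [hMQ.eq, ← mul_assoc, hQM]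
  have hSA : ∀ x y, inner ℝ (A (Q (S x))) (Q y) = inner ℝ (A (Q x)) (Q (S y)) := by
    intro x y
    have h1 : B (S x) = S (B x) := by
      have := hSc B (Commute.refl B)
      rw [← mul_apply_eq_comp, this.eq, mul_apply_eq_comp]
    have h2 : inner ℝ (B (S x)) y = inner ℝ (B x) (S y) := by rw [h1, hSs]
    simpa only [hBdef, mul_apply_eq_comp, hQs (A (Q (S x))) y,
      hQs (A (Q x)) (S y)] using h2
  have hSM : ∀ x y, inner ℝ (M (Q (S x))) (Q y) = inner ℝ (M (Q x)) (Q (S y)) := by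
    intro x y
    rw [← hQs, ← hQs]
    have h1 : ∀ z, Q (M (Q z)) = z := fun z => by
      simpa using congrArg (fun T : H →L[ℝ] H => T z) hQMQ
    rw [h1, h1, hSs]
  refine ⟨Q * (S * R), ?_, ?_, ?_, ?_, ?_⟩
  · calc Q * (S * R) * (Q * (S * R)) = Q * (S * ((R * Q) * (S * R))) := by
          simp only [mul_assoc]
      _ = Q * ((S * S) * R) := by rw [hRQ, one_mul, ← mul_assoc S S R]
      _ = 1 := by rw [hSS, one_mul, hQR]
  · intro x y
    have := hSA (R x) (R y)
    simpa only [mul_apply_eq_comp, hQRx] using this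
  · intro x y
    have h1 := hSA (R x) (R y)
    have h2 := hSM (R x) (R y)
    simp only [hMdef, add_apply, smul_apply,
      inner_add_left, real_inner_smul_left, hQRx] at h1 h2
    rw [h1] at h2
    have h3 := mul_left_cancel₀ hl (add_left_cancel h2)
    simpa only [mul_apply_eq_comp] using h3
  · refine ⟨e * ((‖Q‖ + 1)⁻¹) ^ 2, by positivity, fun x => ?_⟩
    have h1 := hSpos (R x)
    simp only [hBdef, mul_apply_eq_comp, Function.comp_apply] at h1
    rw [hQs, hQRx] at h1
    simp only [mul_apply_eq_comp, Function.comp_apply]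
    refine le_trans ?_ h1
    have h2 : ‖x‖ ≤ (‖Q‖ + 1) * ‖R x‖ := by
      calc ‖x‖ = ‖Q (R x)‖ := by rw [hQRx]
        _ ≤ ‖Q‖ * ‖R x‖ := Q.le_opNorm _
        _ ≤ _ := by nlinarith [norm_nonneg (R x)]
    have h3 : (‖Q‖ + 1)⁻¹ * ‖x‖ ≤ ‖R x‖ := by
      rw [inv_mul_le_iff₀ (by positivity)]
      exact h2
    calc e * ((‖Q‖ + 1)⁻¹) ^ 2 * ‖x‖ ^ 2 = e * ((‖Q‖ + 1)⁻¹ * ‖x‖) ^ 2 := by ring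
      _ ≤ _ := by gcongr
  · intro P hPA hPK
    have hPM : ∀ x y, inner ℝ (M (P x)) y = inner ℝ (M x) (P y) := by
      intro x y
      simp only [hMdef, add_apply, smul_apply, inner_add_left, real_inner_smul_left, hPA, hPK]
    have hQMQx : ∀ z, Q (M (Q z)) = z := fun z => by
      have := congrArg (fun T : H →L[ℝ] H => T z) hQMQ
      simpa using this
    have hP's : ∀ y z, inner ℝ (R (P (Q y))) z = inner ℝ y (R (P (Q z))) := by
      intro y z
      have h1 : inner ℝ (Q (M (Q (R (P (Q y)))))) z = inner ℝ (Q (M (Q y))) (R (P (Q z))) := by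
        rw [hQs, hQs, hQRx, hQRx, hPM]
      rwa [hQMQx, hQMQx] at h1
    -- Symmetry of P for M makes its conjugate Q⁻¹PQ symmetric; symmetry for A then makes this
    -- conjugate commute with QAQ, hence with the sign.
    have hcomm : Commute (R * (P * Q)) B := by
      rw [commute_iff_eq]
      ext y
      refine ext_inner_right ℝ fun z => ?_
      simp only [hBdef, mul_apply_eq_comp, Function.comp_apply]
      rw [hP's, hQs, hQRx, hQs, hQRx, hPA]
    have h1 := (hSc _ hcomm).eq
    rw [commute_iff_eq]
    calc P * (Q * (S * R)) = Q * R * (P * (Q * (S * R))) := by rw [hQR, one_mul]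
      _ = Q * ((R * (P * Q)) * S) * R := by simp only [mul_assoc]
      _ = Q * (S * R) * P * (Q * R) := by rw [h1]; simp only [mul_assoc]
      _ = Q * (S * R) * P := by rw [hQR, mul_one]

end Hilbert

/-! ### Bounded Lipschitz maps and global flows -/

/-- `f` is bounded and Lipschitz on `D`. -/
def LipBdd {H X : Type*} [NormedAddCommGroup H] [NormedAddCommGroup X] (f : H → X) (D : Set H) :
    Prop :=
  ∃ B K : ℝ, 0 ≤ B ∧ 0 ≤ K ∧ (∀ u ∈ D, ‖f u‖ ≤ B) ∧
    ∀ u ∈ D, ∀ v ∈ D, ‖f u - f v‖ ≤ K * ‖u - v‖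

namespace LipBdd

variable {H X Y Z : Type*} [NormedAddCommGroup H] [NormedAddCommGroup X] [NormedSpace ℝ X]
  [NormedAddCommGroup Y] [NormedSpace ℝ Y] [NormedAddCommGroup Z] [NormedSpace ℝ Z]
  {f : H → X} {g : H → Y} {D : Set H}

theorem mono {D' : Set H} (hf : LipBdd f D) (h : D' ⊆ D) : LipBdd f D' := by
  obtain ⟨B, K, hB, hK, h1, h2⟩ := hf
  exact ⟨B, K, hB, hK, fun u hu => h1 u (h hu), fun u hu v hv => h2 u (h hu) v (h hv)⟩

theorem const (x : X) : LipBdd (fun _ : H => x) D :=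
  ⟨‖x‖, 0, norm_nonneg _, le_rfl, fun _ _ => le_rfl, fun u _ v _ => by simp⟩

/-- Serves for the composition of operators and for the application of an operator to a vector. -/
theorem bilin (b : X →L[ℝ] Y →L[ℝ] Z) (hf : LipBdd f D) (hg : LipBdd g D) :
    LipBdd (fun u => b (f u) (g u)) D := by
  obtain ⟨B, K, hB, hK, h1, h2⟩ := hf
  obtain ⟨B', K', hB', hK', h1', h2'⟩ := hg
  refine ⟨‖b‖ * B * B', ‖b‖ * K * B' + ‖b‖ * B * K', by positivity, by positivity,
    fun u hu => ?_, fun u hu v hv => ?_⟩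
  · calc ‖b (f u) (g u)‖ ≤ ‖b‖ * ‖f u‖ * ‖g u‖ := b.le_opNorm₂ _ _
      _ ≤ _ := by gcongr; exacts [h1 u hu, h1' u hu]
  · have : b (f u) (g u) - b (f v) (g v) = b (f u - f v) (g u) + b (f v) (g u - g v) := by
      simp
    rw [this]
    calc ‖b (f u - f v) (g u) + b (f v) (g u - g v)‖
        ≤ ‖b‖ * ‖f u - f v‖ * ‖g u‖ + ‖b‖ * ‖f v‖ * ‖g u - g v‖ :=
          (norm_add_le _ _).trans (add_le_add (b.le_opNorm₂ _ _) (b.le_opNorm₂ _ _))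
      _ ≤ ‖b‖ * (K * ‖u - v‖) * B' + ‖b‖ * B * (K' * ‖u - v‖) := by
          gcongr
          exacts [h2 u hu v hv, h1' u hu, h1 v hv, h2' u hu v hv]
      _ = _ := by ring

theorem clm (b : X →L[ℝ] Y) (hf : LipBdd f D) : LipBdd (fun u => b (f u)) D := by
  obtain ⟨B, K, hB, hK, h1, h2⟩ := hf
  refine ⟨‖b‖ * B, ‖b‖ * K, by positivity, by positivity, fun u hu => ?_, fun u hu v hv => ?_⟩
  · exact (b.le_opNorm _).trans (by gcongr; exact h1 u hu)
  · rw [← map_sub, mul_assoc]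
    exact (b.le_opNorm _).trans (by gcongr; exact h2 u hu v hv)

/-- Asks only for preserved distances, so that it covers the adjoint and the Riesz map, whose types
are semilinear. -/
theorem comp_isometry {i : X → Y} (hi : ∀ x y, ‖i x - i y‖ = ‖x - y‖) (hi0 : i 0 = 0)
    (hf : LipBdd f D) : LipBdd (fun u => i (f u)) D := by
  obtain ⟨B, K, hB, hK, h1, h2⟩ := hf
  refine ⟨B, K, hB, hK, fun u hu => ?_, fun u hu v hv => ?_⟩
  · have := hi (f u) 0
    rw [hi0, sub_zero, sub_zero] at this
    exact this.le.trans (h1 u hu)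
  · exact (hi _ _).le.trans (h2 u hu v hv)

theorem add {f' : H → X} (hf : LipBdd f D) (hg : LipBdd f' D) : LipBdd (fun u => f u + f' u) D := by
  obtain ⟨B, K, hB, hK, h1, h2⟩ := hf
  obtain ⟨B', K', hB', hK', h1', h2'⟩ := hg
  refine ⟨B + B', K + K', by positivity, by positivity, fun u hu => ?_, fun u hu v hv => ?_⟩
  · exact (norm_add_le _ _).trans (add_le_add (h1 u hu) (h1' u hu))
  · rw [add_sub_add_comm, add_mul]
    exact (norm_add_le _ _).trans (add_le_add (h2 u hu v hv) (h2' u hu v hv))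

/-- Multiplication with a Lipschitz cutoff function that vanishes outside `D` makes a map globally
bounded and Lipschitz. -/
theorem cutoff (hf : LipBdd f D) {θ : H → ℝ} {L : ℝ} (hL : 0 ≤ L)
    (hθ : ∀ u v, |θ u - θ v| ≤ L * ‖u - v‖) (h01 : ∀ u, 0 ≤ θ u ∧ θ u ≤ 1)
    (h0 : ∀ u ∉ D, θ u = 0) : LipBdd (fun u => θ u • f u) univ := by
  obtain ⟨B, K, hB, hK, h1, h2⟩ := hf
  -- If one point is outside `D`, the cutoff vanishes there, so its Lipschitz bound controls its
  -- value at the other point. No connecting segment has to stay in `D`.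
  have key : ∀ u ∈ D, ∀ v, v ∉ D → ‖θ u • f u - θ v • f v‖ ≤ (K + L * B) * ‖u - v‖ := by
    intro u hu v hv
    have h3 := hθ u v
    rw [h0 v hv, sub_zero] at h3
    rw [h0 v hv, zero_smul, sub_zero, norm_smul, Real.norm_eq_abs]
    calc |θ u| * ‖f u‖ ≤ (L * ‖u - v‖) * B := by gcongr; exact h1 u hu
      _ = L * B * ‖u - v‖ := by ring
      _ ≤ _ := by gcongr; linarith
  refine ⟨B, K + L * B, hB, by positivity, fun u _ => ?_, fun u _ v _ => ?_⟩
  · by_cases hu : u ∈ D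
    · rw [norm_smul, Real.norm_of_nonneg (h01 u).1]
      calc θ u * ‖f u‖ ≤ 1 * B := by
            gcongr
            exacts [(h01 u).2, h1 u hu]
        _ = B := one_mul _
    · simp [h0 u hu, hB]
  · by_cases hu : u ∈ D <;> by_cases hv : v ∈ D
    · have : θ u • f u - θ v • f v = θ u • (f u - f v) + (θ u - θ v) • f v := by
        rw [smul_sub, sub_smul]; abel
      rw [this]
      calc ‖θ u • (f u - f v) + (θ u - θ v) • f v‖
          ≤ θ u * ‖f u - f v‖ + |θ u - θ v| * ‖f v‖ := by
            refine (norm_add_le _ _).trans ?_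
            rw [norm_smul, norm_smul, Real.norm_of_nonneg (h01 u).1, Real.norm_eq_abs]
        _ ≤ 1 * (K * ‖u - v‖) + (L * ‖u - v‖) * B := by
            gcongr
            exacts [(h01 u).2, h2 u hu v hv, hθ u v, h1 v hv]
        _ = _ := by ring
    · exact key u hu v hv
    · rw [norm_sub_rev, norm_sub_rev u v]
      exact key v hv u hu
    · simp only [h0 u hu, h0 v hv, zero_smul, sub_zero, norm_zero]
      positivity

end LipBdd

/-- A globally bounded Lipschitz vector field has solutions on `[0, ∞)`. -/
theorem exists_global_solution {H : Type*} [NormedAddCommGroup H] [NormedSpace ℝ H]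
    [CompleteSpace H] {Y : H → H} (hY : LipBdd Y univ) (u₀ : H) :
    ∃ ζ : ℝ → H, ζ 0 = u₀ ∧ ∀ t : ℝ, 0 ≤ t → HasDerivWithinAt ζ (Y (ζ t)) (Ici 0) t := by
  obtain ⟨B, K, hB, hK, h1, h2⟩ := hY
  have hLip : LipschitzWith ⟨K, hK⟩ Y :=
    LipschitzWith.of_dist_le_mul fun u v => by
      rw [dist_eq_norm, dist_eq_norm]
      exact h2 u trivial v trivial
  have hloc : ∀ n : ℕ, ∃ α : ℝ → H, α 0 = u₀ ∧
      ∀ t ∈ Icc (0 : ℝ) (n + 1), HasDerivWithinAt α (Y (α t)) (Icc 0 (n + 1)) t := by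
    intro n
    have h0 : (0 : ℝ) ∈ Icc (0 : ℝ) (n + 1) := ⟨le_rfl, by positivity⟩
    -- Speed at most B keeps the solution in the ball of radius B(n + 1) up to time n + 1, so a
    -- Picard interval of any length is available.
    have hPL : IsPicardLindelof (fun _ : ℝ => Y) (tmin := 0) (tmax := (n : ℝ) + 1) ⟨0, h0⟩ u₀
        (⟨B * (n + 1), by positivity⟩) 0 ⟨B, hB⟩ ⟨K, hK⟩ :=
      IsPicardLindelof.of_time_independent (fun x _ => h1 x trivial) hLip.lipschitzOnWith (by
        have : (0 : ℝ) ≤ n + 1 := by positivity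
        simp only [sub_zero, zero_sub, neg_zero, sub_self, NNReal.coe_zero, max_eq_left this]
        exact le_rfl)
    exact hPL.exists_eq_forall_mem_Icc_hasDerivWithinAt₀
  choose α hα0 hα using hloc
  have huniq : ∀ m n : ℕ, m ≤ n → EqOn (α m) (α n) (Icc 0 (m + 1)) := by
    intro m n hmn
    have hmn' : (m : ℝ) ≤ n := by exact_mod_cast hmn
    have hd : ∀ k : ℕ, m ≤ k → ∀ t ∈ Ico (0 : ℝ) (m + 1),
        HasDerivWithinAt (α k) (Y (α k t)) (Ici t) t := by
      intro k hk t ht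
      have hk' : (m : ℝ) ≤ k := by exact_mod_cast hk
      have h3 := hα k t ⟨ht.1, by linarith [ht.2]⟩
      refine h3.mono_of_mem_nhdsWithin ?_
      refine mem_of_superset (Icc_mem_nhdsGE (show t < (k : ℝ) + 1 by linarith [ht.2])) ?_
      exact Icc_subset_Icc_left ht.1
    refine ODE_solution_unique (v := fun _ => Y) (fun _ => hLip) ?_ (hd m le_rfl) ?_ (hd n hmn) ?_
    · exact fun t ht => (hα m t ht).continuousWithinAt
    · exact fun t ht => ((hα n t ⟨ht.1, by linarith [ht.2]⟩).continuousWithinAt).mono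
        (Icc_subset_Icc_right (by linarith))
    · rw [hα0, hα0]
  refine ⟨fun t => α ⌊t⌋₊ t, by simp [hα0], fun t ht => ?_⟩
  -- The pieces agree where they overlap. One index more than ⌊t⌋ gives a single solution on an
  -- interval that contains a neighbourhood of `t` in [0, ∞).
  set n := ⌊t⌋₊ + 1 with hn
  have htn : t < n := by rw [hn]; push_cast; exact Nat.lt_floor_add_one t
  have heq : ∀ s ∈ Ico (0 : ℝ) n, α ⌊s⌋₊ s = α n s := by
    intro s hs
    have h3 : ⌊s⌋₊ ≤ n := (Nat.floor_lt hs.1).2 hs.2 |>.le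
    exact huniq _ _ h3 ⟨hs.1, (Nat.lt_floor_add_one s).le⟩
  have h3 := hα n t ⟨ht, by linarith⟩
  have h4 : HasDerivWithinAt (α n) (Y (α n t)) (Ici 0) t := by
    refine h3.mono_of_mem_nhdsWithin ?_
    rw [mem_nhdsWithin]
    exact ⟨Iio ((n : ℝ) + 1), isOpen_Iio, by simp only [mem_Iio]; linarith,
      fun s hs => ⟨hs.2, (mem_Iio.1 hs.1).le⟩⟩
  simp only [heq t ⟨ht, htn⟩]
  refine h4.congr_of_eventuallyEq ?_ (heq t ⟨ht, htn⟩)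
  filter_upwards [self_mem_nhdsWithin, mem_nhdsWithin_of_mem_nhds (Iio_mem_nhds htn)] with s hs hs'
  exact heq s ⟨hs, hs'⟩

/-! ### Projections onto kernels of constraint derivatives, and constrained flows -/

section Constraint

variable {H K : Type*} [NormedAddCommGroup H] [InnerProductSpace ℝ H] [CompleteSpace H]
  [NormedAddCommGroup K] [InnerProductSpace ℝ K] [CompleteSpace K]

/-- The orthogonal projections onto the kernels of a family of uniformly surjective operators. -/
theorem exists_kernel_projection {Γ : H → H →L[ℝ] K} {D : Set H} (hΓ : LipBdd Γ D) {c : ℝ}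
    (hc : 0 < c) (hlow : ∀ u ∈ D, ∀ k, c * ‖k‖ ≤ ‖(Γ u).adjoint k‖) :
    ∃ P : H → H →L[ℝ] H, LipBdd P D ∧ ∀ u ∈ D, (∀ h, Γ u (P u h) = 0) ∧
      ∀ h, ∃ k, h - P u h = (Γ u).adjoint k := by
  classical
  -- R = (ΓΓ*)⁻¹ exists since ΓΓ* is positive definite; the projection will be 1 − Γ*RΓ.
  have hinv : ∀ u ∈ D, ∃ R : K →L[ℝ] K, R * (Γ u ∘L (Γ u).adjoint) = 1 ∧
      (Γ u ∘L (Γ u).adjoint) * R = 1 := by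
    intro u hu
    set M : K →L[ℝ] K := Γ u ∘L (Γ u).adjoint with hM
    have hform : ∀ x y, inner ℝ (M x) y = inner ℝ ((Γ u).adjoint x) ((Γ u).adjoint y) := by
      intro x y
      rw [hM, ContinuousLinearMap.comp_apply, ContinuousLinearMap.adjoint_inner_right]
    obtain ⟨W, -, -, hW, hWc⟩ := exists_inverse_sqrt (M := M) (c := c ^ 2)
      (fun x y => by rw [hform, real_inner_comm (M y), hform, real_inner_comm]) (by positivity)
      (fun x => by
        rw [hform, real_inner_self_eq_norm_sq, ← mul_pow]
        gcongr
        exact hlow u hu x)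
    refine ⟨W * W, hW, ?_⟩
    have := hWc M (Commute.refl M)
    rw [← mul_assoc, this.eq, mul_assoc, this.eq, ← mul_assoc, hW]
  choose! R hR1 hR2 using hinv
  have hRb : ∀ u ∈ D, ‖R u‖ ≤ (c ^ 2)⁻¹ := by
    intro u hu
    refine (R u).opNorm_le_bound (by positivity) fun x => ?_
    have h1 : inner ℝ x (R u x) = ‖(Γ u).adjoint (R u x)‖ ^ 2 := by
      have h2 : Γ u ((Γ u).adjoint (R u x)) = x := by
        simpa using congrArg (fun T : K →L[ℝ] K => T x) (hR2 u hu)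
      rw [← real_inner_self_eq_norm_sq, ContinuousLinearMap.adjoint_inner_right, h2]
    have h3 : c ^ 2 * ‖R u x‖ ^ 2 ≤ ‖x‖ * ‖R u x‖ := by
      calc c ^ 2 * ‖R u x‖ ^ 2 = (c * ‖R u x‖) ^ 2 := by ring
        _ ≤ ‖(Γ u).adjoint (R u x)‖ ^ 2 := by gcongr; exact hlow u hu _
        _ = inner ℝ x (R u x) := h1.symm
        _ ≤ _ := real_inner_le_norm _ _
    rw [← div_eq_inv_mul, le_div_iff₀ (by positivity)]
    rcases (norm_nonneg (R u x)).eq_or_lt with h0 | h0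
    · rw [← h0]; simp
    · rw [pow_two ‖R u x‖, ← mul_assoc] at h3
      have := le_of_mul_le_mul_right h3 h0
      linarith
  have hA : LipBdd (fun u => (Γ u).adjoint) D :=
    hΓ.comp_isometry (i := fun T : H →L[ℝ] K => T.adjoint)
      (fun S T => by rw [← map_sub, LinearIsometryEquiv.norm_map]) (map_zero _)
  have hM : LipBdd (fun u => Γ u ∘L (Γ u).adjoint) D :=
    hΓ.bilin (ContinuousLinearMap.compL ℝ K H K) hA
  have hRl : LipBdd R D := by
    obtain ⟨B, L, hB, hL, -, h2⟩ := hM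
    refine ⟨(c ^ 2)⁻¹, (c ^ 2)⁻¹ * L * (c ^ 2)⁻¹, by positivity, by positivity, hRb, ?_⟩
    intro u hu v hv
    -- Resolvent identity: inverses inherit the Lipschitz bound.
    have h3 : R u - R v = R u * ((Γ v ∘L (Γ v).adjoint) - (Γ u ∘L (Γ u).adjoint)) * R v := by
      rw [mul_sub, sub_mul, hR1 u hu, mul_assoc, hR2 v hv, mul_one, one_mul]
    rw [h3]
    calc _ ≤ ‖R u‖ * ‖(Γ v ∘L (Γ v).adjoint) - (Γ u ∘L (Γ u).adjoint)‖ * ‖R v‖ :=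
          (norm_mul_le _ _).trans (by gcongr; exact norm_mul_le _ _)
      _ ≤ (c ^ 2)⁻¹ * (L * ‖v - u‖) * (c ^ 2)⁻¹ := by
          gcongr
          exacts [hRb u hu, h2 v hv u hu, hRb v hv]
      _ = _ := by rw [norm_sub_rev]; ring
  refine ⟨fun u => 1 + (-1 : ℝ) • ((Γ u).adjoint ∘L (R u ∘L Γ u)), ?_, fun u hu => ⟨fun h => ?_,
    fun h => ⟨R u (Γ u h), ?_⟩⟩⟩
  · refine (LipBdd.const (1 : H →L[ℝ] H)).add ?_
    have h1 := hRl.bilin (ContinuousLinearMap.compL ℝ H K K) hΓ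
    have h2 := hA.bilin (ContinuousLinearMap.compL ℝ H K H) h1
    exact h2.clm ((-1 : ℝ) • ContinuousLinearMap.id ℝ (H →L[ℝ] H))
  · have h2 : Γ u ((Γ u).adjoint (R u (Γ u h))) = Γ u h := by
      simpa using congrArg (fun T : K →L[ℝ] K => T (Γ u h)) (hR2 u hu)
    simp [h2]
  · simp

/-- The flow of the tangential part of a vector field `q` with respect to the constraint `G`, cut
off away from `N`. -/
theorem exists_constrained_flow {G : H → K} {Γ : H → H →L[ℝ] K} (hG : ∀ u, HasFDerivAt G (Γ u) u)
    {N : Set H} {ρ : ℝ} (hρ : 0 < ρ) {P : H → H →L[ℝ] H}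
    (hP : LipBdd P {u | Metric.infDist u N < 2 * ρ})
    (hΓP : ∀ u, Metric.infDist u N < 2 * ρ → ∀ h, Γ u (P u h) = 0)
    {q : H → H} (hq : LipBdd q {u | Metric.infDist u N < 2 * ρ}) (u₀ : H) :
    ∃ (θ : H → ℝ) (ζ : ℝ → H), (∀ u, 0 ≤ θ u) ∧ (∀ u ∈ N, θ u = 1) ∧
      (∀ u, θ u ≠ 0 → Metric.infDist u N < 2 * ρ) ∧ ζ 0 = u₀ ∧ ∀ t : ℝ, 0 ≤ t →
      HasDerivWithinAt ζ (θ (ζ t) • P (ζ t) (q (ζ t))) (Ici 0) t ∧ G (ζ t) = G u₀ := by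
  set D := {u | Metric.infDist u N < 2 * ρ} with hD
  -- Equal to 1 within distance ρ of N, equal to 0 beyond distance 2ρ, and Lipschitz with constant
  -- 1/ρ.
  set θ : H → ℝ := fun u => max 0 (min 1 (2 - Metric.infDist u N / ρ)) with hθ
  have hθ0 : ∀ u ∉ D, θ u = 0 := by
    intro u hu
    have h1 : 2 * ρ ≤ Metric.infDist u N := not_lt.1 hu
    have h2 : 2 ≤ Metric.infDist u N / ρ := by rwa [le_div_iff₀ hρ]
    simp only [hθ]
    rw [max_eq_left]
    exact (min_le_right _ _).trans (by linarith)
  have hθL : ∀ u v, |θ u - θ v| ≤ ρ⁻¹ * ‖u - v‖ := by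
    intro u v
    have h1 : |θ u - θ v| ≤ |Metric.infDist u N / ρ - Metric.infDist v N / ρ| := by
      simp only [hθ]
      refine (abs_max_sub_max_le_max _ _ _ _).trans ?_
      rw [sub_self, abs_zero, max_eq_right (abs_nonneg _)]
      refine (abs_min_sub_min_le_max _ _ _ _).trans ?_
      rw [sub_self, abs_zero, max_eq_right (abs_nonneg _), sub_sub_sub_cancel_left, abs_sub_comm]
    refine h1.trans ?_
    rw [← sub_div, abs_div, abs_of_pos hρ, div_eq_inv_mul]
    gcongr
    have h2 := (Metric.lipschitz_infDist_pt N).dist_le_mul u v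
    rw [Real.dist_eq, dist_eq_norm] at h2
    simpa using h2
  have hY := ((hP.bilin (ContinuousLinearMap.id ℝ (H →L[ℝ] H)) hq)).cutoff (θ := θ)
    (by positivity) hθL (fun u => ⟨le_max_left _ _, max_le zero_le_one (min_le_left _ _)⟩) hθ0
  obtain ⟨ζ, hζ0, hζ⟩ := exists_global_solution hY u₀
  refine ⟨θ, ζ, fun u => le_max_left _ _, fun u hu => ?_, fun u hu => ?_, hζ0, fun t ht =>
    ⟨by simpa using hζ t ht, ?_⟩⟩
  · simp only [hθ, Metric.infDist_zero_of_mem hu]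
    norm_num
  · by_contra h
    exact hu (hθ0 u h)
  -- The field lies in ker Γ inside `D` and vanishes outside, so G is constant along the whole
  -- trajectory, wherever it goes.
  · have hconst : ∀ s ∈ Ico (0 : ℝ) t, HasDerivWithinAt (fun s => G (ζ s)) 0 (Ici s) s := by
      intro s hs
      have h1 := (hG (ζ s)).comp_hasDerivWithinAt s (hζ s hs.1)
      have h2 : Γ (ζ s) (θ (ζ s) • P (ζ s) (q (ζ s))) = 0 := by
        rw [map_smul]
        by_cases h : ζ s ∈ D
        · rw [hΓP _ h, smul_zero]
        · rw [hθ0 _ h, zero_smul]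
      have h3 : HasDerivWithinAt (G ∘ ζ) 0 (Ici 0) s := by
        rw [← h2]; exact h1
      exact h3.mono (Ici_subset_Ici.2 hs.1)
    have hcont : ContinuousOn (fun s => G (ζ s)) (Icc 0 t) := fun s hs =>
      ((hG (ζ s)).continuousAt.comp_continuousWithinAt (hζ s hs.1).continuousWithinAt).mono
        Icc_subset_Ici_self
    have := constant_of_has_deriv_right_zero hcont hconst t ⟨ht, le_rfl⟩
    simpa [hζ0] using this

end Constraint

/-! ### Tangent directions and kernels of derivatives -/

section TangentSpan

variable {H : Type*} [NormedAddCommGroup H] [InnerProductSpace ℝ H] [CompleteSpace H]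

/-- The closed linear span of the tangent directions to `N` at `u`. -/
def tangentSpan (N : Set H) (u : H) : Submodule ℝ H :=
  (Submodule.span ℝ (tangentConeAt ℝ N u)).topologicalClosure

instance (N : Set H) (u : H) : CompleteSpace (tangentSpan N u) :=
  (Submodule.isClosed_topologicalClosure _).completeSpace_coe

/-- The derivative of a curve in `N` is a tangent direction. -/
theorem mem_tangentConeAt_of_curve {N : Set H} {ζ : ℝ → H} {u h : H}
    (h0 : ζ 0 = u) (hd : HasDerivWithinAt ζ h (Ici 0) 0)
    (hN : ∀ᶠ t in 𝓝[>] (0 : ℝ), ζ t ∈ N) : h ∈ tangentConeAt ℝ N u := by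
  refine mem_tangentConeAt_of_seq (𝓝[>] (0 : ℝ)) (fun t => t⁻¹) (fun t => ζ t - u) ?_ ?_ ?_
  · have h1 : Tendsto ζ (𝓝[>] 0) (𝓝 u) := by
      rw [← h0]
      exact hd.continuousWithinAt.mono_left (nhdsWithin_mono _ Ioi_subset_Ici_self)
    simpa using h1.sub_const u
  · filter_upwards [hN] with t ht
    simpa using ht
  · have h1 := hasDerivWithinAt_iff_tendsto_slope.1 hd
    have h2 : Ici (0 : ℝ) \ {0} = Ioi 0 := by ext x; simp [lt_iff_le_and_ne, eq_comm]
    rw [h2] at h1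
    refine h1.congr fun t => ?_
    simp [slope_def_module, h0]

/-- Difference quotients of G along N vanish, so Γ kills every tangent direction; its kernel is a
closed subspace and therefore contains the closed span. -/
theorem tangentSpan_le_ker {K : Type*} [NormedAddCommGroup K] [InnerProductSpace ℝ K]
    {G : H → K} {Γ : H →L[ℝ] K} {N : Set H} {u : H} (hG : HasFDerivAt G Γ u)
    (hu : G u = 0) (hN : ∀ v ∈ N, G v = 0) {h : H} (hh : h ∈ tangentSpan N u) : Γ h = 0 := by
  have h1 : tangentSpan N u ≤ LinearMap.ker (Γ : H →ₗ[ℝ] K) := by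
    refine Submodule.topologicalClosure_minimal _ ?_ (ContinuousLinearMap.isClosed_ker Γ)
    rw [Submodule.span_le]
    intro y hy
    obtain ⟨α, l, hl, c, d, hd0, hds, hcd⟩ := exists_fun_of_mem_tangentConeAt hy
    have h2 := hG.hasFDerivWithinAt (s := N)
    have h3 := h2.lim hd0 hds hcd
    refine tendsto_nhds_unique (h3.congr' (f₂ := fun _ => (0 : K)) ?_) tendsto_const_nhds
    filter_upwards [hds] with a ha
    rw [hN _ ha, hu, sub_self, smul_zero]
  exact h1 hh

end TangentSpan

/-! ### The generalized Nehari set as a zero set in E ⊕ ℝ -/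

section NehariConstraint

variable {H : Type*} [NormedAddCommGroup H] [InnerProductSpace ℝ H]

/-- The generalized Nehari set of a functional with gradient `g`, relative to the subspace `E`. -/
def nehariSet (E : Submodule ℝ H) (g : H → H) : Set H :=
  {u | u ≠ 0 ∧ inner ℝ (g u) u = (0 : ℝ) ∧ ∀ v ∈ E, inner ℝ (g u) v = (0 : ℝ)}

variable (E : Submodule ℝ H)

/-- The embedding of the first summand. -/
noncomputable def inlL2 : E →L[ℝ] WithLp 2 (E × ℝ) :=
  ((WithLp.prodContinuousLinearEquiv 2 ℝ E ℝ).symm : E × ℝ →L[ℝ] WithLp 2 (E × ℝ)) ∘L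
    ContinuousLinearMap.inl ℝ E ℝ

/-- The embedding of the second summand. -/
noncomputable def inrL2 : ℝ →L[ℝ] WithLp 2 (E × ℝ) :=
  ((WithLp.prodContinuousLinearEquiv 2 ℝ E ℝ).symm : E × ℝ →L[ℝ] WithLp 2 (E × ℝ)) ∘L
    ContinuousLinearMap.inr ℝ E ℝ

theorem inner_inlL2 (v : E) (k : WithLp 2 (E × ℝ)) :
    inner ℝ (inlL2 E v) k = inner ℝ v k.fst := by
  simp [inlL2, WithLp.prod_inner_apply]

theorem inner_inrL2 (s : ℝ) (k : WithLp 2 (E × ℝ)) :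
    inner ℝ (inrL2 E s) k = s * k.snd := by
  simp [inrL2, WithLp.prod_inner_apply, mul_comm]

variable [CompleteSpace E]

/-- The map whose zeros are the elements of the generalized Nehari set. -/
noncomputable def nehariConstraint (g : H → H) (u : H) : WithLp 2 (E × ℝ) :=
  inlL2 E (E.orthogonalProjection (g u)) + inrL2 E (inner ℝ (g u) u)

/-- The derivative of the constraint map, where `D` is the derivative of `g`. -/
noncomputable def nehariConstraintDeriv (g : H → H) (D : H → H →L[ℝ] H) (u : H) :
    H →L[ℝ] WithLp 2 (E × ℝ) :=
  (inlL2 E ∘L E.orthogonalProjection) ∘L D u +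
    (inrL2 E ∘L (innerSL ℝ u ∘L D u) + inrL2 E ∘L innerSL ℝ (g u))

variable {g : H → H} {D : H → H →L[ℝ] H}

theorem hasFDerivAt_nehariConstraint {u : H} (hg : HasFDerivAt g (D u) u) :
    HasFDerivAt (nehariConstraint E g) (nehariConstraintDeriv E g D u) u := by
  have h1 := (inlL2 E ∘L E.orthogonalProjection).hasFDerivAt.comp u hg
  have h2 := (inrL2 E).hasFDerivAt.comp u (hg.inner ℝ (hasFDerivAt_id u))
  refine (h1.add h2).congr_fderiv ?_
  ext h
  · simp [nehariConstraintDeriv, add_comm, real_inner_comm]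

theorem lipBdd_nehariConstraintDeriv {S : Set H} (hS : LipBdd (fun u : H => u) S)
    (hg : LipBdd g S) (hD : LipBdd D S) : LipBdd (nehariConstraintDeriv E g D) S := by
  have hi : ∀ {f : H → H}, LipBdd f S → LipBdd (fun u => innerSL ℝ (f u)) S := fun h =>
    h.comp_isometry (i := fun u => innerSL ℝ u)
      (fun x y => by rw [← map_sub, innerSL_apply_norm]) (map_zero _)
  refine (hD.clm (ContinuousLinearMap.compL ℝ H H (WithLp 2 (E × ℝ))
    (inlL2 E ∘L E.orthogonalProjection))).add ?_
  exact (((hi hS).bilin (ContinuousLinearMap.compL ℝ H H ℝ) hD).clm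
    (ContinuousLinearMap.compL ℝ H ℝ (WithLp 2 (E × ℝ)) (inrL2 E))).add
    ((hi hg).clm (ContinuousLinearMap.compL ℝ H ℝ (WithLp 2 (E × ℝ)) (inrL2 E)))

/-- Computes the adjoint of the constraint derivative. For k = (v, s) and h = v + su the last term
vanishes on the Nehari set, and what remains is the Hessian form at v + su. -/
theorem inner_nehariConstraintDeriv (u h : H) (k : WithLp 2 (E × ℝ)) :
    inner ℝ (nehariConstraintDeriv E g D u h) k =
      inner ℝ (D u h) ((k.fst : H) + k.snd • u) + k.snd * inner ℝ (g u) h := by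
  simp only [nehariConstraintDeriv, add_apply, ContinuousLinearMap.comp_apply, inner_add_left,
    inner_inlL2, inner_inrL2, innerSL_apply_apply, inner_add_right, real_inner_smul_right,
    Submodule.inner_orthogonalProjectionOnto_eq_of_mem_right]
  rw [real_inner_comm u (D u h)]
  ring

theorem nehariConstraint_eq_zero_iff (u : H) :
    nehariConstraint E g u = 0 ↔ inner ℝ (g u) u = (0 : ℝ) ∧ ∀ v ∈ E, inner ℝ (g u) v = (0 : ℝ) := by
  have key : ∀ k : WithLp 2 (E × ℝ), inner ℝ (nehariConstraint E g u) k =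
      inner ℝ (g u) (k.fst : H) + k.snd * inner ℝ (g u) u := by
    intro k
    simp only [nehariConstraint, inner_add_left, inner_inlL2, inner_inrL2,
      Submodule.inner_orthogonalProjectionOnto_eq_of_mem_right]
    ring
  constructor
  · intro h
    constructor
    · have := key (inrL2 E 1)
      simpa [h, inrL2] using this.symm
    · intro v hv
      have := key (inlL2 E ⟨v, hv⟩)
      simpa [h, inlL2] using this.symm
  · rintro ⟨h1, h2⟩
    refine ext_inner_right ℝ fun k => ?_
    rw [key, h1, h2 _ k.fst.2]
    simp

end NehariConstraint

/-! ### Nondegenerate normal directions, the tangential gradient and its flow -/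

section Flow

variable {H : Type*} [NormedAddCommGroup H] [InnerProductSpace ℝ H] [CompleteSpace H]
  {E : Submodule ℝ H} [CompleteSpace E] {J : H → ℝ} {g : H → H} {D : H → H →L[ℝ] H}

/-- On a sublevel set `N` of the generalized Nehari set on which the second derivative is uniformly
negative definite on `E ⊕ ℝ u`, the normal directions are uniformly nondegenerate. -/
theorem norm_le_of_neg_definite {u : H} (hu : u ∈ nehariSet E g) {M c : ℝ}
    (hM : ‖u‖ ≤ M)
    (hneg : ∀ v ∈ E, ∀ s : ℝ, inner ℝ (D u (v + s • u)) (v + s • u) ≤ -(c * (‖v‖ ^ 2 + s ^ 2)))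
    (k : WithLp 2 (E × ℝ)) :
    ‖(k.fst : H) + k.snd • u‖ ≤ (1 + M) * ‖k‖ ∧
    c * ‖k‖ ^ 2 ≤ -inner ℝ (nehariConstraintDeriv E g D u ((k.fst : H) + k.snd • u)) k ∧
    inner ℝ (g u) ((k.fst : H) + k.snd • u) = (0 : ℝ) := by
  have hk : ‖k‖ ^ 2 = ‖(k.fst : H)‖ ^ 2 + k.snd ^ 2 := by
    rw [WithLp.prod_norm_sq_eq_of_L2]
    simp
  have hg0 : inner ℝ (g u) ((k.fst : H) + k.snd • u) = (0 : ℝ) := by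
    rw [inner_add_right, real_inner_smul_right, hu.2.1, hu.2.2 _ k.fst.2]
    simp
  refine ⟨?_, ?_, hg0⟩
  · have h1 : ‖(k.fst : H)‖ ≤ ‖k‖ := by
      refine le_of_sq_le_sq ?_ (norm_nonneg _)
      rw [hk]
      nlinarith [sq_nonneg k.snd]
    have h2 : |k.snd| ≤ ‖k‖ := by
      refine abs_le_of_sq_le_sq ?_ (norm_nonneg _)
      rw [hk]
      nlinarith [sq_nonneg ‖(k.fst : H)‖]
    calc ‖(k.fst : H) + k.snd • u‖ ≤ ‖(k.fst : H)‖ + |k.snd| * ‖u‖ := by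
          refine (norm_add_le _ _).trans ?_
          rw [norm_smul, Real.norm_eq_abs]
      _ ≤ ‖k‖ + ‖k‖ * M := by gcongr
      _ = _ := by ring
  · rw [inner_nehariConstraintDeriv, hg0, hk]
    have := hneg _ k.fst.2 k.snd
    linarith

end Flow

section Flow

variable {H : Type*} [NormedAddCommGroup H] [InnerProductSpace ℝ H] [CompleteSpace H]
  {E : Submodule ℝ H} [CompleteSpace E] {J : H → ℝ} {g : H → H} {D : H → H →L[ℝ] H}

theorem lipBdd_id_closedBall (R : ℝ) : LipBdd (fun u : H => u) (Metric.closedBall 0 R) :=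
  ⟨|R|, 1, abs_nonneg _, zero_le_one, fun u hu =>
    (by simpa using hu : ‖u‖ ≤ R).trans (le_abs_self R), fun u _ v _ => by rw [one_mul]⟩

/-- Tangential projections in a neighbourhood of a bounded part of the Nehari set on which the
second derivative is uniformly negative definite on `E ⊕ ℝ u`. -/
theorem exists_tangential_projection
    (hgb : ∀ R, LipBdd g (Metric.closedBall 0 R)) (hDb : ∀ R, LipBdd D (Metric.closedBall 0 R))
    {N : Set H} (hN : N ⊆ nehariSet E g) (hne : N.Nonempty) {M c : ℝ} (hM0 : 0 ≤ M) (hc : 0 < c)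
    (hM : ∀ u ∈ N, ‖u‖ ≤ M)
    (hneg : ∀ u ∈ N, ∀ v ∈ E, ∀ s : ℝ,
      inner ℝ (D u (v + s • u)) (v + s • u) ≤ -(c * (‖v‖ ^ 2 + s ^ 2))) :
    ∃ ρ > 0, ∃ P : H → H →L[ℝ] H, LipBdd P {u | Metric.infDist u N < 2 * ρ} ∧
      LipBdd g {u | Metric.infDist u N < 2 * ρ} ∧ ∀ u, Metric.infDist u N < 2 * ρ →
      (∀ h, nehariConstraintDeriv E g D u (P u h) = 0) ∧
      ∀ h, ∃ k, h - P u h = (nehariConstraintDeriv E g D u).adjoint k := by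
  have hΓ := lipBdd_nehariConstraintDeriv E (lipBdd_id_closedBall (M + 1)) (hgb (M + 1))
    (hDb (M + 1))
  obtain ⟨B, L, hB, hL, -, hΓL⟩ := id hΓ
  set c₀ := c / (1 + M) with hc₀
  have hc₀0 : 0 < c₀ := by positivity
  -- Moving by less than 2ρ costs at most L · 2ρ ≤ c₀ / 2 of the lower bound c₀ for Γ* on N. The cap
  -- 1/2 keeps the neighbourhood in the ball of radius M + 1, where Γ is L-Lipschitz.
  set ρ := min (1 / 2) (c₀ / (4 * (L + 1))) with hρ
  have hρ0 : 0 < ρ := by positivity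
  have hρ1 : 2 * ρ ≤ 1 := by linarith [min_le_left (1 / 2) (c₀ / (4 * (L + 1)))]
  have hρ2 : L * (2 * ρ) ≤ c₀ / 2 := by
    have h1 : ρ ≤ c₀ / (4 * (L + 1)) := min_le_right _ _
    rw [le_div_iff₀ (by positivity)] at h1
    nlinarith
  have hball : {u | Metric.infDist u N < 2 * ρ} ⊆ Metric.closedBall 0 (M + 1) := by
    intro u hu
    obtain ⟨w, hw, huw⟩ := (Metric.infDist_lt_iff hne).1 hu
    rw [mem_closedBall_zero_iff]
    rw [dist_eq_norm] at huw
    calc ‖u‖ = ‖(u - w) + w‖ := by rw [sub_add_cancel]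
      _ ≤ ‖u - w‖ + ‖w‖ := norm_add_le _ _
      _ ≤ M + 1 := by linarith [hM w hw]
  -- Γ*k is tested against v + su, where k = (v, s).
  have hlowN : ∀ u ∈ N, ∀ k, c₀ * ‖k‖ ≤ ‖(nehariConstraintDeriv E g D u).adjoint k‖ := by
    intro u hu k
    obtain ⟨h1, h2, -⟩ := norm_le_of_neg_definite (hN hu) (hM u hu) (hneg u hu) k
    rw [← ContinuousLinearMap.adjoint_inner_right] at h2
    have h3 : c * ‖k‖ ^ 2 ≤ ((1 + M) * ‖k‖) * ‖(nehariConstraintDeriv E g D u).adjoint k‖ := by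
      refine h2.trans ((neg_le_abs _).trans ((abs_real_inner_le_norm _ _).trans ?_))
      gcongr
    rcases (norm_nonneg k).eq_or_lt with h0 | h0
    · rw [← h0]; simp
    · have h4 : (c * ‖k‖) * ‖k‖ ≤ ((1 + M) * ‖(nehariConstraintDeriv E g D u).adjoint k‖) * ‖k‖ := by
        linarith
      have h5 := le_of_mul_le_mul_right h4 h0
      rw [hc₀, div_mul_eq_mul_div, div_le_iff₀ (by positivity)]
      linarith
  obtain ⟨P, hP, hP'⟩ := exists_kernel_projection (hΓ.mono hball) (c := c₀ / 2) (by positivity) (by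
    intro u hu k
    obtain ⟨w, hw, huw⟩ := (Metric.infDist_lt_iff hne).1 hu
    rw [dist_eq_norm] at huw
    have hwb : w ∈ Metric.closedBall (0 : H) (M + 1) := by
      rw [mem_closedBall_zero_iff]; linarith [hM w hw]
    have h1 := hlowN w hw k
    have h2 : ‖(nehariConstraintDeriv E g D w).adjoint k -
        (nehariConstraintDeriv E g D u).adjoint k‖ ≤ c₀ / 2 * ‖k‖ := by
      rw [← sub_apply, ← map_sub]
      refine (ContinuousLinearMap.le_opNorm _ _).trans ?_
      rw [LinearIsometryEquiv.norm_map]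
      gcongr
      refine (hΓL w hwb u (hball hu)).trans (le_trans ?_ hρ2)
      rw [norm_sub_rev]
      gcongr
    have h3 := norm_sub_norm_le ((nehariConstraintDeriv E g D w).adjoint k)
      ((nehariConstraintDeriv E g D u).adjoint k)
    linarith)
  exact ⟨ρ, hρ0, P, hP, (hgb (M + 1)).mono hball, hP'⟩

/-- The kernel of the derivative of the constraint is the tangent space of the Nehari set. -/
theorem mem_tangentSpan_nehariSet (hg : ∀ u, HasFDerivAt g (D u) u)
    {N : Set H} (hN : N ⊆ nehariSet E g) {ρ : ℝ} (hρ : 0 < ρ) {P : H → H →L[ℝ] H}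
    (hP : LipBdd P {u | Metric.infDist u N < 2 * ρ})
    (hP' : ∀ u, Metric.infDist u N < 2 * ρ → (∀ h, nehariConstraintDeriv E g D u (P u h) = 0) ∧
      ∀ h, ∃ k, h - P u h = (nehariConstraintDeriv E g D u).adjoint k) {u : H} (hu : u ∈ N)
    {h : H} : h ∈ tangentSpan (nehariSet E g) u ↔ nehariConstraintDeriv E g D u h = 0 := by
  have hu0 : nehariConstraint E g u = 0 := (nehariConstraint_eq_zero_iff E u).2 (hN hu).2
  have huD : Metric.infDist u N < 2 * ρ := by
    rw [Metric.infDist_zero_of_mem hu]; positivity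
  constructor
  · exact fun hh => tangentSpan_le_ker (hasFDerivAt_nehariConstraint E (hg u)) hu0
      (fun v hv => (nehariConstraint_eq_zero_iff E v).2 hv.2) hh
  · intro hh
    refine Submodule.le_topologicalClosure _ (Submodule.subset_span ?_)
    -- The constrained flow of the constant field `h` takes the place of the implicit function
    -- theorem: its trajectory from `u` stays in the zero set and has initial velocity P_u h = h.
    obtain ⟨θ, ζ, -, hθ1, -, hζ0, hζ⟩ := exists_constrained_flow
      (fun u => hasFDerivAt_nehariConstraint E (hg u)) hρ hP (fun u hu => (hP' u hu).1)
      (q := fun _ => h) (LipBdd.const h) u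
    have hPh : P u h = h := by
      obtain ⟨k, hk⟩ := (hP' u huD).2 h
      have h1 : h - P u h = 0 := by
        rw [← norm_eq_zero, ← sq_eq_zero_iff, ← real_inner_self_eq_norm_sq]
        nth_rewrite 1 [hk]
        rw [ContinuousLinearMap.adjoint_inner_left, map_sub, hh, (hP' u huD).1, sub_zero,
          inner_zero_right]
      exact (sub_eq_zero.1 h1).symm
    have hd := (hζ 0 le_rfl).1
    rw [hζ0, hθ1 u hu, one_smul, hPh] at hd
    refine mem_tangentConeAt_of_curve hζ0 hd ?_
    have hne : ∀ᶠ t in 𝓝[>] (0 : ℝ), ζ t ≠ 0 := by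
      have h1 : Tendsto ζ (𝓝[>] 0) (𝓝 (ζ 0)) :=
        hd.continuousWithinAt.mono_left (nhdsWithin_mono _ Ioi_subset_Ici_self)
      refine h1.eventually_ne ?_
      rw [hζ0]
      exact (hN hu).1
    filter_upwards [hne, self_mem_nhdsWithin] with t ht ht0
    refine ⟨ht, (nehariConstraint_eq_zero_iff E _).1 ?_⟩
    rw [(hζ t (mem_Ioi.1 ht0).le).2, hu0]

/-- The free η is the parameter in Young's inequality; this takes the place of a Cauchy–Schwarz
estimate for the length of a trajectory. -/
theorem tendsto_zero_of_forall_le_add_div {a b : ℕ → ℝ} (ha : ∀ n, 0 ≤ a n)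
    (hb : Tendsto b atTop (𝓝 0)) (h : ∀ n, ∀ η > 0, a n ≤ η + b n / (2 * η)) :
    Tendsto a atTop (𝓝 0) := by
  rw [Metric.tendsto_atTop]
  intro ε hε
  have h1 : Tendsto (fun n => b n / (2 * (ε / 2))) atTop (𝓝 0) := by
    simpa using hb.div_const (2 * (ε / 2))
  obtain ⟨n₀, hn₀⟩ := eventually_atTop.1 (h1.eventually (gt_mem_nhds (half_pos hε)))
  refine ⟨n₀, fun n hn => ?_⟩
  rw [Real.dist_eq, sub_zero, abs_of_nonneg (ha n)]
  linarith [h n (ε / 2) (half_pos hε), hn₀ n hn]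

/-- **Palais–Smale sequences along the tangential gradient flow** of a functional on its generalized
Nehari set. -/
theorem exists_palaisSmale_flow (hJ : ∀ u, HasGradientAt J (g u) u)
    (hg : ∀ u, HasFDerivAt g (D u) u)
    (hgb : ∀ R, LipBdd g (Metric.closedBall 0 R)) (hDb : ∀ R, LipBdd D (Metric.closedBall 0 R))
    (hne : (nehariSet E g).Nonempty) (hnonneg : ∀ u ∈ nehariSet E g, 0 ≤ J u)
    (hlevel : ∀ C, ∃ M r c : ℝ, 0 ≤ M ∧ 0 < r ∧ 0 < c ∧ ∀ u ∈ nehariSet E g, J u ≤ C →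
      r ≤ ‖u‖ ∧ ‖u‖ ≤ M ∧ ∀ v ∈ E, ∀ s : ℝ,
      inner ℝ (D u (v + s • u)) (v + s • u) ≤ -(c * (‖v‖ ^ 2 + s ^ 2)))
    {ε : ℝ} (hε : 0 < ε) :
    ∃ c ∈ Icc (sInf (J '' nehariSet E g)) (sInf (J '' nehariSet E g) + ε), ∃ (ζ : ℝ → H)
      (t : ℕ → ℝ),
      (∀ t : ℝ, 0 ≤ t → ζ t ∈ nehariSet E g ∧ HasDerivWithinAt ζ
        (-(tangentSpan (nehariSet E g) (ζ t)).starProjection (g (ζ t))) (Ici 0) t) ∧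
      (∀ n, 0 ≤ t n) ∧ Tendsto t atTop atTop ∧
      Tendsto (fun n => J (ζ (t n))) atTop (𝓝 c) ∧
      Tendsto (fun n => (tangentSpan (nehariSet E g) (ζ (t n))).starProjection (g (ζ (t n)))) atTop
        (𝓝 0) ∧
      Tendsto (fun n => g (ζ (t n))) atTop (𝓝 0) ∧
      Tendsto (fun n => ‖ζ (t (n + 1)) - ζ (t n)‖) atTop (𝓝 0) := by
  set m := sInf (J '' nehariSet E g) with hm
  have hbdd : BddBelow (J '' nehariSet E g) := ⟨0, by rintro _ ⟨u, hu, rfl⟩; exact hnonneg u hu⟩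
  obtain ⟨_, ⟨u₀, hu₀, rfl⟩, hu₀m⟩ := exists_lt_of_csInf_lt (hne.image J)
    (show sInf (J '' nehariSet E g) < m + ε by linarith)
  obtain ⟨M, r, c, hM0, hr, hc, hlev⟩ := hlevel (J u₀)
  -- The flow starts at `u₀` and lowers J, so bounds that are uniform on this sublevel set suffice.
  set N := {u ∈ nehariSet E g | J u ≤ J u₀} with hN
  have hNsub : N ⊆ nehariSet E g := fun u hu => hu.1
  have hu₀N : u₀ ∈ N := ⟨hu₀, le_rfl⟩
  obtain ⟨ρ, hρ, P, hP, hgN, hP'⟩ := exists_tangential_projection hgb hDb hNsub ⟨u₀, hu₀N⟩ hM0 hc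
    (fun u hu => (hlev u hu.1 hu.2).2.1) (fun u hu => (hlev u hu.1 hu.2).2.2)
  set Γ := nehariConstraintDeriv E g D with hΓ
  have hND : ∀ u ∈ N, Metric.infDist u N < 2 * ρ := fun u hu => by
    rw [Metric.infDist_zero_of_mem hu]; positivity
  -- the tangential gradient
  have hX : ∀ u ∈ N, (tangentSpan (nehariSet E g) u).starProjection (g u) = P u (g u) := by
    intro u hu
    -- P_u g(u) is in ker Γ, which is the tangent space, and the difference to g(u) is in the range
    -- of Γ*, hence orthogonal to ker Γ.
    refine (Submodule.eq_starProjection_of_mem_of_inner_eq_zero ?_ ?_)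
    · exact (mem_tangentSpan_nehariSet hg hNsub hρ hP hP' hu).2 ((hP' u (hND u hu)).1 _)
    · intro w hw
      obtain ⟨k, hk⟩ := (hP' u (hND u hu)).2 (g u)
      rw [hk, ContinuousLinearMap.adjoint_inner_left,
        (mem_tangentSpan_nehariSet hg hNsub hρ hP hP' hu).1 hw, inner_zero_right]
  have hsq : ∀ u, Metric.infDist u N < 2 * ρ → inner ℝ (g u) (P u (g u)) = ‖P u (g u)‖ ^ 2 := by
    intro u hu
    obtain ⟨k, hk⟩ := (hP' u hu).2 (g u)
    have h1 : inner ℝ (g u - P u (g u)) (P u (g u)) = (0 : ℝ) := by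
      rw [hk, ContinuousLinearMap.adjoint_inner_left, (hP' u hu).1, inner_zero_right]
    rw [inner_sub_left, real_inner_self_eq_norm_sq] at h1
    linarith
  -- The constraint is natural. The normal part of g(u) is Γ*k; pairing with w = v + su, to which
  -- g(u) is orthogonal, gives c‖k‖² ≤ ⟨P g, w⟩ ≤ (1 + M)‖P g‖‖k‖.
  obtain ⟨B, hB0, hB⟩ : ∃ B : ℝ, 0 ≤ B ∧ ∀ u ∈ N, ‖g u‖ ≤ B * ‖P u (g u)‖ := by
    obtain ⟨B, L, hB, -, hΓB, -⟩ := lipBdd_nehariConstraintDeriv E (lipBdd_id_closedBall M) (hgb M)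
      (hDb M)
    refine ⟨1 + B * ((1 + M) / c), by positivity, fun u hu => ?_⟩
    obtain ⟨k, hk⟩ := (hP' u (hND u hu)).2 (g u)
    obtain ⟨h1, h2, h3⟩ := norm_le_of_neg_definite hu.1 (hlev u hu.1 hu.2).2.1
      (hlev u hu.1 hu.2).2.2 k
    set w := (k.fst : H) + k.snd • u with hw
    have h4 : inner ℝ (P u (g u)) w = -inner ℝ (nehariConstraintDeriv E g D u w) k := by
      have h5 := congrArg (fun x => inner ℝ x w) hk
      simp only [inner_sub_left, ContinuousLinearMap.adjoint_inner_left, h3] at h5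
      rw [real_inner_comm k]
      linarith
    have h6 : c * ‖k‖ ^ 2 ≤ ‖P u (g u)‖ * ((1 + M) * ‖k‖) := by
      rw [← h4] at h2
      refine h2.trans ((real_inner_le_norm _ _).trans ?_)
      gcongr
    have h7 : ‖k‖ ≤ (1 + M) / c * ‖P u (g u)‖ := by
      rcases (norm_nonneg k).eq_or_lt with h0 | h0
      · rw [← h0]; positivity
      · have h8 : (c * ‖k‖) * ‖k‖ ≤ ((1 + M) * ‖P u (g u)‖) * ‖k‖ := by linarith
        have h9 := le_of_mul_le_mul_right h8 h0
        rw [div_mul_eq_mul_div, le_div_iff₀ hc]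
        linarith
    calc ‖g u‖ = ‖P u (g u) + (nehariConstraintDeriv E g D u).adjoint k‖ := by
          rw [← hk]; congr 1; abel
      _ ≤ ‖P u (g u)‖ + ‖nehariConstraintDeriv E g D u‖ * ‖k‖ := by
          refine (norm_add_le _ _).trans ?_
          gcongr
          refine (ContinuousLinearMap.le_opNorm _ _).trans ?_
          rw [LinearIsometryEquiv.norm_map]
      _ ≤ ‖P u (g u)‖ + B * ((1 + M) / c * ‖P u (g u)‖) := by
          gcongr
          exact hΓB u (by simpa using (hlev u hu.1 hu.2).2.1)
      _ = _ := by ring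
  -- the flow
  obtain ⟨θ, ζ, hθ0, hθ1, hθD, hζ0, hζ⟩ := exists_constrained_flow
    (fun u => hasFDerivAt_nehariConstraint E (hg u)) hρ hP (fun u hu => (hP' u hu).1)
    (q := fun u => (-1 : ℝ) • g u) (hgN.clm ((-1 : ℝ) • ContinuousLinearMap.id ℝ H)) u₀
  have hJd : ∀ t : ℝ, 0 ≤ t → HasDerivWithinAt (fun t => J (ζ t))
      (-(θ (ζ t) * inner ℝ (g (ζ t)) (P (ζ t) (g (ζ t))))) (Ici 0) t := by
    intro t ht
    have h1 := (hJ (ζ t)).hasFDerivAt.comp_hasDerivWithinAt t (hζ t ht).1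
    have h2 : InnerProductSpace.toDual ℝ H (g (ζ t)) (θ (ζ t) • P (ζ t) ((-1 : ℝ) • g (ζ t))) =
        -(θ (ζ t) * inner ℝ (g (ζ t)) (P (ζ t) (g (ζ t)))) := by
      simp [real_inner_smul_right]
    rw [← h2]
    exact h1
  have hnonpos : ∀ u, -(θ u * inner ℝ (g u) (P u (g u))) ≤ 0 := by
    intro u
    by_cases h : θ u = 0
    · simp [h]
    · rw [hsq u (hθD u h)]
      have := mul_nonneg (hθ0 u) (sq_nonneg ‖P u (g u)‖)
      linarith
  have hJc : ContinuousOn (fun t => J (ζ t)) (Ici 0) := fun t ht => (hJd t ht).continuousWithinAt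
  have hanti : AntitoneOn (fun t => J (ζ t)) (Ici 0) := by
    refine antitoneOn_of_deriv_nonpos (convex_Ici 0) hJc ?_ ?_
    · intro t ht
      rw [interior_Ici] at ht
      exact ((hJd t (mem_Ioi.1 ht).le).hasDerivAt (Ici_mem_nhds ht)).differentiableAt.differentiableWithinAt
    · intro t ht
      rw [interior_Ici] at ht
      rw [((hJd t (mem_Ioi.1 ht).le).hasDerivAt (Ici_mem_nhds ht)).deriv]
      exact hnonpos _
  have hG0 : nehariConstraint E g u₀ = 0 := (nehariConstraint_eq_zero_iff E u₀).2 hu₀.2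
  have hstay : ∀ t : ℝ, 0 ≤ t → ζ t ≠ 0 → ζ t ∈ N := by
    intro t ht h0
    refine ⟨⟨h0, (nehariConstraint_eq_zero_iff E _).1 ((hζ t ht).2.trans hG0)⟩, ?_⟩
    have := hanti (mem_Ici.2 le_rfl) (mem_Ici.2 ht) ht
    simpa [hζ0] using this
  -- On N the norm is at least r. A trajectory that reached 0 would pass through norm r/2 at a
  -- nonzero point, which would lie in N.
  have hζN : ∀ t : ℝ, 0 ≤ t → ζ t ∈ N := by
    intro t ht
    refine hstay t ht fun h0 => ?_
    have hc1 : ContinuousOn (fun s => ‖ζ s‖) (Icc 0 t) := fun s hs =>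
      ((hζ s hs.1).1.continuousWithinAt.norm).mono Icc_subset_Ici_self
    have hr0 : r ≤ ‖ζ 0‖ := by rw [hζ0]; exact (hlev u₀ hu₀ le_rfl).1
    obtain ⟨s, hs, hs'⟩ := intermediate_value_Icc' ht hc1
      (show r / 2 ∈ Icc ‖ζ t‖ ‖ζ 0‖ by rw [h0, norm_zero]; constructor <;> linarith)
    simp only at hs'
    have hs0 : ζ s ≠ 0 := by
      intro h1
      rw [h1, norm_zero] at hs'
      linarith
    have h2 := hstay s hs.1 hs0
    have := (hlev _ h2.1 h2.2).1
    linarith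
  have hflow : ∀ t : ℝ, 0 ≤ t → HasDerivWithinAt ζ (-(P (ζ t) (g (ζ t)))) (Ici 0) t := by
    intro t ht
    have h1 := (hζ t ht).1
    rw [hθ1 _ (hζN t ht), one_smul] at h1
    simpa using h1
  have hJd' : ∀ t : ℝ, 0 ≤ t → HasDerivWithinAt (fun t => J (ζ t))
      (-‖P (ζ t) (g (ζ t))‖ ^ 2) (Ici 0) t := by
    intro t ht
    have h1 := hJd t ht
    rwa [hθ1 _ (hζN t ht), one_mul, hsq _ (hND _ (hζN t ht))] at h1
  set a : ℕ → ℝ := fun n => J (ζ n) with ha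
  have ha_anti : Antitone a := fun i j hij =>
    hanti (mem_Ici.2 i.cast_nonneg) (mem_Ici.2 j.cast_nonneg) (by exact_mod_cast hij)
  have hmle : ∀ t : ℝ, 0 ≤ t → m ≤ J (ζ t) := fun t ht =>
    csInf_le hbdd ⟨_, (hζN t ht).1, rfl⟩
  have ha_lim := tendsto_atTop_ciInf ha_anti
    ⟨m, by rintro _ ⟨n, rfl⟩; exact hmle n n.cast_nonneg⟩
  set c' := ⨅ n, a n with hc'
  -- Mean value theorem for the energy: at some time in (n, n + 1) the squared tangential gradient
  -- equals the energy drop over that interval.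
  have hmvt : ∀ n : ℕ, ∃ t ∈ Ioo (n : ℝ) (n + 1),
      -‖P (ζ t) (g (ζ t))‖ ^ 2 = a (n + 1) - a n := by
    intro n
    have hn : (0 : ℝ) ≤ n := n.cast_nonneg
    obtain ⟨t, ht, h1⟩ := exists_hasDerivAt_eq_slope (fun t => J (ζ t))
      (fun t => -‖P (ζ t) (g (ζ t))‖ ^ 2) (show (n : ℝ) < n + 1 by linarith)
      (hJc.mono fun s hs => mem_Ici.2 (hn.trans hs.1))
      (fun s hs => (hJd' s (hn.trans hs.1.le)).hasDerivAt (Ici_mem_nhds (hn.trans_lt hs.1)))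
    refine ⟨t, ht, h1.trans ?_⟩
    simp [ha]
  choose t ht hta using hmvt
  have ht0 : ∀ n, 0 ≤ t n := fun n => n.cast_nonneg.trans (ht n).1.le
  have hdiff : Tendsto (fun n => a n - a (n + 1)) atTop (𝓝 0) := by
    have := ha_lim.sub (ha_lim.comp (tendsto_add_atTop_nat 1))
    simpa using this
  have hdiff2 : Tendsto (fun n => a n - a (n + 2)) atTop (𝓝 0) := by
    have := ha_lim.sub (ha_lim.comp (tendsto_add_atTop_nat 2))
    simpa using this
  have hP0 : Tendsto (fun n => ‖P (ζ (t n)) (g (ζ (t n)))‖) atTop (𝓝 0) := by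
    have h1 : ∀ n, ‖P (ζ (t n)) (g (ζ (t n)))‖ = Real.sqrt (a n - a (n + 1)) := by
      intro n
      rw [← Real.sqrt_sq (norm_nonneg (P (ζ (t n)) (g (ζ (t n)))))]
      congr 1
      linarith [hta n]
    simp only [h1]
    have := (Real.continuous_sqrt.tendsto 0).comp hdiff
    simpa [Function.comp_def] using this
  refine ⟨c', ⟨?_, ?_⟩, ζ, t, ?_, ht0, ?_, ?_, ?_, ?_, ?_⟩
  · exact ge_of_tendsto' ha_lim fun n => hmle n n.cast_nonneg
  · have h1 := ha_anti.le_of_tendsto ha_lim 0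
    simp only [ha, Nat.cast_zero, hζ0] at h1
    linarith
  · intro s hs
    rw [hX _ (hζN s hs)]
    exact ⟨(hζN s hs).1, hflow s hs⟩
  · exact tendsto_atTop_mono (fun n => (ht n).1.le) tendsto_natCast_atTop_atTop
  · refine tendsto_of_tendsto_of_tendsto_of_le_of_le (ha_lim.comp (tendsto_add_atTop_nat 1)) ha_lim
      (fun n => ?_) (fun n => ?_)
    · refine hanti (mem_Ici.2 (ht0 n)) (mem_Ici.2 (Nat.cast_nonneg _)) ?_
      push_cast
      exact (ht n).2.le
    · exact hanti (mem_Ici.2 n.cast_nonneg) (mem_Ici.2 (ht0 n)) (ht n).1.le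
  · rw [tendsto_zero_iff_norm_tendsto_zero]
    refine hP0.congr fun n => ?_
    rw [hX _ (hζN _ (ht0 n))]
  · rw [tendsto_zero_iff_norm_tendsto_zero]
    refine squeeze_zero (fun _ => norm_nonneg _) (fun n => hB _ (hζN _ (ht0 n))) ?_
    simpa using hP0.const_mul B
  · refine tendsto_zero_of_forall_le_add_div (fun _ => norm_nonneg _) hdiff2 fun n η hη => ?_
    have hle : t n ≤ t (n + 1) := by
      have h1 := (ht n).2
      have h2 := (ht (n + 1)).1
      push_cast at h2
      linarith
    -- The speed p satisfies p ≤ η/2 + p²/(2η), and −J(ζ) has derivative p². Both times lie in [n, n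
    -- + 2], so the distance is at most η plus the energy drop over [n, n + 2] divided by 2η.
    have hbound := image_norm_le_of_norm_deriv_right_le_deriv_boundary' (f := fun s => ζ s - ζ (t n))
      (a := t n) (b := t (n + 1)) (f' := fun s => -(P (ζ s) (g (ζ s))))
      (B := fun s => η / 2 * (s - t n) - (J (ζ s) - J (ζ (t n))) / (2 * η))
      (B' := fun s => η / 2 + ‖P (ζ s) (g (ζ s))‖ ^ 2 / (2 * η))
      (fun s hs => (((hflow s ((ht0 n).trans hs.1)).continuousWithinAt.mono
        fun x hx => mem_Ici.2 ((ht0 n).trans hx.1))).sub continuousWithinAt_const)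
      (fun s hs => ((hflow s ((ht0 n).trans hs.1)).mono
        (Ici_subset_Ici.2 ((ht0 n).trans hs.1))).sub_const _)
      (by simp)
      (((continuousOn_id.sub continuousOn_const).const_smul (η / 2)).sub
        (((hJc.mono fun x hx => mem_Ici.2 ((ht0 n).trans hx.1)).sub continuousOn_const).div_const _))
      (fun s hs => by
        have h1 := ((hJd' s ((ht0 n).trans hs.1)).mono
          (Ici_subset_Ici.2 ((ht0 n).trans hs.1))).sub_const (J (ζ (t n)))
        have h2 := ((hasDerivWithinAt_id s (Ici s)).sub_const (t n)).const_mul (η / 2)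
        have h3 : η / 2 + ‖P (ζ s) (g (ζ s))‖ ^ 2 / (2 * η) =
            η / 2 * 1 - -‖P (ζ s) (g (ζ s))‖ ^ 2 / (2 * η) := by ring
        rw [h3]
        exact h2.sub (h1.div_const (2 * η)))
      (fun s hs => by
        rw [norm_neg, div_add_div _ _ (by norm_num) (by positivity), le_div_iff₀ (by positivity)]
        nlinarith [sq_nonneg (η - ‖P (ζ s) (g (ζ s))‖)])
      (right_mem_Icc.2 hle)
    refine hbound.trans ?_
    have h1 : t (n + 1) - t n ≤ 2 := by
      have h1 := (ht n).1
      have h2 := (ht (n + 1)).2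
      push_cast at h2
      linarith
    have h2 : J (ζ (t n)) ≤ a n :=
      hanti (mem_Ici.2 n.cast_nonneg) (mem_Ici.2 (ht0 n)) (ht n).1.le
    have h3 : a (n + 2) ≤ J (ζ (t (n + 1))) := by
      refine hanti (mem_Ici.2 (ht0 _)) (mem_Ici.2 (Nat.cast_nonneg _)) ?_
      have := (ht (n + 1)).2
      push_cast at this ⊢
      linarith
    have h4 : η / 2 * (t (n + 1) - t n) ≤ η := by nlinarith
    have h5 : (J (ζ (t n)) - J (ζ (t (n + 1)))) / (2 * η) ≤ (a n - a (n + 2)) / (2 * η) := by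
      gcongr
    have h6 : (J (ζ (t (n + 1))) - J (ζ (t n))) / (2 * η) =
        -((J (ζ (t n)) - J (ζ (t (n + 1)))) / (2 * η)) := by ring
    simp only [h6]
    linarith

end Flow

/-! ### Weak derivatives on the line -/

theorem locallyIntegrable_L2 (u : L2) : LocallyIntegrable (u : ℝ → ℝ) volume :=
  (Lp.memLp u).locallyIntegrable (by norm_num)

/-- A compactly supported function on the line vanishes outside some interval `(-R, R)`. -/
theorem HasCompactSupport.exists_forall_eq_zero {φ : ℝ → ℝ} (hφ : HasCompactSupport φ) :
    ∃ R : ℝ, 0 < R ∧ ∀ x, R ≤ |x| → φ x = 0 := by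
  obtain ⟨R, hR, hs⟩ := hφ.isCompact.isBounded.subset_ball_lt 0 0
  refine ⟨R, hR, fun x hx => image_eq_zero_of_notMem_tsupport fun h => ?_⟩
  have := hs h
  rw [mem_ball_zero_iff, Real.norm_eq_abs] at this
  linarith

theorem integral_eq_intervalIntegral_of_eq_zero {φ : ℝ → ℝ} {R : ℝ} (hR : 0 < R)
    (h : ∀ x, R ≤ |x| → φ x = 0) : ∫ x, φ x = ∫ x in (-R)..R, φ x := by
  rw [intervalIntegral.integral_of_le (by linarith)]
  refine (setIntegral_eq_integral_of_forall_compl_eq_zero fun x hx => h x ?_).symm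
  rw [le_abs]
  by_contra! hcon
  exact hx ⟨by linarith, by linarith⟩

/-- The primitive of a locally integrable function has this function as weak derivative. -/
theorem isWeakDeriv_primitive {g : ℝ → ℝ} (hg : LocallyIntegrable g volume) :
    IsWeakDeriv (fun x => ∫ t in (0 : ℝ)..x, g t) g := by
  intro φ hφ hc
  obtain ⟨R, hR, hz⟩ := hc.exists_forall_eq_zero
  obtain ⟨R', hR', hz'⟩ := hc.deriv.exists_forall_eq_zero
  set S := max R R' with hS
  have hS0 : 0 < S := lt_max_of_lt_left hR
  have hgi : ∀ a b : ℝ, IntervalIntegrable g volume a b := fun a b =>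
    (hg.integrableOn_isCompact isCompact_uIcc).intervalIntegrable
  rw [integral_eq_intervalIntegral_of_eq_zero hS0 (fun x hx => by
      rw [hz' x ((le_max_right _ _).trans hx), mul_zero]),
    integral_eq_intervalIntegral_of_eq_zero hS0 (fun x hx => by
      rw [hz x ((le_max_left _ _).trans hx), mul_zero])]
  have h1 : AbsolutelyContinuousOnInterval (fun x => ∫ t in (0 : ℝ)..x, g t) (-S) S :=
    (hgi (-S) S).absolutelyContinuousOnInterval_intervalIntegral (by
      rw [uIcc_of_le (by linarith)]; exact ⟨by linarith, hS0.le⟩)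
  have h2 : AbsolutelyContinuousOnInterval φ (-S) S :=
    ((hφ.of_le (by exact_mod_cast le_top)).contDiffOn).absolutelyContinuousOnInterval
  rw [h1.integral_mul_deriv_eq_deriv_mul h2, hz S ((le_max_left _ _).trans (le_abs_self _)),
    hz (-S) (by rw [abs_neg]; exact (le_max_left _ _).trans (le_abs_self _))]
  simp only [mul_zero, sub_zero, zero_sub, neg_inj]
  refine intervalIntegral.integral_congr_ae ?_
  filter_upwards [LocallyIntegrable.ae_hasDerivAt_integral hg] with x hx _
  rw [(hx 0).deriv]

/-- A function with vanishing weak derivative is constant. -/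
theorem ae_eq_const_of_isWeakDeriv_zero {h : ℝ → ℝ} (hh : LocallyIntegrable h volume)
    (hd : IsWeakDeriv h 0) : ∃ c : ℝ, ∀ᵐ x, h x = c := by
  set β : ContDiffBump (0 : ℝ) := ⟨1, 2, one_pos, one_lt_two⟩ with hβ
  set η : ℝ → ℝ := β.normed volume with hη
  have hηs : ContDiff ℝ (⊤ : ℕ∞) η := β.contDiff_normed
  have hηc : HasCompactSupport η := β.hasCompactSupport_normed
  have hη1 : ∫ x, η x = 1 := β.integral_normed
  have hint : ∀ ψ : ℝ → ℝ, ContDiff ℝ (⊤ : ℕ∞) ψ → HasCompactSupport ψ →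
      Integrable (fun x => h x * ψ x) := by
    intro ψ hψ hψc
    simpa [mul_comm] using hh.integrable_smul_left_of_hasCompactSupport hψ.continuous hψc
  -- The constant is forced by testing against the bump η of integral 1.
  refine ⟨∫ x, h x * η x, ?_⟩
  set c := ∫ x, h x * η x with hc
  have hloc : LocallyIntegrable (fun x => h x - c) volume := hh.sub (locallyIntegrable_const c)
  have key := ae_eq_zero_of_integral_contDiff_smul_eq_zero hloc (fun ψ hψ hψc => ?_)
  · filter_upwards [key] with x hx
    linarith
  -- `ψ - (∫ ψ) η` is the derivative of a test function
  set a := ∫ x, ψ x with ha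
  set θ : ℝ → ℝ := fun x => ψ x - a * η x with hθ
  have hθs : ContDiff ℝ (⊤ : ℕ∞) θ := hψ.sub (contDiff_const.mul hηs)
  have hψi : Integrable ψ := hψ.continuous.integrable_of_hasCompactSupport hψc
  have hηi : Integrable η := hηs.continuous.integrable_of_hasCompactSupport hηc
  have hθi : Integrable θ := hψi.sub (hηi.const_mul a)
  have hθ0 : ∫ x, θ x = 0 := by
    rw [integral_sub hψi (hηi.const_mul a), integral_const_mul, hη1, mul_one, sub_self]
  obtain ⟨R₁, hR₁, hz₁⟩ := hψc.exists_forall_eq_zero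
  obtain ⟨R₂, hR₂, hz₂⟩ := hηc.exists_forall_eq_zero
  set R := max R₁ R₂ with hR
  have hR0 : 0 < R := lt_max_of_lt_left hR₁
  have hzθ : ∀ x, R ≤ |x| → θ x = 0 := fun x hx => by
    simp [hθ, hz₁ x ((le_max_left _ _).trans hx), hz₂ x ((le_max_right _ _).trans hx)]
  set Φ : ℝ → ℝ := fun x => ∫ t in (-R)..x, θ t with hΦ
  have hΦd : ∀ x, HasDerivAt Φ (θ x) x := fun x =>
    intervalIntegral.integral_hasDerivAt_right (hθs.continuous.intervalIntegrable _ _)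
      (hθs.continuous.stronglyMeasurableAtFilter _ _) hθs.continuous.continuousAt
  have hΦ' : deriv Φ = θ := funext fun x => (hΦd x).deriv
  have hΦs : ContDiff ℝ (⊤ : ℕ∞) Φ := by
    rw [contDiff_infty_iff_deriv, hΦ']
    exact ⟨fun x => (hΦd x).differentiableAt, hθs⟩
  have hΦc : HasCompactSupport Φ := by
    refine HasCompactSupport.of_support_subset_isCompact (isCompact_Icc (a := -R) (b := R)) ?_
    intro x hx
    by_contra hcon
    refine hx ?_
    simp only [hΦ]
    rcases lt_or_ge x (-R) with h1 | h1
    · rw [intervalIntegral.integral_symm, intervalIntegral.integral_of_le h1.le, neg_eq_zero]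
      refine setIntegral_eq_zero_of_forall_eq_zero fun t ht => hzθ t ?_
      rw [le_abs]; right; linarith [ht.2]
    · have h2 : R < x := by
        by_contra! h3
        exact hcon ⟨h1, h3⟩
      rw [← intervalIntegral.integral_add_adjacent_intervals (b := R)
        (hθs.continuous.intervalIntegrable _ _) (hθs.continuous.intervalIntegrable _ _),
        ← integral_eq_intervalIntegral_of_eq_zero hR0 hzθ, hθ0, zero_add,
        intervalIntegral.integral_of_le h2.le]
      refine setIntegral_eq_zero_of_forall_eq_zero fun t ht => hzθ t ?_
      rw [le_abs]; left; exact ht.1.le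
  have h3 := hd Φ hΦs hΦc
  simp only [hΦ', Pi.zero_apply, zero_mul, integral_zero, neg_zero] at h3
  have h4 : ∀ x, ψ x • (h x - c) = h x * θ x + a * (h x * η x) - c * ψ x := by
    intro x; simp only [hθ, smul_eq_mul]; ring
  have hθc : HasCompactSupport θ := hΦ' ▸ hΦc.deriv
  have h5 : Integrable fun x => h x * θ x + a * (h x * η x) :=
    (hint θ hθs hθc).add ((hint η hηs hηc).const_mul a)
  simp_rw [h4]
  rw [integral_sub h5 (hψi.const_mul c),
    integral_add (hint θ hθs hθc) ((hint η hηs hηc).const_mul a), h3, integral_const_mul,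
    integral_const_mul]
  simp only [← hc, ← ha]
  ring

namespace GapSoliton.H1

/-- Elements of `H¹(ℝ)` are primitives of their weak derivatives. -/
theorem exists_ae_eq_primitive (u : H1) :
    ∃ c : ℝ, ∀ᵐ x, u.fn x = c + ∫ t in (0 : ℝ)..x, u.der t := by
  have hg := locallyIntegrable_L2 u.der
  have hgi : ∀ a b : ℝ, IntervalIntegrable u.der volume a b := fun a b =>
    (hg.integrableOn_isCompact isCompact_uIcc).intervalIntegrable
  have hcont : Continuous fun x => ∫ t in (0 : ℝ)..x, u.der t :=
    intervalIntegral.continuous_primitive hgi 0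
  have hloc : LocallyIntegrable (fun x => u.fn x - ∫ t in (0 : ℝ)..x, u.der t) volume :=
    (locallyIntegrable_L2 u.fn).sub hcont.locallyIntegrable
  obtain ⟨c, hc⟩ := ae_eq_const_of_isWeakDeriv_zero hloc (by
    intro φ hφ hφc
    have h1 : IsWeakDeriv u.fn u.der := u.2
    have h2 := h1 φ hφ hφc
    have h3 := isWeakDeriv_primitive hg φ hφ hφc
    have hφ' : Continuous (deriv φ) := hφ.continuous_deriv (by simp)
    have i1 : Integrable fun x => u.fn x * deriv φ x := by
      simpa [mul_comm] using
        (locallyIntegrable_L2 u.fn).integrable_smul_left_of_hasCompactSupport hφ' hφc.deriv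
    have i2 : Integrable fun x => (∫ t in (0 : ℝ)..x, u.der t) * deriv φ x := by
      simpa [mul_comm] using
        hcont.locallyIntegrable.integrable_smul_left_of_hasCompactSupport hφ' hφc.deriv
    simp_rw [sub_mul]
    rw [integral_sub i1 i2, h2, h3]
    simp)
  refine ⟨c, ?_⟩
  filter_upwards [hc] with x hx
  linarith

end GapSoliton.H1

/-- Cauchy–Schwarz against the constant 1, from the nonnegativity of the integral of (|g| − mean)².
-/
theorem sq_setIntegral_abs_le {g : ℝ → ℝ} {I : Set ℝ} {l : ℝ} (hl : 0 < l)
    (hI : volume.real I = l) (hI' : volume I ≠ ∞) (hg : IntegrableOn g I)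
    (hg2 : IntegrableOn (fun x => g x ^ 2) I) :
    (∫ x in I, |g x|) ^ 2 ≤ l * ∫ x in I, g x ^ 2 := by
  set m := (∫ x in I, |g x|) / l with hm
  haveI : IsFiniteMeasure (volume.restrict I) := ⟨by simpa using hI'.lt_top⟩
  have h1 : 0 ≤ ∫ x in I, (|g x| - m) ^ 2 := integral_nonneg fun x => sq_nonneg _
  have h2 : ∀ x, (|g x| - m) ^ 2 = (g x ^ 2 - 2 * m * |g x|) + m ^ 2 := by
    intro x; rw [sub_sq, sq_abs]; ring
  simp_rw [h2] at h1
  have hga : IntegrableOn (fun x => 2 * m * |g x|) I := (hg.abs).const_mul (2 * m)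
  have hgs : IntegrableOn (fun x => g x ^ 2 - 2 * m * |g x|) I := hg2.sub hga
  rw [integral_add hgs (integrable_const _), integral_sub hg2 hga, integral_const_mul,
    integral_const, smul_eq_mul] at h1
  have h3 : (volume.restrict I).real univ = l := by rw [← hI]; simp [Measure.real]
  rw [h3] at h1
  have h4 : ∫ x in I, |g x| = m * l := by rw [hm]; field_simp
  rw [h4] at h1 ⊢
  nlinarith

/-! ### The local Sobolev inequality and the embedding into bounded functions -/

namespace GapSoliton.H1

theorem integrable_sq_L2 (u : L2) : Integrable (fun x => u x ^ 2) := (Lp.memLp u).integrable_sq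

/-- The local Sobolev inequality on an interval of length `l`. -/
theorem ae_sq_le_local (u : H1) (a : ℝ) {l : ℝ} (hl : 0 < l) :
    ∀ᵐ x, x ∈ Ioc a (a + l) → u.fn x ^ 2 ≤
      2 / l * (∫ y in Ioc a (a + l), u.fn y ^ 2) + 2 * l * ∫ y in Ioc a (a + l), u.der y ^ 2 := by
  obtain ⟨c, hc⟩ := u.exists_ae_eq_primitive
  have hg := locallyIntegrable_L2 u.der
  have hgi : ∀ a b : ℝ, IntervalIntegrable u.der volume a b := fun a b =>
    (hg.integrableOn_isCompact isCompact_uIcc).intervalIntegrable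
  set I := Ioc a (a + l) with hI
  have hIl : volume.real I = l := by simp [hI, Measure.real, hl.le]
  have hI' : volume I ≠ ∞ := by simp [hI]
  haveI : IsFiniteMeasure (volume.restrict I) := ⟨by simpa using hI'.lt_top⟩
  have hcs := sq_setIntegral_abs_le hl hIl hI'
    ((hg.integrableOn_isCompact (isCompact_Icc (a := a) (b := a + l))).mono_set Ioc_subset_Icc_self)
    (integrable_sq_L2 u.der).integrableOn
  set U : ℝ → ℝ := fun x => c + ∫ t in (0 : ℝ)..x, u.der t with hU
  have hUd : ∀ x ∈ I, ∀ y ∈ I, (U x - U y) ^ 2 ≤ l * ∫ y in I, u.der y ^ 2 := by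
    intro x hx y hy
    refine le_trans ?_ hcs
    have h1 : U x - U y = ∫ t in y..x, u.der t := by
      simp only [hU]
      rw [add_sub_add_left_eq_sub, intervalIntegral.integral_interval_sub_left (hgi _ _) (hgi _ _)]
    rw [h1, ← sq_abs]
    gcongr
    rw [← Real.norm_eq_abs]
    refine (intervalIntegral.norm_integral_le_integral_norm_uIoc).trans ?_
    simp only [Real.norm_eq_abs]
    refine setIntegral_mono_set ?_ (Eventually.of_forall fun t => abs_nonneg _) ?_
    · exact ((hg.integrableOn_isCompact
        (isCompact_Icc (a := a) (b := a + l))).mono_set Ioc_subset_Icc_self).abs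
    · refine HasSubset.Subset.eventuallyLE fun t ht => ?_
      have ht' := ht
      rw [mem_uIoc] at ht'
      rcases ht' with h | h
      · exact ⟨hy.1.trans h.1, h.2.trans hx.2⟩
      · exact ⟨hx.1.trans h.1, h.2.trans hy.2⟩
  have hUI : ∫ y in I, U y ^ 2 = ∫ y in I, u.fn y ^ 2 := by
    refine integral_congr_ae (ae_restrict_of_ae ?_)
    filter_upwards [hc] with y hy
    rw [hy]
  have hUint : IntegrableOn (fun y => U y ^ 2) I := by
    refine (integrable_sq_L2 u.fn).integrableOn.congr (ae_restrict_of_ae ?_)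
    filter_upwards [hc] with y hy
    rw [hy]
  filter_upwards [hc] with x hx hxI
  rw [hx, ← hUI]
  change U x ^ 2 ≤ _
  -- Average U(x)² ≤ 2U(y)² + 2(U(x) − U(y))² over y in the interval.
  have h2 : ∫ y in I, U x ^ 2 ≤ ∫ y in I, (2 * U y ^ 2 + 2 * (l * ∫ y in I, u.der y ^ 2)) := by
    refine setIntegral_mono_on (integrable_const _) ((hUint.const_mul 2).add (integrable_const _))
      measurableSet_Ioc fun y hy => ?_
    nlinarith [hUd x hxI y hy, sq_nonneg (U x - 2 * U y)]
  have h3 : (volume.restrict I).real univ = l := by rw [← hIl]; simp [Measure.real]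
  rw [integral_add (hUint.const_mul 2) (integrable_const _), integral_const, integral_const,
    integral_const_mul, h3, smul_eq_mul, smul_eq_mul] at h2
  have h4 : U x ^ 2 = l⁻¹ * (l * U x ^ 2) := by field_simp
  rw [h4]
  calc l⁻¹ * (l * U x ^ 2) ≤ l⁻¹ * (2 * (∫ y in I, U y ^ 2) + l * (2 * (l * ∫ y in I, u.der y ^ 2))) := by
        gcongr
    _ = _ := by field_simp

theorem norm_sq_eq (u : H1) : ‖u‖ ^ 2 = ‖u.fn‖ ^ 2 + ‖u.der‖ ^ 2 := by
  have h : ‖u‖ = ‖(u : WithLp 2 (L2 × L2))‖ := rfl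
  rw [h, WithLp.prod_norm_sq_eq_of_L2]
  rfl

theorem norm_sq_L2 (u : L2) : ‖u‖ ^ 2 = ∫ x, u x ^ 2 := by
  rw [← real_inner_self_eq_norm_sq, L2.inner_def]
  simp [pow_two]

theorem inner_L2 (u v : L2) : inner ℝ u v = ∫ x, u x * v x := by
  rw [L2.inner_def]
  simp [mul_comm]

/-- The Sobolev embedding of `H¹(ℝ)` into the bounded functions. -/
theorem ae_abs_le (u : H1) : ∀ᵐ x, |u.fn x| ≤ 2 * ‖u‖ := by
  have h : ∀ᵐ x, ∀ n : ℤ, x ∈ Ioc ((n : ℝ)) (n + 1) → u.fn x ^ 2 ≤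
      2 / 1 * (∫ y in Ioc (n : ℝ) (n + 1), u.fn y ^ 2) +
        2 * 1 * ∫ y in Ioc (n : ℝ) (n + 1), u.der y ^ 2 :=
    ae_all_iff.2 fun n => u.ae_sq_le_local n one_pos
  filter_upwards [h] with x hx
  -- The half-open unit interval that contains `x` ends at ⌈x⌉.
  have h1 := hx (⌈x⌉ - 1) ⟨by push_cast; linarith [Int.ceil_lt_add_one x],
    by push_cast; linarith [Int.le_ceil x]⟩
  have h2 : ∀ (w : L2) (I : Set ℝ), ∫ y in I, w y ^ 2 ≤ ‖w‖ ^ 2 := fun w I => by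
    rw [norm_sq_L2]
    exact setIntegral_le_integral (integrable_sq_L2 w) (Eventually.of_forall fun _ => sq_nonneg _)
  refine abs_le_of_sq_le_sq ?_ (by positivity)
  refine h1.trans ?_
  rw [mul_pow, norm_sq_eq]
  nlinarith [h2 u.fn (Ioc (((⌈x⌉ - 1 : ℤ) : ℝ)) (((⌈x⌉ - 1 : ℤ) : ℝ) + 1)),
    h2 u.der (Ioc (((⌈x⌉ - 1 : ℤ) : ℝ)) (((⌈x⌉ - 1 : ℤ) : ℝ) + 1)), sq_nonneg ‖u.fn‖,
    sq_nonneg ‖u.der‖]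

end GapSoliton.H1

/-! ### Form bounds for Stepanov bounded weights, and test functions -/

namespace GapSoliton.H1

theorem lintegral_sq_L2 (w : L2) (I : Set ℝ) :
    ∫⁻ x in I, ENNReal.ofReal (w x ^ 2) = ENNReal.ofReal (∫ x in I, w x ^ 2) :=
  (ofReal_integral_eq_lintegral_ofReal (integrable_sq_L2 w).integrableOn
    (Eventually.of_forall fun _ => sq_nonneg _)).symm

/-- Stepanov bounded weights are form bounded, with arbitrarily small bound. -/
theorem lintegral_weight_le {V : ℝ → ℝ} {l : ℝ} (hl : 0 < l) (hl1 : l ≤ 1)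
    (u : H1) : ∫⁻ x, ‖V x‖ₑ * ENNReal.ofReal (u.fn x ^ 2) ≤
      bsNorm (fun x => ‖V x‖ₑ) * ENNReal.ofReal (2 / l * ‖u.fn‖ ^ 2 + 2 * l * ‖u.der‖ ^ 2) := by
  set W := bsNorm fun x => ‖V x‖ₑ with hW
  -- Tile the line by intervals of length l. As l ≤ 1, each tile lies in a unit window, so ∫|V| over
  -- it is at most the BS norm, while u² is bounded there by the local Sobolev inequality.
  set s : ℤ → Set ℝ := fun n => Ioc (n • l) ((n + 1) • l) with hs
  have hsm : ∀ n, MeasurableSet (s n) := fun n => measurableSet_Ioc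
  have hcover : ∀ F : ℝ → ℝ≥0∞, ∫⁻ x, F x = ∑' n, ∫⁻ x in s n, F x := by
    intro F
    rw [← lintegral_iUnion hsm (pairwise_disjoint_Ioc_zsmul l), iUnion_Ioc_zsmul hl,
      Measure.restrict_univ]
  have hsI : ∀ n, s n = Ioc (n • l) (n • l + l) := by
    intro n; simp only [hs]; rw [add_smul, one_smul]
  have hVs : ∀ n, ∫⁻ x in s n, ‖V x‖ₑ ≤ W := by
    intro n
    refine le_trans ?_ (le_iSup (fun t : ℝ => ∫⁻ x in Icc t (t + 1), ‖V x‖ₑ) (n • l))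
    refine lintegral_mono_set ?_
    rw [hsI]
    exact fun x hx => ⟨hx.1.le, hx.2.trans (by linarith)⟩
  have hloc : ∀ n, ∫⁻ x in s n, ‖V x‖ₑ * ENNReal.ofReal (u.fn x ^ 2) ≤
      W * (ENNReal.ofReal (2 / l) * (∫⁻ x in s n, ENNReal.ofReal (u.fn x ^ 2)) +
        ENNReal.ofReal (2 * l) * ∫⁻ x in s n, ENNReal.ofReal (u.der x ^ 2)) := by
    intro n
    have hnn : ∀ w : L2, 0 ≤ ∫ y in s n, w y ^ 2 := fun w => integral_nonneg fun _ => sq_nonneg _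
    rw [lintegral_sq_L2, lintegral_sq_L2, ← ENNReal.ofReal_mul (by positivity),
      ← ENNReal.ofReal_mul (by positivity),
      ← ENNReal.ofReal_add (mul_nonneg (by positivity) (hnn _)) (mul_nonneg (by positivity) (hnn _))]
    set B := 2 / l * (∫ y in s n, u.fn y ^ 2) + 2 * l * ∫ y in s n, u.der y ^ 2 with hB
    calc ∫⁻ x in s n, ‖V x‖ₑ * ENNReal.ofReal (u.fn x ^ 2)
        ≤ ∫⁻ x in s n, ‖V x‖ₑ * ENNReal.ofReal B := by
          refine lintegral_mono_ae ?_
          rw [ae_restrict_iff' (hsm n)]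
          have h1 := u.ae_sq_le_local (n • l) hl
          rw [← hsI] at h1
          filter_upwards [h1] with x hx hxs
          gcongr
          exact hx hxs
      _ = (∫⁻ x in s n, ‖V x‖ₑ) * ENNReal.ofReal B :=
          lintegral_mul_const' _ _ ENNReal.ofReal_ne_top
      _ ≤ _ := by gcongr; exact hVs n
  rw [hcover]
  refine (ENNReal.tsum_le_tsum hloc).trans ?_
  rw [ENNReal.tsum_mul_left, ENNReal.tsum_add, ENNReal.tsum_mul_left, ENNReal.tsum_mul_left,
    ← hcover, ← hcover]
  have huniv : ∀ w : L2, ∫⁻ x, ENNReal.ofReal (w x ^ 2) = ENNReal.ofReal (‖w‖ ^ 2) := fun w => by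
    have := lintegral_sq_L2 w univ
    rwa [setLIntegral_univ, setIntegral_univ, ← norm_sq_L2] at this
  rw [huniv, huniv, ← ENNReal.ofReal_mul (by positivity), ← ENNReal.ofReal_mul (by positivity),
    ← ENNReal.ofReal_add (by positivity) (by positivity)]

theorem integrable_weight_sq {V : ℝ → ℝ} (hV : StepanovBounded V) (u : H1) :
    Integrable fun x => |V x| * u.fn x ^ 2 := by
  refine ⟨(hV.1.aestronglyMeasurable.norm).mul (integrable_sq_L2 u.fn).aestronglyMeasurable, ?_⟩
  rw [hasFiniteIntegral_iff_enorm]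
  have h1 : ∀ x, ‖|V x| * u.fn x ^ 2‖ₑ = ‖V x‖ₑ * ENNReal.ofReal (u.fn x ^ 2) := by
    intro x
    rw [enorm_mul, Real.enorm_abs, Real.enorm_of_nonneg (sq_nonneg _)]
  simp_rw [h1]
  refine (lintegral_weight_le one_pos le_rfl u).trans_lt ?_
  exact ENNReal.mul_lt_top hV.2 ENNReal.ofReal_lt_top

theorem integral_weight_sq_le {V : ℝ → ℝ} (hV : StepanovBounded V) {l : ℝ} (hl : 0 < l)
    (hl1 : l ≤ 1) (u : H1) : ∫ x, |V x| * u.fn x ^ 2 ≤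
      (bsNorm fun x => ‖V x‖ₑ).toReal * (2 / l * ‖u.fn‖ ^ 2 + 2 * l * ‖u.der‖ ^ 2) := by
  rw [integral_eq_lintegral_of_nonneg_ae (Eventually.of_forall fun x => by positivity)
    (integrable_weight_sq hV u).aestronglyMeasurable]
  refine ENNReal.toReal_le_of_le_ofReal (by positivity) ?_
  rw [ENNReal.ofReal_mul ENNReal.toReal_nonneg, ENNReal.ofReal_toReal hV.2.ne]
  refine le_trans (le_of_eq ?_) (lintegral_weight_le hl hl1 u)
  refine lintegral_congr fun x => ?_
  rw [ENNReal.ofReal_mul (abs_nonneg _), ← Real.norm_eq_abs, ofReal_norm_eq_enorm]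

theorem integrable_weight_mul {V : ℝ → ℝ} (hV : StepanovBounded V) (u v : H1) :
    Integrable fun x => V x * u.fn x * v.fn x := by
  refine Integrable.mono' ((integrable_weight_sq hV u).add (integrable_weight_sq hV v))
    ((hV.1.aestronglyMeasurable.mul (Lp.memLp u.fn).1).mul (Lp.memLp v.fn).1) ?_
  refine Eventually.of_forall fun x => ?_
  rw [Real.norm_eq_abs, abs_mul, abs_mul, Pi.add_apply, ← mul_add, mul_assoc]
  refine mul_le_mul_of_nonneg_left ?_ (abs_nonneg _)
  nlinarith [sq_nonneg (|u.fn x| - |v.fn x|), sq_abs (u.fn x), sq_abs (v.fn x),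
    sq_nonneg (u.fn x), sq_nonneg (v.fn x)]

theorem integrable_mul_L2 (u v : L2) : Integrable fun x => u x * v x :=
  (Lp.memLp u).integrable_mul (Lp.memLp v)

/-! ### The inclusion into `L²` and test functions -/

/-- The inclusion of `H¹(ℝ)` into `L²(ℝ)`. -/
noncomputable def fnL : H1 →L[ℝ] L2 :=
  LinearMap.mkContinuous
    { toFun := fun u => u.fn
      map_add' := fun _ _ => rfl
      map_smul' := fun _ _ => rfl } 1 fun u => by
    rw [one_mul]
    refine le_of_sq_le_sq ?_ (norm_nonneg _)
    rw [norm_sq_eq]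
    exact le_add_of_nonneg_right (sq_nonneg _)

theorem fnL_apply (u : H1) : fnL u = u.fn := rfl

theorem norm_fn_le (u : H1) : ‖u.fn‖ ≤ ‖u‖ := by
  refine le_of_sq_le_sq ?_ (norm_nonneg _)
  rw [norm_sq_eq]
  exact le_add_of_nonneg_right (sq_nonneg _)

/-- A function determines its weak derivative, by testing against all test functions. -/
theorem fn_injective {u : H1} (h : u.fn = 0) : u = 0 := by
  have hu : IsWeakDeriv u.fn u.der := u.2
  have h0 : u.der = 0 := by
    have h1 : ∀ᵐ x, u.der x = 0 :=
      ae_eq_zero_of_integral_contDiff_smul_eq_zero (locallyIntegrable_L2 u.der) fun φ hφ hφc => by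
        have h2 := hu φ hφ hφc
        rw [h] at h2
        have h3 : ∫ x, (0 : L2) x * deriv φ x = 0 := by
          rw [← integral_zero ℝ ℝ]
          refine integral_congr_ae ?_
          filter_upwards [Lp.coeFn_zero ℝ 2 (volume : Measure ℝ)] with x hx
          rw [hx]
          simp
        rw [h3] at h2
        simp only [smul_eq_mul]
        simp_rw [mul_comm (φ _)]
        linarith
    rw [Lp.eq_zero_iff_ae_eq_zero]
    exact h1
  rw [← norm_eq_zero, ← sq_eq_zero_iff, norm_sq_eq, h, h0]
  simp

/-- Test functions belong to `H¹(ℝ)`. -/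
theorem exists_of_testFunction {φ : ℝ → ℝ} (hφ : ContDiff ℝ (⊤ : ℕ∞) φ) (hc : HasCompactSupport φ) :
    ∃ u : H1, ‖u.fn‖ ^ 2 = ∫ x, φ x ^ 2 ∧ ‖u.der‖ ^ 2 = ∫ x, deriv φ x ^ 2 := by
  have h1 : MemLp φ 2 volume := hφ.continuous.memLp_of_hasCompactSupport hc
  have h2 : MemLp (deriv φ) 2 volume :=
    (hφ.continuous_deriv (by simp)).memLp_of_hasCompactSupport hc.deriv
  refine ⟨⟨WithLp.toLp 2 (h1.toLp φ, h2.toLp (deriv φ)), ?_⟩, ?_, ?_⟩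
  · intro ψ hψ hψc
    have h3 : ∫ x, (h1.toLp φ) x * deriv ψ x = ∫ x, φ x * deriv ψ x := by
      refine integral_congr_ae ?_
      filter_upwards [h1.coeFn_toLp] with x hx
      rw [hx]
    have h4 : ∫ x, (h2.toLp (deriv φ)) x * ψ x = ∫ x, deriv φ x * ψ x := by
      refine integral_congr_ae ?_
      filter_upwards [h2.coeFn_toLp] with x hx
      rw [hx]
    refine h3.trans (Eq.trans ?_ (congrArg Neg.neg h4.symm))
    have hd : ∀ {θ : ℝ → ℝ}, ContDiff ℝ (⊤ : ℕ∞) θ → ∀ x, HasDerivAt θ (deriv θ x) x :=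
      fun hθ x => ((hθ.differentiable (by simp)) x).hasDerivAt
    refine integral_mul_deriv_eq_deriv_mul_of_integrable (fun x _ => hd hφ x) (fun x _ => hd hψ x) ?_ ?_ ?_
    · exact (hφ.continuous.mul (hψ.continuous_deriv (by simp))).integrable_of_hasCompactSupport
        hc.mul_right
    · exact ((hφ.continuous_deriv (by simp)).mul hψ.continuous).integrable_of_hasCompactSupport
        hψc.mul_left
    · exact (hφ.continuous.mul hψ.continuous).integrable_of_hasCompactSupport hc.mul_right
  · rw [norm_sq_L2]
    refine integral_congr_ae ?_
    filter_upwards [h1.coeFn_toLp] with x hx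
    rw [← hx]
    rfl
  · rw [norm_sq_L2]
    refine integral_congr_ae ?_
    filter_upwards [h2.coeFn_toLp] with x hx
    rw [← hx]
    rfl

/-- The derivative is not bounded in `L²(ℝ)`. -/
theorem exists_der_large (C : ℝ) : ∃ u : H1, C * ‖u.fn‖ ^ 2 < ‖u.der‖ ^ 2 := by
  set β : ContDiffBump (0 : ℝ) := ⟨1, 2, one_pos, one_lt_two⟩ with hβ
  set η : ℝ → ℝ := β.normed volume with hη
  have hηs : ContDiff ℝ (⊤ : ℕ∞) η := β.contDiff_normed
  have hηc : HasCompactSupport η := β.hasCompactSupport_normed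
  set A := ∫ x, η x ^ 2 with hA
  set B := ∫ x, deriv η x ^ 2 with hB
  have hA0 : 0 ≤ A := integral_nonneg fun _ => sq_nonneg _
  have hη' : Continuous (deriv η) := hηs.continuous_deriv (by simp)
  have hB0 : 0 < B := by
    have hB1 : 0 ≤ B := integral_nonneg fun _ => sq_nonneg _
    refine lt_of_le_of_ne hB1 fun h0 => ?_
    have h1 : (fun x => deriv η x ^ 2) = 0 := by
      have h2 : (fun x => deriv η x ^ 2) =ᵐ[volume] 0 :=
        (integral_eq_zero_iff_of_nonneg (fun _ => sq_nonneg _)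
          ((hη'.memLp_of_hasCompactSupport (p := 2) hηc.deriv).integrable_sq)).1 h0.symm
      exact (Continuous.ae_eq_iff_eq volume (hη'.pow 2) continuous_const).1 h2
    have h3 : ∀ x, deriv η x = 0 := fun x => by simpa using congrFun h1 x
    obtain ⟨R, hR, hz⟩ := hηc.exists_forall_eq_zero
    have h4 : ∀ x, η x = 0 := fun x =>
      (is_const_of_deriv_eq_zero (hηs.differentiable (by simp)) h3 x R).trans
        (hz R (le_abs_self R))
    have h5 : ∫ x, η x = 1 := β.integral_normed
    simp [h4] at h5
  -- Compressing the bump to η(nx) divides ‖u‖² by n and multiplies ‖u'‖² by n.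
  obtain ⟨n, hn⟩ := exists_nat_gt (max 1 (|C| * A / B))
  have hn1 : 1 < (n : ℝ) := (le_max_left _ _).trans_lt hn
  have hn2 : |C| * A < n * B := by
    have := (le_max_right _ _).trans_lt hn
    rwa [div_lt_iff₀ hB0] at this
  have hn0 : (n : ℝ) ≠ 0 := by positivity
  have hφs : ContDiff ℝ (⊤ : ℕ∞) fun x => η (n * x) := hηs.comp (contDiff_const.mul contDiff_id)
  have hφc : HasCompactSupport fun x => η (n * x) := by
    exact hηc.comp_homeomorph (Homeomorph.mulLeft₀ (n : ℝ) hn0)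
  obtain ⟨u, hu1, hu2⟩ := exists_of_testFunction hφs hφc
  refine ⟨u, ?_⟩
  have hd : ∀ x, deriv (fun x => η (n * x)) x = n * deriv η (n * x) := by
    intro x
    have := deriv_comp_mul_left (n : ℝ) η x
    simpa using this
  have hni : |(n : ℝ)⁻¹| = (n : ℝ)⁻¹ := abs_of_nonneg (by positivity)
  simp_rw [hd, mul_pow] at hu2
  rw [Measure.integral_comp_mul_left (fun y => η y ^ 2), hni, smul_eq_mul] at hu1
  rw [integral_const_mul, Measure.integral_comp_mul_left (fun y => deriv η y ^ 2), hni,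
    smul_eq_mul] at hu2
  rw [hu1, hu2]
  have h6 : C * ((n : ℝ)⁻¹ * A) ≤ (n : ℝ)⁻¹ * (|C| * A) := by
    rw [mul_left_comm]
    gcongr
    exact le_abs_self C
  have h7 : (n : ℝ)⁻¹ * (|C| * A) < (n : ℝ)⁻¹ * (n * B) := by gcongr
  have h8 : (n : ℝ)⁻¹ * (n * B) = B := by field_simp
  have h9 : (n : ℝ) ^ 2 * ((n : ℝ)⁻¹ * B) = n * B := by field_simp
  rw [h9]
  nlinarith

end GapSoliton.H1

/-! ### Operators associated with symmetric forms -/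

/-- A bounded symmetric form is represented by a symmetric operator. -/
theorem exists_operator_of_form {H : Type*} [NormedAddCommGroup H] [InnerProductSpace ℝ H]
    [CompleteSpace H] (B : H → H → ℝ) (hsymm : ∀ u v, B u v = B v u)
    (hadd : ∀ u u' v, B (u + u') v = B u v + B u' v) (hsmul : ∀ (c : ℝ) u v, B (c • u) v = c * B u v)
    {C : ℝ} (hC : 0 ≤ C) (hb : ∀ u v, |B u v| ≤ C * (‖u‖ ^ 2 + ‖v‖ ^ 2)) :
    ∃ A : H →L[ℝ] H, SymmOp A ∧ (∀ u v, inner ℝ (A u) v = B u v) ∧ ‖A‖ ≤ 2 * C := by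
  have hb' : ∀ u v, |B u v| ≤ 2 * C * ‖u‖ * ‖v‖ := by
    intro u v
    have hz : ∀ w, B 0 w = 0 := fun w => by simpa using hsmul 0 0 w
    rcases eq_or_ne u 0 with rfl | hu
    · simp [hz]
    rcases eq_or_ne v 0 with rfl | hv
    · simp [hsymm u, hz]
    -- Normalizing both arguments turns the bound by a sum of squares into one by a product.
    have h1 := hb (‖u‖⁻¹ • u) (‖v‖⁻¹ • v)
    rw [hsmul, hsymm u, hsmul, hsymm v] at h1
    have hu' : 0 < ‖u‖ := norm_pos_iff.2 hu
    have hv' : 0 < ‖v‖ := norm_pos_iff.2 hv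
    rw [norm_smul, norm_smul, norm_inv, norm_inv, norm_norm, norm_norm, inv_mul_cancel₀ hu'.ne',
      inv_mul_cancel₀ hv'.ne', abs_mul, abs_mul, abs_of_pos (inv_pos.2 hu'),
      abs_of_pos (inv_pos.2 hv')] at h1
    have h2 : |B u v| = ‖u‖ * ‖v‖ * (‖u‖⁻¹ * (‖v‖⁻¹ * |B u v|)) := by field_simp
    rw [h2]
    calc ‖u‖ * ‖v‖ * (‖u‖⁻¹ * (‖v‖⁻¹ * |B u v|)) ≤ ‖u‖ * ‖v‖ * (C * (1 ^ 2 + 1 ^ 2)) := by gcongr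
      _ = _ := by ring
  set b : H →L[ℝ] H →L[ℝ] ℝ := (LinearMap.mk₂ ℝ B hadd hsmul
    (fun u v v' => by rw [hsymm, hadd, hsymm v, hsymm v'])
    (fun c u v => by rw [hsymm, hsmul, hsymm v]; rfl)).mkContinuous₂ (2 * C) hb' with hbdef
  have hA : ∀ u v, inner ℝ (InnerProductSpace.continuousLinearMapOfBilin b u) v = B u v := fun u v =>
    InnerProductSpace.continuousLinearMapOfBilin_apply b u v
  refine ⟨InnerProductSpace.continuousLinearMapOfBilin b, fun u v => ?_, hA, ?_⟩
  · rw [hA, real_inner_comm, hA, hsymm]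
  · refine ContinuousLinearMap.opNorm_le_bound _ (by positivity) fun u => ?_
    set y := InnerProductSpace.continuousLinearMapOfBilin b u with hy
    rcases (norm_nonneg y).eq_or_lt with h0 | h0
    · rw [← h0]; positivity
    · have h1 : ‖y‖ * ‖y‖ ≤ (2 * C * ‖u‖) * ‖y‖ := by
        rw [← real_inner_self_eq_norm_mul_norm]
        nth_rewrite 1 [hy]
        rw [hA]
        exact (le_abs_self _).trans (hb' u y)
      exact le_of_mul_le_mul_right h1 h0

namespace GapSoliton

theorem H1.inner_smul_l (c : ℝ) (u v : H1) : inner ℝ (c • u) v = c * inner ℝ u v :=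
  real_inner_smul_left (F := H1) u v c

theorem H1.inner_smul_r (c : ℝ) (u v : H1) : inner ℝ u (c • v) = c * inner ℝ u v :=
  real_inner_smul_right (F := H1) u v c

theorem inner_smul_L2 (c : ℝ) (u v : L2) : inner ℝ (c • u) v = c * inner ℝ u v :=
  real_inner_smul_left (F := L2) u v c

/-- The operator on `H¹(ℝ)` that represents the inner product of `L²(ℝ)`. -/
noncomputable def massOp : H1 →L[ℝ] H1 := H1.fnL.adjoint ∘L H1.fnL

theorem inner_massOp (u v : H1) : inner ℝ (massOp u) v = inner ℝ u.fn v.fn := by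
  rw [massOp, ContinuousLinearMap.comp_apply, ContinuousLinearMap.adjoint_inner_left]
  rfl

theorem symmOp_massOp : SymmOp massOp := by
  intro u v
  rw [inner_massOp, real_inner_comm (massOp v) u, inner_massOp]
  exact real_inner_comm _ _

/-! ### The Schrödinger form and the spectral splitting of its domain -/

section Potential

variable {V : ℝ → ℝ} (hV : StepanovBounded V)
include hV

theorem schrodingerForm_eq (u v : H1) : schrodingerForm V u v =
    inner ℝ u.der v.der + ∫ x, V x * u.fn x * v.fn x := by
  rw [schrodingerForm, integral_add (H1.integrable_mul_L2 _ _) (H1.integrable_weight_mul hV u v),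
    H1.inner_L2]

/-- The form is bounded on H¹ because V is form bounded. All spectral arguments use this bounded
operator together with `massOp`, in place of the unbounded L. -/
theorem exists_formOp : ∃ A : H1 →L[ℝ] H1, SymmOp A ∧
    ∀ u v, inner ℝ (A u) v = schrodingerForm V u v := by
  set W := (bsNorm fun x => ‖V x‖ₑ).toReal with hW
  have hW0 : 0 ≤ W := ENNReal.toReal_nonneg
  obtain ⟨A, hA, hA', -⟩ := exists_operator_of_form (H := H1) (schrodingerForm V) (C := 1 + 2 * W)
    (fun u v => by
      rw [schrodingerForm, schrodingerForm]
      refine integral_congr_ae (Eventually.of_forall fun x => ?_)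
      simp only
      ring)
    (fun u u' v => by
      rw [schrodingerForm_eq hV, schrodingerForm_eq hV, schrodingerForm_eq hV]
      have h1 : (u + u').der = u.der + u'.der := rfl
      have h2 : ∫ x, V x * (u + u').fn x * v.fn x =
          (∫ x, V x * u.fn x * v.fn x) + ∫ x, V x * u'.fn x * v.fn x := by
        rw [← integral_add (H1.integrable_weight_mul hV u v) (H1.integrable_weight_mul hV u' v)]
        refine integral_congr_ae ?_
        filter_upwards [Lp.coeFn_add u.fn u'.fn] with x hx
        have h3 : (u + u').fn x = u.fn x + u'.fn x := hx
        rw [h3]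
        ring
      rw [h1, h2, inner_add_left]
      ring)
    (fun c u v => by
      rw [schrodingerForm_eq hV, schrodingerForm_eq hV]
      have h1 : (c • u).der = c • u.der := rfl
      have h2 : ∫ x, V x * (c • u).fn x * v.fn x = c * ∫ x, V x * u.fn x * v.fn x := by
        rw [← integral_const_mul]
        refine integral_congr_ae ?_
        filter_upwards [Lp.coeFn_smul c u.fn] with x hx
        have h3 : (c • u).fn x = c * u.fn x := hx
        rw [h3]
        ring
      rw [h1, h2, inner_smul_L2]
      ring)
    (by positivity)
    (fun u v => by
      rw [schrodingerForm_eq hV]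
      have h1 : |inner ℝ u.der v.der| ≤ ‖u‖ ^ 2 + ‖v‖ ^ 2 := by
        have h2 := abs_real_inner_le_norm u.der v.der
        have h3 := u.norm_sq_eq
        have h4 := v.norm_sq_eq
        nlinarith [sq_nonneg (‖u.der‖ - ‖v.der‖), sq_nonneg ‖u.fn‖, sq_nonneg ‖v.fn‖,
          sq_nonneg ‖u.der‖, sq_nonneg ‖v.der‖]
      have h2 : ∀ w : H1, ∫ x, |V x| * w.fn x ^ 2 ≤ 2 * W * ‖w‖ ^ 2 := fun w => by
        refine (H1.integral_weight_sq_le hV one_pos le_rfl w).trans (le_of_eq ?_)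
        rw [H1.norm_sq_eq, ← hW]
        ring
      have h3 : |∫ x, V x * u.fn x * v.fn x| ≤ 2 * W * (‖u‖ ^ 2 + ‖v‖ ^ 2) := by
        rw [mul_add]
        refine le_trans ?_ (add_le_add (h2 u) (h2 v))
        rw [← integral_add (H1.integrable_weight_sq hV u) (H1.integrable_weight_sq hV v),
          ← Real.norm_eq_abs]
        refine norm_integral_le_of_norm_le
          ((H1.integrable_weight_sq hV u).add (H1.integrable_weight_sq hV v))
          (Eventually.of_forall fun x => ?_)
        rw [Real.norm_eq_abs, abs_mul, abs_mul, ← mul_add, mul_assoc]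
        refine mul_le_mul_of_nonneg_left ?_ (abs_nonneg _)
        nlinarith [sq_nonneg (|u.fn x| - |v.fn x|), sq_abs (u.fn x), sq_abs (v.fn x),
          sq_nonneg (u.fn x), sq_nonneg (v.fn x)]
      refine (abs_add_le _ _).trans ((add_le_add h1 h3).trans (le_of_eq ?_))
      ring)
  exact ⟨A, hA, hA'⟩

/-- The form of `L` is bounded from below. -/
theorem exists_garding : ∃ l : ℝ, 0 < l ∧ ∀ u : H1,
    1 / 2 * ‖u‖ ^ 2 ≤ schrodingerForm V u u + l * ‖u.fn‖ ^ 2 := by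
  set W := (bsNorm fun x => ‖V x‖ₑ).toReal with hW
  have hW0 : 0 ≤ W := ENNReal.toReal_nonneg
  -- Chosen so that 2dW ≤ 1/2: the potential takes at most half of ‖u'‖².
  set d : ℝ := 1 / (4 * W + 4) with hd
  have hd0 : 0 < d := by positivity
  have hd1 : d ≤ 1 := by
    rw [hd, div_le_one (by positivity)]
    linarith
  have hWd : W * d ≤ 1 / 4 := by
    rw [hd, mul_one_div, div_le_iff₀ (by positivity)]
    linarith
  refine ⟨1 / 2 + W * (2 / d), by positivity, fun u => ?_⟩
  have h1 := H1.integral_weight_sq_le hV hd0 hd1 u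
  have h2 : -∫ x, |V x| * u.fn x ^ 2 ≤ ∫ x, V x * u.fn x * u.fn x := by
    rw [← integral_neg]
    refine integral_mono (H1.integrable_weight_sq hV u).neg (H1.integrable_weight_mul hV u u)
      fun x => ?_
    simp only
    nlinarith [neg_abs_le (V x), sq_nonneg (u.fn x)]
  rw [schrodingerForm_eq hV, real_inner_self_eq_norm_sq, H1.norm_sq_eq]
  rw [← hW] at h1
  nlinarith [sq_nonneg ‖u.der‖]

/-- If `0` is in the resolvent set of `L`, then the form operator is bounded below. -/
theorem exists_le_norm_formOp (h0 : (0 : ℝ) ∉ schrodingerSpectrum V) {A : H1 →L[ℝ] H1}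
    (hA : SymmOp A) (hAf : ∀ u v, inner ℝ (A u) v = schrodingerForm V u v) :
    ∃ α : ℝ, 0 < α ∧ ∀ u, α * ‖u‖ ≤ ‖A u‖ := by
  obtain ⟨T, hT1, hT2⟩ := not_not.1 h0
  obtain ⟨l, hl, hgard⟩ := exists_garding hV
  have hinj : Function.Injective A := by
    rw [injective_iff_map_eq_zero]
    intro u hu
    have h1 : SchrodingerGraph V u.fn 0 := ⟨u, rfl, fun v => by
      rw [← hAf, hu, inner_zero_left, inner_zero_left]⟩
    have h2 := hT2 _ _ h1
    rw [zero_smul, sub_zero, map_zero] at h2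
    exact H1.fn_injective h2.symm
  have hsurj : Function.Surjective A := by
    intro y
    -- Let K = `massOp`. First solve (A + lK)u₀ = y, which Gårding's inequality permits. Then the
    -- inverse of L, applied to the L² function u₀, gives U with AU = Ku₀, and A(u₀ + lU) = y.
    obtain ⟨R, -, -, hR, hRc⟩ := exists_inverse_sqrt (M := A + l • massOp) (c := 1 / 2)
      (fun u v => by
        simp only [add_apply, smul_apply, inner_add_left, inner_add_right, H1.inner_smul_l,
          H1.inner_smul_r, hA u v, symmOp_massOp u v]) (by norm_num)
      (fun u => by
        simp only [add_apply, smul_apply, inner_add_left, H1.inner_smul_l, hAf,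
          inner_massOp, real_inner_self_eq_norm_sq]
        exact hgard u)
    have hMR : (A + l • massOp) * (R * R) = 1 := by
      have := hRc _ (Commute.refl _)
      rw [← mul_assoc, this.eq, mul_assoc, this.eq, ← mul_assoc, hR]
    set u₀ := R (R y) with hu₀
    have h1 : A u₀ + l • massOp u₀ = y := by
      simpa using congrArg (fun T : H1 →L[ℝ] H1 => T y) hMR
    obtain ⟨U, hU, hU'⟩ := hT1 u₀.fn
    refine ⟨u₀ + l • U, ?_⟩
    have h2 : A U = massOp u₀ := by
      refine ext_inner_right ℝ fun v => ?_
      rw [hAf, hU', inner_massOp, zero_smul, add_zero]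
    rw [map_add, map_smul, h2, h1]
  set e := ContinuousLinearEquiv.ofBijective A (LinearMap.ker_eq_bot.2 hinj)
    (LinearMap.range_eq_top.2 hsurj) with he
  have he' : ∀ u, e u = A u := fun u => rfl
  refine ⟨(‖(e.symm : H1 →L[ℝ] H1)‖ + 1)⁻¹, by positivity, fun u => ?_⟩
  rw [inv_mul_le_iff₀ (by positivity)]
  calc ‖u‖ = ‖(e.symm : H1 →L[ℝ] H1) (A u)‖ := by rw [← he']; simp
    _ ≤ ‖(e.symm : H1 →L[ℝ] H1)‖ * ‖A u‖ := ContinuousLinearMap.le_opNorm _ _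
    _ ≤ _ := by gcongr; linarith

/-- The form of `L` takes positive values. -/
theorem exists_schrodingerForm_pos : ∃ u : H1, 0 < schrodingerForm V u u := by
  obtain ⟨l, hl, hgard⟩ := exists_garding hV
  obtain ⟨u, hu⟩ := H1.exists_der_large (2 * l)
  refine ⟨u, ?_⟩
  have h1 := hgard u
  rw [H1.norm_sq_eq] at h1
  nlinarith [sq_nonneg ‖u.fn‖]

/-- If the spectrum of `L` meets `(-∞, 0)`, then the form of `L` takes negative values. -/
theorem exists_schrodingerForm_neg (hneg : ∃ r ∈ schrodingerSpectrum V, r < 0) :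
    ∃ u : H1, schrodingerForm V u u < 0 := by
  obtain ⟨r, hr, hr0⟩ := hneg
  by_contra! hnn
  refine hr ?_
  obtain ⟨A, hA, hAf⟩ := exists_formOp hV
  obtain ⟨l, hl, hgard⟩ := exists_garding hV
  -- ε times Gårding's inequality, with ε ≤ 1 and εl ≤ −r, shows that the form of L − r is coercive
  -- on H¹ when the form of L is nonnegative.
  set ε := min 1 (-r / l) with hε
  have hε0 : 0 < ε := lt_min one_pos (div_pos (neg_pos.2 hr0) hl)
  have hε1 : ε ≤ 1 := min_le_left _ _
  have hεl : ε * l ≤ -r := by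
    have : ε ≤ -r / l := min_le_right _ _
    rwa [le_div_iff₀ hl] at this
  obtain ⟨R, -, -, hR, hRc⟩ := exists_inverse_sqrt (M := A + (-r) • massOp) (c := ε / 2)
    (fun u v => by
      simp only [add_apply, smul_apply, inner_add_left, inner_add_right, H1.inner_smul_l,
        H1.inner_smul_r, hA u v, symmOp_massOp u v]) (by positivity)
    (fun u => by
      simp only [add_apply, smul_apply, inner_add_left, H1.inner_smul_l, hAf,
        inner_massOp, real_inner_self_eq_norm_sq]
      have h1 := mul_le_mul_of_nonneg_left (hgard u) hε0.le
      have h2 := mul_le_mul_of_nonneg_right hεl (sq_nonneg ‖u.fn‖)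
      have h3 := mul_le_mul_of_nonneg_right hε1 (hnn u)
      linarith)
  have hMR : (A + (-r) • massOp) * (R * R) = 1 := by
    have := hRc _ (Commute.refl _)
    rw [← mul_assoc, this.eq, mul_assoc, this.eq, ← mul_assoc, hR]
  have hMRx : ∀ y, A (R (R y)) = y + r • massOp (R (R y)) := by
    intro y
    have h1 : A (R (R y)) + (-r) • massOp (R (R y)) = y := by
      simpa using congrArg (fun T : H1 →L[ℝ] H1 => T y) hMR
    nth_rewrite 2 [← h1]
    rw [neg_smul]
    abel
  have hRMx : ∀ y, R (R (A y + (-r) • massOp y)) = y := by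
    intro y
    simpa using congrArg (fun T : H1 →L[ℝ] H1 => T y) hR
  have hadj : ∀ (w : L2) (v : H1), inner ℝ (H1.fnL.adjoint w) v = inner ℝ w v.fn := fun w v =>
    ContinuousLinearMap.adjoint_inner_left _ _ _
  -- With ι the inclusion into L², the resolvent is ι (A − r ι*ι)⁻¹ ι*.
  refine ⟨H1.fnL ∘L (R ∘L R ∘L H1.fnL.adjoint), fun w => ?_, fun u w hG => ?_⟩
  · refine ⟨R (R (H1.fnL.adjoint w)), rfl, fun v => ?_⟩
    rw [← hAf, hMRx, inner_add_left, hadj, H1.inner_smul_l, inner_massOp, inner_add_left,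
      inner_smul_L2]
    rfl
  · obtain ⟨U, hU, hU'⟩ := hG
    have h1 : H1.fnL.adjoint (w - r • u) = A U + (-r) • massOp U := by
      refine ext_inner_right ℝ fun v => ?_
      rw [hadj, inner_add_left, hAf, hU', H1.inner_smul_l, inner_massOp, inner_sub_left,
        inner_smul_L2, hU]
      ring
    simp only [ContinuousLinearMap.comp_apply, h1, hRMx]
    exact hU

/-- The spectral splitting of `H¹(ℝ)`: the subspaces `E⁺` and `E⁻` are the eigenspaces of a bounded
involution that is symmetric for the form of `L` and for the inner product of `L²(ℝ)`. -/
theorem exists_spectral_involution (h0 : (0 : ℝ) ∉ schrodingerSpectrum V) {A : H1 →L[ℝ] H1}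
    (hA : SymmOp A) (hAf : ∀ u v, inner ℝ (A u) v = schrodingerForm V u v) :
    ∃ S : H1 →L[ℝ] H1, (∀ u, S (S u) = u) ∧
      (∀ u v, inner ℝ (A (S u)) v = inner ℝ (A u) (S v)) ∧
      (∀ u v, inner ℝ (S u).fn v.fn = inner ℝ u.fn (S v).fn) ∧
      (∃ d > 0, ∀ u, d * ‖u‖ ^ 2 ≤ inner ℝ (A (S u)) u) ∧
      ∀ σ : ℝ, σ = 1 ∨ σ = -1 → ∀ u, u ∈ signSubspace V σ ↔ S u = σ • u := by
  obtain ⟨α, hα, hbelow⟩ := exists_le_norm_formOp hV h0 hA hAf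
  obtain ⟨l, hl, hgard⟩ := exists_garding hV
  obtain ⟨S, hSS, hSA, hSK, ⟨d, hd, hSpos⟩, hScomm⟩ := exists_form_sign hA symmOp_massOp hα hbelow
    (c := 1 / 2) (by norm_num) hl.ne' (fun u => by
      rw [hAf, inner_massOp, real_inner_self_eq_norm_sq]
      exact hgard u)
  have hSSx : ∀ u, S (S u) = u := fun u => by
    simpa using congrArg (fun T : H1 →L[ℝ] H1 => T u) hSS
  have hSk : ∀ u v, inner ℝ (S u).fn v.fn = inner ℝ u.fn (S v).fn := by
    intro u v
    rw [← inner_massOp, hSK, inner_massOp]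
  refine ⟨S, hSSx, hSA, hSk, ⟨d, hd, hSpos⟩, fun σ hσ => ?_⟩
  have hσ2 : σ * σ = 1 := by rcases hσ with rfl | rfl <;> norm_num
  have hσ0 : σ ≠ 0 := by rintro rfl; simp at hσ2
  have hpos : ∀ τ : ℝ, τ * τ = 1 → ∀ u, S u = τ • u → d * ‖u‖ ^ 2 ≤ τ * schrodingerForm V u u := by
    intro τ _ u hu
    have h1 := hSpos u
    rwa [hu, map_smul, H1.inner_smul_l, hAf] at h1
  -- the projections onto the eigenspaces
  set p : ℝ → H1 → H1 := fun τ u => (1 / 2 : ℝ) • (u + τ • S u) with hp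
  have hpS : ∀ τ : ℝ, τ * τ = 1 → ∀ u, S (p τ u) = τ • p τ u := by
    intro τ hτ u
    simp only [hp, map_smul, map_add, hSSx, smul_add, smul_smul]
    rw [show τ * (1 / 2 * τ) = 1 / 2 by rw [mul_left_comm, hτ, mul_one], mul_comm τ, add_comm]
  have hpadd : ∀ u, p σ u + p (-σ) u = u := by
    intro u
    simp only [hp, ← smul_add]
    rw [neg_smul, add_add_add_comm, add_neg_cancel, add_zero, ← two_smul ℝ, smul_smul]
    norm_num
  have hort : ∀ u v, S u = σ • u → S v = (-σ) • v → inner ℝ u.fn v.fn = (0 : ℝ) ∧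
      schrodingerForm V u v = 0 := by
    intro u v hu hv
    have h1 := hSk u v
    have h2 := hSA u v
    rw [hu, hv] at h1
    rw [hu, hv, map_smul, H1.inner_smul_l, H1.inner_smul_r, hAf] at h2
    have h3 : inner ℝ (σ • u).fn v.fn = σ * inner ℝ u.fn v.fn := real_inner_smul_left _ _ _
    have h4 : inner ℝ u.fn ((-σ) • v).fn = -σ * inner ℝ u.fn v.fn := real_inner_smul_right _ _ _
    rw [h3, h4] at h1
    constructor
    · refine (mul_eq_zero.1 (show σ * inner ℝ u.fn v.fn = 0 by linarith)).resolve_left hσ0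
    · refine (mul_eq_zero.1 (show σ * schrodingerForm V u v = 0 by linarith)).resolve_left hσ0
  set Eσ : Submodule ℝ H1 := LinearMap.ker ((S - σ • (1 : H1 →L[ℝ] H1) : H1 →L[ℝ] H1) : H1 →ₗ[ℝ] H1)
    with hEσ
  have hmem : ∀ u, u ∈ Eσ ↔ S u = σ • u := by
    intro u
    simp [hEσ, LinearMap.mem_ker, sub_eq_zero]
  intro u
  rw [← hmem]
  suffices signSubspace V σ = Eσ by rw [this]
  have hsplitmem : ∀ v, v ∈ l2Orthogonal Eσ ↔ S v = (-σ) • v := by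
    intro v
    constructor
    · intro hv
      have h1 : inner ℝ (p σ v).fn v.fn = (0 : ℝ) := hv _ ((hmem _).2 (hpS σ hσ2 v))
      have h2 := (hort (p σ v) (p (-σ) v) (hpS σ hσ2 v)
        (hpS (-σ) (by linarith [hσ2, neg_mul_neg σ σ]) v)).1
      have h3 : v.fn = (p σ v).fn + (p (-σ) v).fn := by
        nth_rewrite 1 [← hpadd v]
        rfl
      rw [h3, inner_add_right, h2, add_zero, inner_self_eq_zero] at h1
      have h4 := H1.fn_injective h1
      have h5 := hpadd v
      rw [h4, zero_add] at h5
      rw [← h5]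
      exact hpS (-σ) (by linarith [hσ2, neg_mul_neg σ σ]) v
    · intro hv w hw
      exact (hort w v ((hmem w).1 hw) hv).1
  refine le_antisymm (sSup_le ?_) (le_sSup ⟨⟨?_, ?_⟩, ?_⟩)
  -- Maximality of the eigenspace: the projection onto a reducing subspace X is symmetric for both
  -- forms, hence commutes with S, so X is invariant under S.
  · rintro X ⟨⟨hX1, hX2⟩, hX3⟩
    have hcompl : IsCompl X (l2Orthogonal X) := by
      refine ⟨?_, codisjoint_iff.2 hX1⟩
      rw [Submodule.disjoint_def]
      intro x hx hx'
      exact H1.fn_injective (inner_self_eq_zero.1 (hx' x hx))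
    set P₀ := X.projection (l2Orthogonal X) hcompl with hP₀
    have hPmem : ∀ u, P₀ u ∈ X := fun u => Submodule.projection_apply_mem hcompl u
    have hPsub : ∀ u, u - P₀ u ∈ l2Orthogonal X := fun u => Submodule.sub_projection_mem hcompl u
    have hsymm : ∀ u v, schrodingerForm V u v = schrodingerForm V v u := fun u v => by
      rw [← hAf, hA, real_inner_comm, hAf]
    have hfsub : ∀ u v w, schrodingerForm V u (v - w) =
        schrodingerForm V u v - schrodingerForm V u w := fun u v w => by
      simp only [← hAf, inner_sub_right]
    have hksub : ∀ u v w : H1, inner ℝ u.fn (v - w).fn =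
        inner ℝ u.fn v.fn - (inner ℝ u.fn w.fn : ℝ) := fun u v w => inner_sub_right _ _ _
    have hPa : ∀ u v, schrodingerForm V (P₀ u) v = schrodingerForm V u (P₀ v) := by
      intro u v
      have h1 := hX2 _ (hPmem u) _ (hPsub v)
      have h2 := hX2 _ (hPmem v) _ (hPsub u)
      rw [hfsub] at h1 h2
      rw [hsymm u, sub_eq_zero.1 h1, sub_eq_zero.1 h2, hsymm]
    have hPk : ∀ u v, inner ℝ (P₀ u).fn v.fn = (inner ℝ u.fn (P₀ v).fn : ℝ) := by
      intro u v
      have h1 : inner ℝ (P₀ u).fn (v - P₀ v).fn = (0 : ℝ) := hPsub v _ (hPmem u)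
      have h2 : inner ℝ (P₀ v).fn (u - P₀ u).fn = (0 : ℝ) := hPsub u _ (hPmem v)
      rw [hksub] at h1 h2
      rw [real_inner_comm u.fn] at h2
      rw [sub_eq_zero.1 h1, ← real_inner_comm, sub_eq_zero.1 h2, ← real_inner_comm]
    have hPP : ∀ u, P₀ (P₀ u) = P₀ u := fun u =>
      Submodule.projection_apply_of_mem_left hcompl (hPmem u)
    -- The form plus l times the L² product is, by Gårding, an equivalent inner product, and X and
    -- its complement are orthogonal for it.
    have hPb : ∀ u, ‖P₀ u‖ ≤ Real.sqrt (2 * (‖A‖ + l)) * ‖u‖ := by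
      intro u
      have h1 := hgard (P₀ u)
      have h2 := hgard (u - P₀ u)
      have h3 : schrodingerForm V u u = schrodingerForm V (P₀ u) (P₀ u) +
          schrodingerForm V (u - P₀ u) (u - P₀ u) := by
        have h4 := hPa u u
        have h5 := hPa u (P₀ u)
        rw [hPP] at h5
        rw [hfsub, hsymm (u - P₀ u), hsymm (u - P₀ u), hfsub, hfsub, h5, hsymm (P₀ u) u]
        ring
      have h4 : ‖u.fn‖ ^ 2 = ‖(P₀ u).fn‖ ^ 2 + ‖(u - P₀ u).fn‖ ^ 2 := by
        have h6 : inner ℝ (P₀ u).fn (u - P₀ u).fn = (0 : ℝ) := hPsub u _ (hPmem u)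
        have h7 : u.fn = (P₀ u).fn + (u - P₀ u).fn := by
          have : u = P₀ u + (u - P₀ u) := by abel
          nth_rewrite 1 [this]
          rfl
        rw [h7, norm_add_sq_real, h6]
        ring
      have h5 : schrodingerForm V u u ≤ ‖A‖ * ‖u‖ ^ 2 := by
        rw [← hAf]
        refine (real_inner_le_norm _ _).trans ?_
        rw [pow_two, ← mul_assoc]
        gcongr
        exact A.le_opNorm u
      have h6 : ‖u.fn‖ ^ 2 ≤ ‖u‖ ^ 2 := by
        gcongr
        exact u.norm_fn_le
      have h7 : ‖P₀ u‖ ^ 2 ≤ 2 * (‖A‖ + l) * ‖u‖ ^ 2 := by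
        nlinarith [sq_nonneg ‖u - P₀ u‖]
      rw [← Real.sqrt_sq (norm_nonneg (P₀ u)), ← Real.sqrt_sq (norm_nonneg u),
        ← Real.sqrt_mul' _ (by positivity)]
      exact Real.sqrt_le_sqrt h7
    set P : H1 →L[ℝ] H1 := P₀.mkContinuous _ hPb with hP
    have hPe : ∀ u, P u = P₀ u := fun u => rfl
    have hcomm := hScomm P (fun u v => by rw [hAf, hAf, hPe, hPe, hPa])
      (fun u v => by rw [inner_massOp, inner_massOp, hPe, hPe, hPk])
    intro u hu
    rw [hmem]
    have hPu : P u = u := Submodule.projection_apply_of_mem_left hcompl hu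
    have hPS : P (S u) = S u := by
      have := congrArg (fun T : H1 →L[ℝ] H1 => T u) hcomm.eq
      simp only [mul_apply_eq_comp, Function.comp_apply] at this
      rw [this, hPu]
    have hSX : S u ∈ X := by rw [← hPS]; exact hPmem _
    -- The (−σ)-component of u lies in X, where σ(Lu, u) is positive definite, and in the eigenspace
    -- for −σ, where it is nonpositive; so it is 0.
    have hy : p (-σ) u ∈ X := X.smul_mem _ (X.add_mem hu (X.smul_mem _ hSX))
    have hτ : (-σ) * (-σ) = 1 := by linarith [neg_mul_neg σ σ]
    have hyS := hpS (-σ) hτ u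
    have hy0 : p (-σ) u = 0 := by
      by_contra hne
      have h1 := hX3 _ hy hne
      have h2 := hpos (-σ) hτ _ hyS
      have h3 : 0 ≤ d * ‖p (-σ) u‖ ^ 2 := by positivity
      linarith
    have h1 := hpadd u
    rw [hy0, add_zero] at h1
    rw [← h1]
    exact hpS σ hσ2 u
  · rw [eq_top_iff]
    intro u _
    rw [← hpadd u]
    refine Submodule.add_mem_sup ((hmem _).2 (hpS σ hσ2 u)) ((hsplitmem _).2 ?_)
    exact hpS (-σ) (by linarith [neg_mul_neg σ σ]) u
  · intro u hu v hv
    exact (hort u v ((hmem u).1 hu) ((hsplitmem v).1 hv)).2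
  · intro u hu hne
    refine lt_of_lt_of_le ?_ (hpos σ hσ2 u ((hmem u).1 hu))
    have := norm_pos_iff.2 hne
    positivity

end Potential

end GapSoliton

/-! ### Superposition operators -/

/-- A Carathéodory function may be composed with a measurable function. -/
theorem GapSoliton.Caratheodory.aestronglyMeasurable {g : ℝ → ℝ → ℝ} (hg : Caratheodory g)
    {u : ℝ → ℝ} (hu : AEStronglyMeasurable u (volume : Measure ℝ)) :
    AEStronglyMeasurable (fun x => g x (u x)) volume := by
  obtain ⟨u', hu', hae⟩ := hu
  refine AEStronglyMeasurable.congr (f := fun x => g x (u' x)) ?_ ?_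
  · refine aestronglyMeasurable_of_tendsto_ae (u := atTop) (f := fun n x => g x (hu'.approx n x))
      (fun n => ?_) ?_
    · set ψ := hu'.approx n with hψ
      have h1 : (fun x => g x (ψ x)) =
          fun x => ∑ y ∈ ψ.range, (ψ ⁻¹' {y}).indicator (fun x => g x y) x := by
        funext x
        rw [Finset.sum_eq_single (ψ x)]
        · simp
        · intro y _ hy
          exact indicator_of_notMem (fun h => hy (by simpa using h.symm)) _
        · intro h
          exact absurd (SimpleFunc.mem_range_self ψ x) h
      rw [h1]
      refine (Finset.aemeasurable_fun_sum _ fun y _ => ?_).aestronglyMeasurable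
      exact (hg.2 y).indicator (ψ.measurableSet_fiber y)
    · filter_upwards [hg.1] with x hx
      exact (hx.tendsto _).comp (hu'.tendsto_approx x)
  · filter_upwards [hae] with x hx
    rw [hx]

/-- First order Taylor estimate. -/
theorem abs_taylor_le {φ φ' : ℝ → ℝ} (hφ : ∀ s, HasDerivAt φ (φ' s) s) {K s t : ℝ}
    (hK : ∀ τ ∈ uIcc s t, |φ' τ - φ' s| ≤ K * |τ - s|) (hK0 : 0 ≤ K) :
    |φ t - φ s - φ' s * (t - s)| ≤ K * (t - s) ^ 2 := by
  have h1 := (convex_uIcc s t).norm_image_sub_le_of_norm_hasDerivWithin_le (C := K * |t - s|)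
    (f := fun τ => φ τ - φ' s * τ) (f' := fun τ => φ' τ - φ' s) (x := s) (y := t)
    (fun τ _ => by
      have := ((hφ τ).sub ((hasDerivAt_id τ).const_mul (φ' s))).hasDerivWithinAt (s := uIcc s t)
      simpa [Function.comp_def, Pi.sub_def] using this)
    (fun τ hτ => by
      refine (hK τ hτ).trans (mul_le_mul_of_nonneg_left ?_ hK0)
      exact abs_sub_left_of_mem_uIcc hτ) left_mem_uIcc right_mem_uIcc
  simp only [Real.norm_eq_abs] at h1
  rw [mul_assoc, abs_mul_abs_self] at h1
  calc |φ t - φ s - φ' s * (t - s)| = |φ t - φ' s * t - (φ s - φ' s * s)| := by congr 1; ring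
    _ ≤ _ := h1
    _ = _ := by ring

theorem integral_sub_sub {α : Type*} [MeasurableSpace α] {ν : Measure α} {a b c : α → ℝ}
    (ha : Integrable a ν) (hb : Integrable b ν) (hc : Integrable c ν) :
    ∫ x, (a x - b x - c x) ∂ν = ∫ x, a x ∂ν - ∫ x, b x ∂ν - ∫ x, c x ∂ν := by
  have h1 : Integrable (fun x => a x - b x) ν := ha.sub hb
  rw [integral_sub h1 hc, integral_sub ha hb]

/-- A map with a quadratic remainder is differentiable. -/
theorem hasFDerivAt_of_norm_sub_le {E F : Type*} [NormedAddCommGroup E] [NormedSpace ℝ E]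
    [NormedAddCommGroup F] [NormedSpace ℝ F] {g : E → F} {D : E →L[ℝ] F} {u : E} {C : ℝ}
    (h : ∀ v, ‖v‖ ≤ 1 → ‖g (u + v) - g u - D v‖ ≤ C * ‖v‖ ^ 2) : HasFDerivAt g D u := by
  rw [hasFDerivAt_iff_isLittleO_nhds_zero]
  have h1 : (fun v => g (u + v) - g u - D v) =O[𝓝 0] fun v : E => ‖v‖ ^ 2 := by
    refine Asymptotics.IsBigO.of_bound C ?_
    filter_upwards [Metric.closedBall_mem_nhds (0 : E) one_pos] with v hv
    rw [norm_pow, norm_norm]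
    exact h v (by simpa using hv)
  refine h1.trans_isLittleO ?_
  have h2 := Asymptotics.isLittleO_norm_pow_id (E' := E) one_lt_two
  exact h2

namespace GapSoliton

/-- The regularity of the nonlinearity that is used: it is Carathéodory and differentiable, with
derivative that vanishes at `0` and is Lipschitz on bounded sets. -/
structure RegularNonlinearity (f : ℝ → ℝ → ℝ) : Prop where
  smooth : ∀ᵐ x : ℝ, ContDiff ℝ 1 (f x)
  primitive_caratheodory : Caratheodory (primitive f)
  caratheodory : Caratheodory f
  deriv_caratheodory : Caratheodory fun x s => deriv (f x) s
  apply_zero : ∀ᵐ x : ℝ, f x 0 = 0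
  deriv_zero : ∀ᵐ x : ℝ, deriv (f x) 0 = 0
  lipschitz : ∀ R : ℝ, 0 < R → ∃ μ : ℝ, 0 < μ ∧ ∀ᵐ x : ℝ, ∀ s t : ℝ, |s| ≤ R → |t| ≤ R →
    |deriv (f x) s - deriv (f x) t| ≤ μ * |s - t|

theorem hasDerivAt_primitive {f : ℝ → ℝ → ℝ} {x : ℝ} (h : Continuous (f x)) (s : ℝ) :
    HasDerivAt (primitive f x) (f x s) s :=
  (h.integral_hasStrictDerivAt 0 s).hasDerivAt

theorem primitive_zero (f : ℝ → ℝ → ℝ) (x : ℝ) : primitive f x 0 = 0 :=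
  intervalIntegral.integral_same

namespace RegularNonlinearity

variable {f : ℝ → ℝ → ℝ} (hf : RegularNonlinearity f)
include hf

theorem exists_bounds (R : ℝ) (hR : 0 < R) : ∃ K : ℝ, 0 < K ∧ ∀ᵐ x : ℝ, ∀ s t : ℝ,
    |s| ≤ R → |t| ≤ R →
      |deriv (f x) s - deriv (f x) t| ≤ K * |s - t| ∧ |f x s - f x t| ≤ K * |s - t| ∧
      |f x t - f x s - deriv (f x) s * (t - s)| ≤ K * (t - s) ^ 2 ∧
      |primitive f x t - primitive f x s - f x s * (t - s)| ≤ K * (t - s) ^ 2 := by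
  obtain ⟨μ, hμ, hlip⟩ := hf.lipschitz R hR
  -- Since f_u(x, 0) = 0, |f_u| ≤ μR on [−R, R]; the factor 1 + R covers the Lipschitz constants of
  -- f_u and of f.
  refine ⟨μ * (1 + R), by positivity, ?_⟩
  filter_upwards [hlip, hf.smooth, hf.deriv_zero] with x hx hsm hd0 s t hs ht
  have hμ1 : μ ≤ μ * (1 + R) := by nlinarith
  have hder : ∀ s, HasDerivAt (f x) (deriv (f x) s) s := fun s =>
    (hsm.differentiable one_ne_zero s).hasDerivAt
  have hin : ∀ {s t τ : ℝ}, |s| ≤ R → |t| ≤ R → τ ∈ uIcc s t → |τ| ≤ R := by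
    intro s t τ hs ht hτ
    exact abs_le.2 ((uIcc_subset_Icc (abs_le.1 hs) (abs_le.1 ht)) hτ)
  have hlipf : ∀ s t, |s| ≤ R → |t| ≤ R → |f x s - f x t| ≤ μ * (1 + R) * |s - t| := by
    intro s t hs ht
    refine (convex_uIcc s t).norm_image_sub_le_of_norm_hasDerivWithin_le
      (f' := fun τ => deriv (f x) τ)
      (fun τ _ => (hder τ).hasDerivWithinAt) (fun τ hτ => ?_) right_mem_uIcc left_mem_uIcc
    have h1 := hin hs ht hτ
    have h2 := hx τ 0 h1 (by simpa using hR.le)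
    rw [hd0, sub_zero, sub_zero] at h2
    refine h2.trans (mul_le_mul_of_nonneg_left (by linarith) hμ.le)
  refine ⟨(hx s t hs ht).trans (by gcongr), hlipf s t hs ht,
    abs_taylor_le hder (fun τ hτ => ?_) (by positivity),
    abs_taylor_le (fun s => hasDerivAt_primitive hsm.continuous s) (fun τ hτ => ?_) (by positivity)⟩
  · exact (hx τ s (hin hs ht hτ) hs).trans (by gcongr)
  · exact hlipf τ s (hin hs ht hτ) hs

/-- The nonlinearity and its primitive and derivative are small near `0`. -/
theorem exists_growth (R : ℝ) (hR : 0 < R) : ∃ K : ℝ, 0 < K ∧ ∀ᵐ x : ℝ, ∀ s : ℝ, |s| ≤ R →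
    |deriv (f x) s| ≤ K * |s| ∧ |f x s| ≤ K * |s| ∧ |f x s| ≤ K * s ^ 2 ∧
      |primitive f x s| ≤ K * s ^ 2 := by
  obtain ⟨K, hK, h⟩ := hf.exists_bounds R hR
  refine ⟨K, hK, ?_⟩
  filter_upwards [h, hf.apply_zero, hf.deriv_zero] with x hx h0 h1 s hs
  have hR0 : |(0 : ℝ)| ≤ R := by simpa using hR.le
  have h2 := hx s 0 hs hR0
  have h3 := hx 0 s hR0 hs
  simp only [h0, h1, primitive_zero, sub_zero, zero_mul] at h2 h3
  exact ⟨h2.1, h2.2.1, h3.2.2.1, h3.2.2.2⟩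

end RegularNonlinearity

/-! ### Integrals against elements of `H¹(ℝ)` -/

section Weight

variable {p : ℝ → ℝ} (hp : AEStronglyMeasurable p (volume : Measure ℝ)) {C : ℝ} (w : H1)
  (hb : ∀ᵐ x, |p x| ≤ C * |w.fn x|)
include hp hb

theorem memLp_of_abs_le : MemLp p 2 (volume : Measure ℝ) :=
  (Lp.memLp w.fn).of_le_mul (c := C) hp (by simpa using hb)

theorem integrable_mul_of_abs_le (v : H1) : Integrable fun x => p x * v.fn x :=
  (memLp_of_abs_le hp w hb).integrable_mul (Lp.memLp v.fn)

theorem abs_integral_mul_le (hC : 0 ≤ C) (v : H1) : |∫ x, p x * v.fn x| ≤ C * (‖w‖ * ‖v‖) := by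
  have h1 : ∫ x, p x * v.fn x = inner ℝ ((memLp_of_abs_le hp w hb).toLp p) v.fn := by
    rw [← integral_eq_inner]
    simp only [mul_comm]
  have h2 : ‖(memLp_of_abs_le hp w hb).toLp p‖ ≤ C * ‖w.fn‖ := by
    refine Lp.norm_le_mul_norm_of_ae_le_mul ?_
    filter_upwards [hb, (memLp_of_abs_le hp w hb).coeFn_toLp] with x hx hx'
    rw [hx']
    simpa using hx
  rw [h1]
  calc _ ≤ ‖(memLp_of_abs_le hp w hb).toLp p‖ * ‖v.fn‖ := abs_real_inner_le_norm _ _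
    _ ≤ (C * ‖w‖) * ‖v‖ := by
      gcongr
      · exact h2.trans (mul_le_mul_of_nonneg_left w.norm_fn_le hC)
      · exact v.norm_fn_le
    _ = _ := by ring

theorem exists_riesz : ∃ y : H1, ∀ v : H1, inner ℝ y v = ∫ x, p x * v.fn x := by
  refine ⟨H1.fnL.adjoint ((memLp_of_abs_le hp w hb).toLp p), fun v => ?_⟩
  rw [ContinuousLinearMap.adjoint_inner_left]
  have := integral_eq_inner (memLp_of_abs_le hp w hb) v.fn
  rw [H1.fnL_apply, ← this]
  simp only [mul_comm]

end Weight

theorem integrable_coeff_mul {m : ℝ → ℝ} (hm : AEStronglyMeasurable m (volume : Measure ℝ)) {C : ℝ}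
    (hb : ∀ᵐ x, |m x| ≤ C) (v w : H1) : Integrable fun x => m x * v.fn x * w.fn x := by
  refine integrable_mul_of_abs_le (C := C) (hm.mul (Lp.memLp v.fn).1) v ?_ w
  filter_upwards [hb] with x hx
  rw [Pi.mul_apply, abs_mul]
  exact mul_le_mul_of_nonneg_right hx (abs_nonneg _)

theorem abs_integral_coeff_mul_le {m : ℝ → ℝ} (hm : AEStronglyMeasurable m (volume : Measure ℝ))
    {C : ℝ} (hC : 0 ≤ C) (hb : ∀ᵐ x, |m x| ≤ C) (v w : H1) :
    |∫ x, m x * v.fn x * w.fn x| ≤ C * (‖v‖ * ‖w‖) := by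
  refine abs_integral_mul_le (hm.mul (Lp.memLp v.fn).1) v ?_ hC w
  filter_upwards [hb] with x hx
  rw [Pi.mul_apply, abs_mul]
  exact mul_le_mul_of_nonneg_right hx (abs_nonneg _)

/-- A bounded coefficient is represented by a symmetric operator in `H¹(ℝ)`. -/
theorem exists_mulOp {m : ℝ → ℝ} (hm : AEStronglyMeasurable m (volume : Measure ℝ)) {C : ℝ}
    (hC : 0 ≤ C) (hb : ∀ᵐ x, |m x| ≤ C) :
    ∃ A : H1 →L[ℝ] H1, SymmOp A ∧ (∀ v w : H1, inner ℝ (A v) w = ∫ x, m x * v.fn x * w.fn x) := by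
  obtain ⟨A, h1, h2, -⟩ := exists_operator_of_form (H := H1)
    (fun v w => ∫ x, m x * v.fn x * w.fn x)
    (fun v w => by simp only [mul_assoc, mul_comm (v.fn _)])
    (fun v v' w => by
      rw [← integral_add (integrable_coeff_mul hm hb v w) (integrable_coeff_mul hm hb v' w)]
      refine integral_congr_ae ?_
      filter_upwards [Lp.coeFn_add v.fn v'.fn] with x hx
      have h3 : (v + v').fn x = v.fn x + v'.fn x := hx
      rw [h3]
      ring)
    (fun c v w => by
      rw [← integral_const_mul]
      refine integral_congr_ae ?_
      filter_upwards [Lp.coeFn_smul c v.fn] with x hx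
      have h3 : (c • v).fn x = c * v.fn x := hx
      rw [h3]
      ring) hC
    (fun v w => by
      refine (abs_integral_coeff_mul_le hm hC hb v w).trans (mul_le_mul_of_nonneg_left ?_ hC)
      nlinarith [sq_nonneg (‖v‖ - ‖w‖), sq_nonneg ‖v‖, sq_nonneg ‖w‖])
  exact ⟨A, h1, h2⟩

theorem norm_le_of_inner_le {H : Type*} [NormedAddCommGroup H] [InnerProductSpace ℝ H] {y : H}
    {C : ℝ} (hC : 0 ≤ C) (h : ∀ v, |inner ℝ y v| ≤ C * ‖v‖) : ‖y‖ ≤ C := by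
  have h1 := (le_abs_self _).trans (h y)
  rw [real_inner_self_eq_norm_mul_norm] at h1
  rcases (norm_nonneg y).eq_or_lt with h0 | h0
  · rwa [← h0]
  · exact le_of_mul_le_mul_right h1 h0

theorem opNorm_le_of_inner_le {H : Type*} [NormedAddCommGroup H] [InnerProductSpace ℝ H]
    {A : H →L[ℝ] H} {C : ℝ} (hC : 0 ≤ C) (h : ∀ u v, |inner ℝ (A u) v| ≤ C * (‖u‖ * ‖v‖)) :
    ‖A‖ ≤ C :=
  A.opNorm_le_bound hC fun u => norm_le_of_inner_le (by positivity) fun v => by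
    rw [mul_assoc]
    exact h u v

theorem H1.ae_abs_le_of_norm_le {u : H1} {R : ℝ} (h : ‖u‖ ≤ R) : ∀ᵐ x, |u.fn x| ≤ 2 * R := by
  filter_upwards [u.ae_abs_le] with x hx
  linarith

namespace RegularNonlinearity

variable {f : ℝ → ℝ → ℝ} (hf : RegularNonlinearity f)
include hf

theorem aestronglyMeasurable (u : L2) : AEStronglyMeasurable (fun x => f x (u x)) volume :=
  hf.caratheodory.aestronglyMeasurable (Lp.memLp u).1

theorem integrable_apply_mul (u v : H1) : Integrable fun x => f x (u.fn x) * v.fn x := by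
  -- By the Sobolev embedding the values of u lie in |s| ≤ 2‖u‖; the 1 keeps the radius positive for
  -- u = 0.
  obtain ⟨K, hK, h⟩ := hf.exists_growth (2 * ‖u‖ + 1) (by positivity)
  refine integrable_mul_of_abs_le (C := K) (hf.aestronglyMeasurable u.fn) u ?_ v
  filter_upwards [h, u.ae_abs_le] with x hx hx'
  exact (hx _ (by linarith)).2.1

theorem integrable_deriv_mul (u v w : H1) :
    Integrable fun x => deriv (f x) (u.fn x) * v.fn x * w.fn x := by
  obtain ⟨K, hK, h⟩ := hf.exists_growth (2 * ‖u‖ + 1) (by positivity)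
  refine integrable_coeff_mul (C := K * (2 * ‖u‖ + 1))
    (hf.deriv_caratheodory.aestronglyMeasurable (Lp.memLp u.fn).1) ?_ v w
  filter_upwards [h, u.ae_abs_le] with x hx hx'
  exact (hx _ (by linarith)).1.trans (mul_le_mul_of_nonneg_left (by linarith) hK.le)

theorem integrable_primitive (u : H1) : Integrable fun x => primitive f x (u.fn x) := by
  obtain ⟨K, hK, h⟩ := hf.exists_growth (2 * ‖u‖ + 1) (by positivity)
  refine ((H1.integrable_sq_L2 u.fn).const_mul K).mono'
    (hf.primitive_caratheodory.aestronglyMeasurable (Lp.memLp u.fn).1) ?_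
  filter_upwards [h, u.ae_abs_le] with x hx hx'
  exact (hx _ (by linarith)).2.2.2

/-- The functional `∫ F(x, u)` is twice differentiable on `H¹(ℝ)`, and its gradient and its Hessian
are Lipschitz on bounded sets. -/
theorem exists_gradient_hessian : ∃ (G : H1 → H1) (D : H1 → H1 →L[ℝ] H1),
    (∀ u v : H1, inner ℝ (G u) v = ∫ x, f x (u.fn x) * v.fn x) ∧
    (∀ u v w : H1, inner ℝ (D u v) w = ∫ x, deriv (f x) (u.fn x) * v.fn x * w.fn x) ∧
    (∀ u, HasGradientAt (fun u : H1 => ∫ x, primitive f x (u.fn x)) (G u) u) ∧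
    (∀ u, HasFDerivAt G (D u) u) ∧
    (∀ R, LipBdd G (Metric.closedBall 0 R)) ∧ ∀ R, LipBdd D (Metric.closedBall 0 R) := by
  have hG : ∀ u : H1, ∃ y : H1, ∀ v : H1, inner ℝ y v = ∫ x, f x (u.fn x) * v.fn x := by
    intro u
    obtain ⟨K, hK, h⟩ := hf.exists_growth (2 * ‖u‖ + 1) (by positivity)
    refine exists_riesz (C := K) (hf.aestronglyMeasurable u.fn) u ?_
    filter_upwards [h, u.ae_abs_le] with x hx hx'
    exact (hx _ (by linarith)).2.1
  have hD : ∀ u : H1, ∃ A : H1 →L[ℝ] H1, SymmOp A ∧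
      ∀ v w : H1, inner ℝ (A v) w = ∫ x, deriv (f x) (u.fn x) * v.fn x * w.fn x := by
    intro u
    obtain ⟨K, hK, h⟩ := hf.exists_growth (2 * ‖u‖ + 1) (by positivity)
    refine exists_mulOp (C := K * (2 * ‖u‖ + 1))
      (hf.deriv_caratheodory.aestronglyMeasurable (Lp.memLp u.fn).1) (by positivity) ?_
    filter_upwards [h, u.ae_abs_le] with x hx hx'
    exact (hx _ (by linarith)).1.trans (mul_le_mul_of_nonneg_left (by linarith) hK.le)
  choose G hG using hG
  choose D hDs hD using hD
  have hsubfn : ∀ u v : H1, ∀ᵐ x, (u - v).fn x = u.fn x - v.fn x := fun u v => by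
    filter_upwards [Lp.coeFn_sub u.fn v.fn] with x hx
    exact hx
  have haddfn : ∀ u v : H1, ∀ᵐ x, (u + v).fn x = u.fn x + v.fn x := fun u v => by
    filter_upwards [Lp.coeFn_add u.fn v.fn] with x hx
    exact hx
  have hmf : ∀ u : H1, AEStronglyMeasurable (fun x => f x (u.fn x)) volume := fun u =>
    hf.aestronglyMeasurable u.fn
  have hmd : ∀ u : H1, AEStronglyMeasurable (fun x => deriv (f x) (u.fn x)) volume := fun u =>
    hf.deriv_caratheodory.aestronglyMeasurable (Lp.memLp u.fn).1
  have hGdiff : ∀ R, 0 ≤ R → ∃ K, 0 ≤ K ∧ ∀ u v : H1, ‖u‖ ≤ R → ‖v‖ ≤ R →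
      ‖G u - G v‖ ≤ K * ‖u - v‖ := by
    intro R hR
    obtain ⟨K, hK, h⟩ := hf.exists_bounds (2 * R + 1) (by positivity)
    refine ⟨K, hK.le, fun u v hu hv => norm_le_of_inner_le (by positivity) fun w => ?_⟩
    rw [inner_sub_left, hG, hG, ← integral_sub (hf.integrable_apply_mul u w)
      (hf.integrable_apply_mul v w)]
    simp only [← sub_mul]
    rw [mul_assoc]
    refine abs_integral_mul_le (p := fun x => f x (u.fn x) - f x (v.fn x)) ((hmf u).sub (hmf v))
      (u - v) ?_ hK.le w
    filter_upwards [h, H1.ae_abs_le_of_norm_le hu, H1.ae_abs_le_of_norm_le hv, hsubfn u v]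
      with x hx hxu hxv hs
    rw [hs]
    exact (hx _ _ (by linarith) (by linarith)).2.1
  have hDdiff : ∀ R, 0 ≤ R → ∃ K, 0 ≤ K ∧ ∀ u v : H1, ‖u‖ ≤ R → ‖v‖ ≤ R →
      ‖D u - D v‖ ≤ K * ‖u - v‖ := by
    intro R hR
    obtain ⟨K, hK, h⟩ := hf.exists_bounds (2 * R + 1) (by positivity)
    -- The factor 2 is the Sobolev constant, since the difference of the coefficients is estimated
    -- in the sup norm.
    refine ⟨2 * K, by positivity, fun u v hu hv =>
      opNorm_le_of_inner_le (by positivity) fun w z => ?_⟩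
    rw [sub_apply, inner_sub_left, hD, hD, ← integral_sub (hf.integrable_deriv_mul u w z)
      (hf.integrable_deriv_mul v w z)]
    simp only [← sub_mul]
    refine abs_integral_coeff_mul_le (m := fun x => deriv (f x) (u.fn x) - deriv (f x) (v.fn x))
      ((hmd u).sub (hmd v)) (by positivity) ?_ w z
    filter_upwards [h, H1.ae_abs_le_of_norm_le hu, H1.ae_abs_le_of_norm_le hv, hsubfn u v,
      (u - v).ae_abs_le] with x hx hxu hxv hs hle
    rw [hs] at hle
    refine (hx _ _ (by linarith) (by linarith)).1.trans ?_
    nlinarith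
  have hlip : ∀ {X : Type} [NormedAddCommGroup X] (T : H1 → X), (∀ R, 0 ≤ R → ∃ K, 0 ≤ K ∧
      ∀ u v : H1, ‖u‖ ≤ R → ‖v‖ ≤ R → ‖T u - T v‖ ≤ K * ‖u - v‖) →
      ∀ R, LipBdd T (Metric.closedBall 0 R) := by
    intro X _ T hT R
    obtain ⟨K, hK, h⟩ := hT |R| (abs_nonneg R)
    have hb : ∀ u ∈ Metric.closedBall (0 : H1) R, ‖u‖ ≤ |R| := fun u hu =>
      (mem_closedBall_zero_iff.1 hu).trans (le_abs_self R)
    refine ⟨‖T 0‖ + K * |R|, K, by positivity, hK, fun u hu => ?_, fun u hu v hv =>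
      h u v (hb u hu) (hb v hv)⟩
    have h1 := h u 0 (hb u hu) (by simp)
    rw [sub_zero] at h1
    calc ‖T u‖ = ‖T 0 + (T u - T 0)‖ := by congr 1; abel
      _ ≤ ‖T 0‖ + ‖T u - T 0‖ := norm_add_le _ _
      _ ≤ ‖T 0‖ + K * |R| := by
        gcongr
        exact h1.trans (mul_le_mul_of_nonneg_left (hb u hu) hK)
  refine ⟨G, D, hG, hD, fun u => ?_, fun u => ?_, hlip G hGdiff, hlip D hDdiff⟩
  · rw [hasGradientAt_iff_hasFDerivAt]
    obtain ⟨K, hK, h⟩ := hf.exists_bounds (2 * (‖u‖ + 1)) (by positivity)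
    refine hasFDerivAt_of_norm_sub_le (C := K) fun v hv => ?_
    have huv : ‖u + v‖ ≤ ‖u‖ + 1 := (norm_add_le _ _).trans (by linarith)
    rw [InnerProductSpace.toDual_apply_apply, hG, ← integral_sub_sub (hf.integrable_primitive _)
      (hf.integrable_primitive _) (hf.integrable_apply_mul u v)]
    calc _ ≤ ∫ x, K * v.fn x ^ 2 := by
          refine norm_integral_le_of_norm_le ((H1.integrable_sq_L2 v.fn).const_mul K) ?_
          filter_upwards [h, H1.ae_abs_le_of_norm_le huv,
            H1.ae_abs_le_of_norm_le (show ‖u‖ ≤ ‖u‖ + 1 by linarith), haddfn u v] with x hx h1 h2 h3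
          have h4 := (hx _ _ h2 h1).2.2.2
          rw [h3, add_sub_cancel_left] at h4
          rw [h3]
          exact h4
      _ = K * ‖v.fn‖ ^ 2 := by rw [integral_const_mul, H1.norm_sq_L2]
      _ ≤ _ := by
        gcongr
        exact v.norm_fn_le
  · obtain ⟨K, hK, h⟩ := hf.exists_bounds (2 * (‖u‖ + 1)) (by positivity)
    refine hasFDerivAt_of_norm_sub_le (C := 2 * K) fun v hv => ?_
    have huv : ‖u + v‖ ≤ ‖u‖ + 1 := (norm_add_le _ _).trans (by linarith)
    refine norm_le_of_inner_le (by positivity) fun w => ?_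
    rw [inner_sub_left, inner_sub_left, hG, hG, hD, ← integral_sub_sub (hf.integrable_apply_mul _ _)
      (hf.integrable_apply_mul _ _) (hf.integrable_deriv_mul u v w)]
    simp only [← sub_mul]
    -- The pointwise remainder Kv² becomes 2K‖v‖ |v|: one factor in the sup norm, the other in L².
    refine (abs_integral_mul_le (p := fun x => f x ((u + v).fn x) - f x (u.fn x) -
      deriv (f x) (u.fn x) * v.fn x) (C := 2 * K * ‖v‖) (((hmf _).sub (hmf _)).sub
      ((hmd u).mul (Lp.memLp v.fn).1)) v ?_ (by positivity) w).trans (le_of_eq (by ring))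
    filter_upwards [h, H1.ae_abs_le_of_norm_le huv, v.ae_abs_le,
      H1.ae_abs_le_of_norm_le (show ‖u‖ ≤ ‖u‖ + 1 by linarith), haddfn u v] with x hx h1 hv' h2 h3
    have h4 := (hx _ _ h2 h1).2.2.1
    rw [h3, add_sub_cancel_left] at h4
    rw [h3]
    refine h4.trans ?_
    rw [← sq_abs, pow_two, mul_comm 2 K, mul_assoc, mul_assoc, ← mul_assoc 2]
    gcongr

end RegularNonlinearity

end GapSoliton

/-! ### Superlinear functions of one variable -/

/-- A differentiable function with `h'(s) s ≥ 0` is minimal at `0`. -/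
theorem apply_zero_le_of_deriv_mul_nonneg {h h' : ℝ → ℝ} (hd : ∀ s, HasDerivAt h (h' s) s)
    (hs : ∀ s, 0 ≤ h' s * s) (s : ℝ) : h 0 ≤ h s := by
  have hc : Continuous h := continuous_iff_continuousAt.2 fun s => (hd s).continuousAt
  rcases le_total 0 s with h0 | h0
  · refine monotoneOn_of_deriv_nonneg (convex_Ici 0) hc.continuousOn
      (fun x _ => (hd x).differentiableAt.differentiableWithinAt) (fun x hx => ?_)
      (self_mem_Ici (a := (0 : ℝ))) h0 h0
    rw [interior_Ici, mem_Ioi] at hx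
    rw [(hd x).deriv]
    exact nonneg_of_mul_nonneg_left (hs x) hx
  · refine antitoneOn_of_deriv_nonpos (convex_Iic 0) hc.continuousOn
      (fun x _ => (hd x).differentiableAt.differentiableWithinAt) (fun x hx => ?_)
      h0 (self_mem_Iic (a := (0 : ℝ))) h0
    rw [interior_Iic, mem_Iio] at hx
    rw [(hd x).deriv]
    nlinarith [hs x]

/-- If `Φ'(s) s ≥ ν Φ(s)` for `s > 0`, then `Φ(s) s ^ (-ν)` is increasing. -/
theorem rpow_mul_le_of_deriv_mul_ge {Φ φ : ℝ → ℝ} {ν δ : ℝ} (hd : ∀ s, HasDerivAt Φ (φ s) s)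
    (hs : ∀ s, 0 < s → ν * Φ s ≤ φ s * s) (h1 : δ ≤ Φ 1) {s : ℝ} (h1s : 1 ≤ s) :
    δ * s ^ ν ≤ Φ s := by
  have hder : ∀ x : ℝ, 0 < x → HasDerivAt (fun x => Φ x * x ^ (-ν))
      (φ x * x ^ (-ν) + Φ x * (-ν * x ^ (-ν - 1))) x := fun x hx =>
    (hd x).mul (Real.hasDerivAt_rpow_const (Or.inl hx.ne'))
  have hpos : ∀ x : ℝ, x ∈ Ici (1 : ℝ) → 0 < x := fun x hx => one_pos.trans_le hx
  have h2 : (fun x => Φ x * x ^ (-ν)) 1 ≤ (fun x => Φ x * x ^ (-ν)) s := by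
    refine monotoneOn_of_deriv_nonneg (convex_Ici 1)
      (fun x hx => (hder x (hpos x hx)).continuousAt.continuousWithinAt)
      (fun x hx => (hder x (hpos x (interior_subset hx))).differentiableAt.differentiableWithinAt)
      (fun x hx => ?_) self_mem_Ici h1s h1s
    have hx0 := hpos x (interior_subset hx)
    rw [(hder x hx0).deriv]
    have h3 : x ^ (-ν) = x ^ (-ν - 1) * x := by
      rw [← Real.rpow_add_one hx0.ne', sub_add_cancel]
    have h4 : φ x * x ^ (-ν) + Φ x * (-ν * x ^ (-ν - 1)) =
        x ^ (-ν - 1) * (φ x * x - ν * Φ x) := by rw [h3]; ring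
    rw [h4]
    exact mul_nonneg (Real.rpow_nonneg hx0.le _) (sub_nonneg.2 (hs x hx0))
  simp only [Real.one_rpow, mul_one] at h2
  have hs0 : 0 < s := hpos s h1s
  have h3 : Φ s = Φ s * s ^ (-ν) * s ^ ν := by
    rw [mul_assoc, ← Real.rpow_add hs0, neg_add_cancel, Real.rpow_zero, mul_one]
  rw [h3]
  exact mul_le_mul_of_nonneg_right (h1.trans h2) (Real.rpow_nonneg hs0.le _)

namespace GapSoliton

/-- The superlinearity condition on the nonlinearity. -/
structure SuperlinearNonlinearity (f : ℝ → ℝ → ℝ) (θ : ℝ) : Prop extends RegularNonlinearity f where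
  pos : 0 < θ
  lt_one : θ < 1
  superlinear : ∀ᵐ x : ℝ, ∀ s : ℝ, s ≠ 0 →
    0 < f x s * s ∧ f x s * s ≤ θ * (deriv (f x) s * s ^ 2)

namespace SuperlinearNonlinearity

variable {f : ℝ → ℝ → ℝ} {θ : ℝ} (hf : SuperlinearNonlinearity f θ)
include hf

/-- The last inequality is the Ambrosetti–Rabinowitz condition. It holds because θ f(s)s − (1 +
θ)F(s) vanishes at 0 and its derivative θ f_u(s)s − f(s), multiplied by s, is nonnegative. -/
theorem ae_bounds : ∀ᵐ x : ℝ, ∀ s : ℝ, 0 ≤ f x s * s ∧ f x s * s ≤ θ * (deriv (f x) s * s ^ 2) ∧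
    0 ≤ deriv (f x) s ∧ 0 ≤ primitive f x s ∧ (1 + θ) * primitive f x s ≤ θ * (f x s * s) := by
  filter_upwards [hf.superlinear, hf.smooth, hf.apply_zero, hf.deriv_zero] with x hx hsm h0 hd0
  have hder : ∀ s, HasDerivAt (f x) (deriv (f x) s) s := fun s =>
    (hsm.differentiable one_ne_zero s).hasDerivAt
  have h1 : ∀ s, 0 ≤ f x s * s ∧ f x s * s ≤ θ * (deriv (f x) s * s ^ 2) := by
    intro s
    rcases eq_or_ne s 0 with rfl | hs
    · simp
    · exact ⟨(hx s hs).1.le, (hx s hs).2⟩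
  intro s
  refine ⟨(h1 s).1, (h1 s).2, ?_, ?_, ?_⟩
  · rcases eq_or_ne s 0 with rfl | hs
    · rw [hd0]
    · have h2 := (hx s hs).1.trans_le (hx s hs).2
      have h3 := (mul_pos_iff_of_pos_left hf.pos).1 h2
      exact ((mul_pos_iff_of_pos_right (by positivity)).1 h3).le
  · have := apply_zero_le_of_deriv_mul_nonneg (hasDerivAt_primitive (f := f) hsm.continuous)
      (fun s => (h1 s).1) s
    rwa [primitive_zero] at this
  · have := apply_zero_le_of_deriv_mul_nonneg
      (h := fun s => θ * (f x s * s) - (1 + θ) * primitive f x s)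
      (h' := fun s => θ * (deriv (f x) s * s + f x s) - (1 + θ) * f x s) (fun s => by
        have := (((hder s).mul (hasDerivAt_id s)).const_mul θ).sub
          ((hasDerivAt_primitive (f := f) hsm.continuous s).const_mul (1 + θ))
        simpa [Pi.sub_def, Pi.mul_def] using this)
      (fun s => by
        have := (h1 s).2
        nlinarith) s
    simp only [primitive_zero, mul_zero, sub_zero] at this
    linarith

/-- The primitive grows faster than any quadratic function. -/
theorem exists_quadratic_le
    (hF : ∀ s : ℝ, s ≠ 0 → ∃ δ : ℝ, 0 < δ ∧ ∀ᵐ x : ℝ, δ ≤ primitive f x s) (Λ : ℝ) (hΛ : 0 < Λ) :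
    ∃ C : ℝ, 0 ≤ C ∧ ∀ᵐ x : ℝ, ∀ s, Λ * s ^ 2 - C ≤ primitive f x s := by
  obtain ⟨δ₁, hδ₁, h1⟩ := hF 1 one_ne_zero
  obtain ⟨δ₂, hδ₂, h2⟩ := hF (-1) (by norm_num)
  set δ := min δ₁ δ₂
  have hδ : 0 < δ := lt_min hδ₁ hδ₂
  -- The Ambrosetti–Rabinowitz exponent exceeds 2 because θ < 1, so F(s) ≥ δ|s|^ν beats Λs² for |s|
  -- ≥ S'. For smaller |s| the constant C = ΛS'² suffices, as F ≥ 0.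
  set ν := (1 + θ) / θ with hν
  have hθ := hf.pos
  have hν2 : 0 < ν - 2 := by
    rw [hν, sub_pos, lt_div_iff₀ hθ]
    linarith [hf.lt_one]
  obtain ⟨S, hS⟩ := eventually_atTop.1 ((tendsto_rpow_atTop hν2).eventually_ge_atTop (Λ / δ))
  set S' := max S 1
  refine ⟨Λ * S' ^ 2, by positivity, ?_⟩
  filter_upwards [hf.ae_bounds, hf.smooth, h1, h2] with x hx hsm hx1 hx2 s
  have hFd := hasDerivAt_primitive (f := f) hsm.continuous
  have hAR : ∀ s, ν * primitive f x s ≤ f x s * s := fun s => by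
    rw [hν, div_mul_eq_mul_div, div_le_iff₀ hθ, mul_comm _ θ]
    exact (hx s).2.2.2.2
  have hgrow : ∀ {Φ φ : ℝ → ℝ}, (∀ s, HasDerivAt Φ (φ s) s) →
      (∀ s, 0 < s → ν * Φ s ≤ φ s * s) → δ ≤ Φ 1 → ∀ s, S' ≤ s → Λ * s ^ 2 ≤ Φ s := by
    intro Φ φ h1 h2 h3 s hs
    have hs1 : 1 ≤ s := (le_max_right _ _).trans hs
    have hs0 : 0 < s := one_pos.trans_le hs1
    refine le_trans ?_ (rpow_mul_le_of_deriv_mul_ge h1 h2 h3 hs1)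
    have h4 := hS s ((le_max_left _ _).trans hs)
    rw [div_le_iff₀ hδ] at h4
    have h5 : s ^ ν = s ^ (ν - 2) * s ^ 2 := by
      rw [← Real.rpow_natCast s 2, ← Real.rpow_add hs0]
      congr 1
      push_cast
      ring
    rw [h5]
    nlinarith [sq_nonneg s]
  rcases le_total |s| S' with h | h
  · have h3 : s ^ 2 ≤ S' ^ 2 := by
      rw [← sq_abs]
      gcongr
    nlinarith [(hx s).2.2.2.1]
  · rcases le_total 0 s with h0 | h0
    · rw [abs_of_nonneg h0] at h
      have := hgrow hFd (fun s _ => hAR s) ((min_le_left _ _).trans hx1) s h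
      nlinarith [sq_nonneg S']
    · rw [abs_of_nonpos h0] at h
      have := hgrow (Φ := fun s => primitive f x (-s)) (φ := fun s => - f x (-s)) (fun s => by
          have := (hFd (-s)).comp s (hasDerivAt_neg s)
          simpa [Function.comp_def] using this) (fun s _ => by
          have := hAR (-s)
          linarith) ((min_le_right _ _).trans hx2) (-s) h
      simp only [neg_neg, neg_sq] at this
      nlinarith [sq_nonneg S']

end SuperlinearNonlinearity

/-- A symmetric operator that is positive on the `1`-eigenspace and negative on the
`(-1)`-eigenspace of an involution, the two eigenspaces being orthogonal both for the form of the
operator and in `L²(ℝ)`. -/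
structure SplitForm (B T : H1 →L[ℝ] H1) (d : ℝ) : Prop where
  symm : SymmOp B
  invol : ∀ u, T (T u) = u
  comm : ∀ u v, inner ℝ (B (T u)) v = inner ℝ (B u) (T v)
  comm_fn : ∀ u v, inner ℝ (T u).fn v.fn = (inner ℝ u.fn (T v).fn : ℝ)
  pos : 0 < d
  coercive : ∀ u, d * ‖u‖ ^ 2 ≤ inner ℝ (B (T u)) u

namespace SplitForm

variable {B T : H1 →L[ℝ] H1} {d : ℝ} (h : SplitForm B T d)
include h

theorem neg_of_apply_eq_neg {v : H1} (hv : T v = -v) : inner ℝ (B v) v ≤ -(d * ‖v‖ ^ 2) := by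
  have := h.coercive v
  rw [hv, map_neg, inner_neg_left] at this
  linarith

theorem inner_eq_zero {u v : H1} (hu : T u = u) (hv : T v = -v) : inner ℝ (B u) v = 0 := by
  have := h.comm u v
  rw [hu, hv, inner_neg_right] at this
  linarith

theorem inner_fn_eq_zero {u v : H1} (hu : T u = u) (hv : T v = -v) :
    inner ℝ u.fn v.fn = (0 : ℝ) := by
  have h1 := h.comm_fn u v
  have h2 : inner ℝ u.fn (-v).fn = -(inner ℝ u.fn v.fn : ℝ) := inner_neg_right _ _
  rw [hu, hv, h2] at h1
  linarith

end SplitForm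

/-! ### A priori bounds and concavity on the Nehari manifold -/

section Nehari

variable {f : ℝ → ℝ → ℝ} {θ d : ℝ} (hf : SuperlinearNonlinearity f θ) {B T : H1 →L[ℝ] H1}
  (hB : SplitForm B T d) {E : Submodule ℝ H1} (hE : ∀ v, v ∈ E ↔ T v = -v)
  {G : H1 → H1} (hG : ∀ u v : H1, inner ℝ (G u) v = ∫ x, f x (u.fn x) * v.fn x)

include hG in
theorem inner_eq_integral_of_inner_sub_eq_zero {u v : H1} (h : inner ℝ (B u - G u) v = 0) :
    inner ℝ (B u) v = ∫ x, f x (u.fn x) * v.fn x := by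
  rw [inner_sub_left, hG] at h
  linarith

include hf in
theorem integral_apply_mul_self_nonneg (u : H1) : 0 ≤ ∫ x, f x (u.fn x) * u.fn x := by
  refine integral_nonneg_of_ae ?_
  filter_upwards [hf.ae_bounds] with x hx
  exact (hx _).1

include hf hG in
/-- On the Nehari manifold, the energy controls `∫ f(x, u) u`. -/
theorem integral_apply_mul_self_le {u : H1} (hu : u ∈ nehariSet E fun u => B u - G u) :
    (1 - θ) * ∫ x, f x (u.fn x) * u.fn x ≤
      2 * (1 + θ) * (1 / 2 * inner ℝ (B u) u - ∫ x, primitive f x (u.fn x)) := by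
  rw [inner_eq_integral_of_inner_sub_eq_zero hG hu.2.1]
  have h1 : (1 + θ) * ∫ x, primitive f x (u.fn x) ≤ θ * ∫ x, f x (u.fn x) * u.fn x := by
    rw [← integral_const_mul, ← integral_const_mul]
    refine integral_mono_ae ((hf.integrable_primitive u).const_mul _)
      ((hf.integrable_apply_mul u u).const_mul _) ?_
    filter_upwards [hf.ae_bounds] with x hx
    exact (hx _).2.2.2.2
  linarith

include hB hE hG in
/-- On the Nehari manifold, the norm is controlled by the nonlinearity. -/
theorem norm_sq_le_integral {u : H1} (hu : u ∈ nehariSet E fun u => B u - G u) :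
    d * ‖u‖ ^ 2 ≤ ∫ x, f x (u.fn x) * (T u).fn x := by
  refine (hB.coercive u).trans ?_
  rw [hB.comm]
  refine (inner_eq_integral_of_inner_sub_eq_zero hG ?_).le
  -- This is twice the E-component of u, so the derivative of J vanishes on Tu as well as on u.
  have h1 : u - T u ∈ E := by
    rw [hE, map_sub, hB.invol, neg_sub]
  have h2 := hu.2.2 _ h1
  have h3 := hu.2.1
  rw [inner_sub_right] at h2
  linarith

include hf in
-- Where |u| ≤ 1, f² ≤ K f u and Young's inequality applies; where |u| ≥ 1, |f| ≤ f u and |v| ≤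
-- 2‖v‖. No growth condition at infinity is needed.
theorem integral_apply_mul_le : ∃ K : ℝ, 0 < K ∧ ∀ (η : ℝ), 0 < η → ∀ u v : H1,
    ∫ x, f x (u.fn x) * v.fn x ≤
      η * ‖v‖ ^ 2 + (K / (4 * η) + 2 * ‖v‖) * ∫ x, f x (u.fn x) * u.fn x := by
  obtain ⟨K, hK, h⟩ := hf.exists_growth 1 one_pos
  refine ⟨K, hK, fun η hη u v => ?_⟩
  have h1 : Integrable fun x => η * v.fn x ^ 2 := (H1.integrable_sq_L2 v.fn).const_mul η
  have h2 : Integrable fun x => (K / (4 * η) + 2 * ‖v‖) * (f x (u.fn x) * u.fn x) :=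
    (hf.integrable_apply_mul u u).const_mul _
  calc _ ≤ ∫ x, (η * v.fn x ^ 2 + (K / (4 * η) + 2 * ‖v‖) * (f x (u.fn x) * u.fn x)) := by
        refine integral_mono_ae (hf.integrable_apply_mul u v) (h1.add h2) ?_
        filter_upwards [h, hf.ae_bounds, v.ae_abs_le] with x hx hx' hv
        set s := u.fn x
        set p := f x s
        have hps := (hx' s).1
        rcases le_total |s| 1 with hs | hs
        · have h3 := (hx s hs).2.1
          have h4 : p ^ 2 ≤ K * (p * s) := by
            rw [← sq_abs, pow_two]
            calc |p| * |p| ≤ |p| * (K * |s|) := by gcongr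
              _ = K * |p * s| := by rw [abs_mul]; ring
              _ = _ := by rw [abs_of_nonneg hps]
          have h5 : p * v.fn x ≤ η * v.fn x ^ 2 + p ^ 2 / (4 * η) := by
            have : η * v.fn x ^ 2 + p ^ 2 / (4 * η) - p * v.fn x =
                η * (v.fn x - p / (2 * η)) ^ 2 := by field_simp; ring
            nlinarith [mul_nonneg hη.le (sq_nonneg (v.fn x - p / (2 * η)))]
          have h6 : p ^ 2 / (4 * η) ≤ K / (4 * η) * (p * s) := by
            rw [div_mul_eq_mul_div]
            gcongr
          nlinarith [mul_nonneg (norm_nonneg v) hps]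
        · have h3 : |p| ≤ p * s := by
            rw [← abs_of_nonneg hps, abs_mul]
            exact le_mul_of_one_le_right (abs_nonneg _) hs
          calc p * v.fn x ≤ |p| * |v.fn x| := by rw [← abs_mul]; exact le_abs_self _
            _ ≤ (p * s) * (2 * ‖v‖) := by gcongr
            _ ≤ _ := by
              have : 0 ≤ η * v.fn x ^ 2 + K / (4 * η) * (p * s) := by positivity
              linarith
    _ = η * ‖v.fn‖ ^ 2 + _ := by
        rw [integral_add h1 h2, integral_const_mul, integral_const_mul, H1.norm_sq_L2]
    _ ≤ _ := by
        gcongr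
        exact v.norm_fn_le

include hf hB hE hG in
-- The preceding estimate with v = Tu, where η‖T‖² ≤ d/2 lets the left side absorb the quadratic
-- term. As the energy controls ∫f(x, u)u, it will control the norm.
theorem exists_norm_sq_le : ∃ K : ℝ, 0 < K ∧ ∀ u ∈ nehariSet E fun u => B u - G u,
    ‖u‖ ^ 2 ≤ K * (1 + ‖u‖) * ∫ x, f x (u.fn x) * u.fn x := by
  obtain ⟨K, hK, h⟩ := integral_apply_mul_le hf
  have hd := hB.pos
  set τ := ‖T‖ with hτ
  set η := d / (2 * (τ ^ 2 + 1)) with hη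
  have hη0 : 0 < η := by positivity
  have hητ : η * τ ^ 2 ≤ d / 2 := by
    rw [hη, div_mul_eq_mul_div, div_le_div_iff₀ (by positivity) two_pos]
    nlinarith
  refine ⟨2 / d * (K / (4 * η) + 2 * τ), by positivity, fun u hu => ?_⟩
  have h1 := (norm_sq_le_integral hB hE hG hu).trans (h η hη0 u (T u))
  have h2 : ‖T u‖ ≤ τ * ‖u‖ := T.le_opNorm u
  have hP := integral_apply_mul_self_nonneg hf u
  set P := ∫ x, f x (u.fn x) * u.fn x
  have h3 : η * ‖T u‖ ^ 2 ≤ d / 2 * ‖u‖ ^ 2 := by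
    calc η * ‖T u‖ ^ 2 ≤ η * (τ * ‖u‖) ^ 2 := by gcongr
      _ = η * τ ^ 2 * ‖u‖ ^ 2 := by ring
      _ ≤ _ := by gcongr
  have h4 : (K / (4 * η) + 2 * ‖T u‖) * P ≤ (K / (4 * η) + 2 * τ) * (1 + ‖u‖) * P := by
    refine mul_le_mul_of_nonneg_right ?_ hP
    have h5 : 0 ≤ K / (4 * η) * ‖u‖ := by positivity
    have h6 : 0 ≤ τ := T.opNorm_nonneg
    nlinarith
  have h5 : d / 2 * ‖u‖ ^ 2 ≤ (K / (4 * η) + 2 * τ) * (1 + ‖u‖) * P := by linarith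
  calc ‖u‖ ^ 2 = 2 / d * (d / 2 * ‖u‖ ^ 2) := by field_simp
    _ ≤ 2 / d * ((K / (4 * η) + 2 * τ) * (1 + ‖u‖) * P) := by gcongr
    _ = _ := by ring

include hf hB hE hG in
/-- The Nehari manifold stays away from `0`. -/
theorem exists_le_norm : ∃ r : ℝ, 0 < r ∧ ∀ u ∈ nehariSet E fun u => B u - G u, r ≤ ‖u‖ := by
  obtain ⟨K, hK, h⟩ := hf.exists_growth 2 two_pos
  have hd := hB.pos
  refine ⟨min 1 (d / (2 * K * (‖T‖ + 1))), by positivity, fun u hu => ?_⟩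
  rcases le_total 1 ‖u‖ with h1 | h1
  · exact (min_le_left _ _).trans h1
  refine (min_le_right _ _).trans ?_
  rw [div_le_iff₀ (by positivity)]
  -- For ‖u‖ ≤ 1 the bound |f(x, u)| ≤ Ku² makes the right side cubic: d‖u‖² ≤ 2K‖T‖‖u‖³.
  have h2 := norm_sq_le_integral hB hE hG hu
  have h3 := abs_integral_mul_le (C := 2 * K * ‖u‖) (hf.aestronglyMeasurable u.fn) u (by
    filter_upwards [h, u.ae_abs_le] with x hx hx'
    refine (hx _ (by linarith)).2.2.1.trans ?_
    rw [← sq_abs]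
    have := mul_le_mul_of_nonneg_left hx' (mul_nonneg hK.le (abs_nonneg (u.fn x)))
    linarith) (by positivity) (T u)
  have h4 := T.le_opNorm u
  have hu0 : 0 < ‖u‖ := norm_pos_iff.2 hu.1
  have h5 : d * ‖u‖ ^ 2 ≤ 2 * K * ‖u‖ * (‖u‖ * (‖T‖ * ‖u‖)) :=
    h2.trans ((le_abs_self _).trans (h3.trans (by gcongr)))
  have h6 : d * ‖u‖ ^ 2 ≤ (‖u‖ * (2 * K * ‖T‖)) * ‖u‖ ^ 2 := by linarith
  have h7 := le_of_mul_le_mul_right h6 (by positivity)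
  nlinarith [mul_pos hu0 hK]

/-- The pointwise inequality behind the concavity of the energy at points of the Nehari manifold. -/
theorem two_mul_add_sub_le {p q u v s θ : ℝ} (hθ : 0 < θ) (h0 : u = 0 → p = 0) (hq : 0 ≤ q)
    (h1 : 0 ≤ p * u) (h2 : p * u ≤ θ * (q * u ^ 2)) :
    2 * s * (p * v) + s ^ 2 * (p * u) - q * (v + s * u) * (v + s * u) ≤
      -((1 - θ) * s ^ 2 * (p * u)) := by
  rcases eq_or_ne u 0 with rfl | hu
  · rw [h0 rfl]
    nlinarith [mul_nonneg hq (sq_nonneg v)]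
  -- With v = au, multiplying by θ and using P ≤ θQ leaves exactly the square P((a + s) − θs)² ≥ 0.
  · obtain ⟨a, rfl⟩ : ∃ a, v = a * u := ⟨v / u, by field_simp⟩
    set P := p * u with hP
    set Q := q * u ^ 2 with hQ
    have e1 : p * (a * u) = a * P := by rw [hP]; ring
    have e2 : q * (a * u + s * u) * (a * u + s * u) = Q * (a + s) ^ 2 := by rw [hQ]; ring
    rw [e1, e2]
    have h3 : P * (a + s) ^ 2 ≤ θ * Q * (a + s) ^ 2 :=
      mul_le_mul_of_nonneg_right h2 (sq_nonneg _)
    have h4 : 0 ≤ P * ((a + s) - θ * s) ^ 2 := mul_nonneg h1 (sq_nonneg _)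
    refine le_of_mul_le_mul_left ?_ hθ
    nlinarith

include hf hB hE hG in
/-- The Hessian is negative definite transversally to the Nehari manifold. -/
theorem inner_hessian_le {D : H1 → H1 →L[ℝ] H1}
    (hD : ∀ u v w : H1, inner ℝ (D u v) w = ∫ x, deriv (f x) (u.fn x) * v.fn x * w.fn x)
    {u : H1} (hu : u ∈ nehariSet E fun u => B u - G u) {v : H1} (hv : v ∈ E) (s : ℝ) :
    inner ℝ ((B - D u) (v + s • u)) (v + s • u) ≤
      -(d * ‖v‖ ^ 2 + (1 - θ) * s ^ 2 * ∫ x, f x (u.fn x) * u.fn x) := by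
  have h1 := inner_eq_integral_of_inner_sub_eq_zero hG hu.2.1
  have h2 := inner_eq_integral_of_inner_sub_eq_zero hG (hu.2.2 v hv)
  have h3 := hB.neg_of_apply_eq_neg ((hE v).1 hv)
  -- The Nehari equations replace the mixed term and the u-term of the form by integrals of f, so
  -- that only a pointwise inequality remains.
  have h4 : inner ℝ (B (v + s • u)) (v + s • u) = inner ℝ (B v) v +
      2 * s * (∫ x, f x (u.fn x) * v.fn x) + s ^ 2 * ∫ x, f x (u.fn x) * u.fn x := by
    rw [← h1, ← h2, map_add, map_smul, inner_add_left, inner_add_right, inner_add_right,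
      H1.inner_smul_l, H1.inner_smul_l, H1.inner_smul_r, H1.inner_smul_r, hB.symm v u,
      real_inner_comm (B u) v]
    ring
  have i1 : Integrable fun x => 2 * s * (f x (u.fn x) * v.fn x) :=
    (hf.integrable_apply_mul u v).const_mul _
  have i2 : Integrable fun x => s ^ 2 * (f x (u.fn x) * u.fn x) :=
    (hf.integrable_apply_mul u u).const_mul _
  have i3 : Integrable fun x => 2 * s * (f x (u.fn x) * v.fn x) + s ^ 2 * (f x (u.fn x) * u.fn x) :=
    i1.add i2
  have i4 := hf.integrable_deriv_mul u (v + s • u) (v + s • u)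
  have h5 : (2 * s * ∫ x, f x (u.fn x) * v.fn x) + (s ^ 2 * ∫ x, f x (u.fn x) * u.fn x) -
      ∫ x, deriv (f x) (u.fn x) * (v + s • u).fn x * (v + s • u).fn x ≤
      -((1 - θ) * s ^ 2 * ∫ x, f x (u.fn x) * u.fn x) := by
    rw [← integral_const_mul, ← integral_const_mul, ← integral_const_mul, ← integral_add i1 i2,
      ← integral_sub i3 i4, ← integral_neg]
    refine integral_mono_ae (i3.sub i4) (((hf.integrable_apply_mul u u).const_mul _).neg) ?_
    filter_upwards [hf.ae_bounds, hf.apply_zero, Lp.coeFn_add v.fn (s • u.fn),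
      Lp.coeFn_smul s u.fn] with x hx h0 e1 e2
    have e3 : (v + s • u).fn x = v.fn x + s * u.fn x := by
      refine (show (v + s • u).fn x = (v.fn + s • u.fn) x from rfl).trans ?_
      rw [e1, Pi.add_apply, e2, Pi.smul_apply, smul_eq_mul]
    rw [e3]
    exact two_mul_add_sub_le hf.pos (fun h => by rw [h, h0]) (hx _).2.2.1 (hx _).1 (hx _).2.1
  rw [sub_apply, inner_sub_left, hD, h4]
  linarith

include hf hB hE hG in
/-- Uniform bounds on the part of the Nehari manifold below an energy level. -/
theorem exists_level_bounds {D : H1 → H1 →L[ℝ] H1}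
    (hD : ∀ u v w : H1, inner ℝ (D u v) w = ∫ x, deriv (f x) (u.fn x) * v.fn x * w.fn x) (C : ℝ) :
    ∃ M r c, 0 ≤ M ∧ 0 < r ∧ 0 < c ∧ ∀ u ∈ nehariSet E fun u => B u - G u,
      1 / 2 * inner ℝ (B u) u - ∫ x, primitive f x (u.fn x) ≤ C → r ≤ ‖u‖ ∧ ‖u‖ ≤ M ∧
        ∀ v ∈ E, ∀ s : ℝ, inner ℝ ((B - D u) (v + s • u)) (v + s • u) ≤
          -(c * (‖v‖ ^ 2 + s ^ 2)) := by
  obtain ⟨r, hr, hrN⟩ := exists_le_norm hf hB hE hG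
  obtain ⟨K, hK, hKN⟩ := exists_norm_sq_le hf hB hE hG
  have hd := hB.pos
  have hθ1 : 0 < 1 - θ := sub_pos.2 hf.lt_one
  have hθ := hf.pos
  -- P₀ bounds ∫f(x, u)u at energy at most C. For ‖u‖ ≥ 1, ‖u‖² ≤ 2KP₀‖u‖ then gives the bound M on
  -- the norm, and the lower bound r on the norm gives ∫f(x, u)u ≥ κ > 0.
  set P₀ := 2 * (1 + θ) * |C| / (1 - θ) with hP₀
  have hP₀0 : 0 ≤ P₀ := by positivity
  set M := 1 + 2 * K * P₀ with hM
  set κ := r ^ 2 / (K * (1 + M)) with hκ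
  have hκ0 : 0 < κ := by positivity
  refine ⟨M, r, min d ((1 - θ) * κ), by positivity, hr, lt_min hd (by positivity),
    fun u hu hJ => ?_⟩
  have h1 := integral_apply_mul_self_le hf hG hu
  have h2 := hKN u hu
  have h0 := integral_apply_mul_self_nonneg hf u
  have hru := hrN u hu
  have h7 := fun v hv s => inner_hessian_le hf hB hE hG hD hu (v := v) hv s
  set P := ∫ x, f x (u.fn x) * u.fn x
  have hPP : P ≤ P₀ := by
    rw [hP₀, le_div_iff₀ hθ1]
    have : 2 * (1 + θ) * (1 / 2 * inner ℝ (B u) u - ∫ x, primitive f x (u.fn x)) ≤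
        2 * (1 + θ) * |C| := by
      gcongr
      exact hJ.trans (le_abs_self C)
    linarith
  have hMu : ‖u‖ ≤ M := by
    rcases le_total ‖u‖ 1 with h3 | h3
    · exact h3.trans (by rw [hM]; linarith [mul_nonneg (mul_nonneg two_pos.le hK.le) hP₀0])
    · have h4 : ‖u‖ * ‖u‖ ≤ (2 * K * P₀) * ‖u‖ := by
        calc ‖u‖ * ‖u‖ = ‖u‖ ^ 2 := (pow_two _).symm
          _ ≤ K * (1 + ‖u‖) * P := h2
          _ ≤ K * (‖u‖ + ‖u‖) * P₀ := by gcongr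
          _ = _ := by ring
      have := le_of_mul_le_mul_right h4 (one_pos.trans_le h3)
      linarith
  have hκP : κ ≤ P := by
    rw [hκ, div_le_iff₀ (by positivity)]
    calc r ^ 2 ≤ ‖u‖ ^ 2 := by gcongr
      _ ≤ K * (1 + ‖u‖) * P := h2
      _ ≤ K * (1 + M) * P := by gcongr
      _ = _ := by ring
  refine ⟨hru, hMu, fun v hv s => (h7 v hv s).trans (neg_le_neg ?_)⟩
  have h8 : min d ((1 - θ) * κ) * ‖v‖ ^ 2 ≤ d * ‖v‖ ^ 2 := by
    gcongr
    exact min_le_left _ _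
  have h9 : min d ((1 - θ) * κ) * s ^ 2 ≤ (1 - θ) * s ^ 2 * P := by
    calc _ ≤ (1 - θ) * κ * s ^ 2 := by gcongr; exact min_le_right _ _
      _ ≤ (1 - θ) * P * s ^ 2 := by gcongr
      _ = _ := by ring
  linarith

end Nehari

end GapSoliton

/-! ### The Nehari manifold is not empty -/

theorem cauchySeq_of_norm_sub_sq_le {X : Type*} [NormedAddCommGroup X] {v : ℕ → X} {a : ℕ → ℝ}
    (h : ∀ m n, ‖v m - v n‖ ^ 2 ≤ a m + a n) (ha : Tendsto a atTop (𝓝 0)) : CauchySeq v := by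
  rw [Metric.cauchySeq_iff]
  intro ε hε
  obtain ⟨N, hN⟩ := eventually_atTop.1 (ha.eventually_lt_const (show 0 < ε ^ 2 / 2 by positivity))
  refine ⟨N, fun m hm n hn => ?_⟩
  rw [dist_eq_norm]
  refine lt_of_pow_lt_pow_left₀ 2 hε.le ((h m n).trans_lt ?_)
  linarith [hN m hm, hN n hn]

/-- An integrable function is small outside a set of finite measure. -/
theorem exists_setIntegral_compl_lt {h : ℝ → ℝ} (hh : Integrable h) {ε : ℝ} (hε : 0 < ε) :
    ∃ I : Set ℝ, MeasurableSet I ∧ volume I < ∞ ∧ ∫ x in Iᶜ, h x < ε := by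
  have h1 := tendsto_setIntegral_of_monotone (μ := volume) (f := h)
    (s := fun n : ℕ => Icc (-(n : ℝ)) n) (fun n => measurableSet_Icc)
    (fun m n hmn => Icc_subset_Icc (by simpa using hmn) (by simpa using hmn)) hh.integrableOn
  have h2 : (⋃ n : ℕ, Icc (-(n : ℝ)) n) = univ := by
    refine eq_univ_of_forall fun x => mem_iUnion.2 ?_
    obtain ⟨n, hn⟩ := exists_nat_ge |x|
    exact ⟨n, abs_le.1 hn⟩
  rw [h2, setIntegral_univ] at h1
  obtain ⟨n, hn⟩ := (h1.eventually_const_lt (show (∫ x, h x) - ε < ∫ x, h x by linarith)).exists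
  refine ⟨Icc (-(n : ℝ)) n, measurableSet_Icc, measure_Icc_lt_top, ?_⟩
  have := integral_add_compl (measurableSet_Icc (a := -(n : ℝ)) (b := n)) hh
  linarith

namespace GapSoliton

section Linking

variable {f : ℝ → ℝ → ℝ} {θ d : ℝ} (hf : SuperlinearNonlinearity f θ) {B T : H1 →L[ℝ] H1}
  (hB : SplitForm B T d) {E : Submodule ℝ H1} (hE : ∀ v, v ∈ E ↔ T v = -v)

theorem SplitForm.inner_smul_add (hB : SplitForm B T d) {u v : H1} (hu : T u = u) (hv : T v = -v)
    (s : ℝ) :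
    inner ℝ (B (s • u + v)) (s • u + v) = s ^ 2 * inner ℝ (B u) u + inner ℝ (B v) v := by
  have h1 := hB.inner_eq_zero hu hv
  have h2 : inner ℝ (B v) u = 0 := by rw [hB.symm, real_inner_comm, h1]
  rw [map_add, map_smul, inner_add_left, inner_add_right, inner_add_right, H1.inner_smul_l,
    H1.inner_smul_l, H1.inner_smul_r, H1.inner_smul_r, h1, h2]
  ring

include hf in
theorem integral_primitive_nonneg (w : H1) : 0 ≤ ∫ x, primitive f x (w.fn x) := by
  refine integral_nonneg_of_ae ?_
  filter_upwards [hf.ae_bounds] with x hx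
  exact (hx _).2.2.2.1

include hf hB hE in
-- If v dominates, the quadratic part is nonpositive and F ≥ 0. Otherwise su + v is of size s in L²
-- and its product with u is s‖u‖², because the splitting is also L²-orthogonal. So enough mass lies
-- in a fixed set of finite measure, where F ≥ Λw² − C with Λ large outweighs the quadratic part.
theorem exists_forall_energy_nonpos
    (hF : ∀ s : ℝ, s ≠ 0 → ∃ δ : ℝ, 0 < δ ∧ ∀ᵐ x : ℝ, δ ≤ primitive f x s)
    {u : H1} (hu : T u = u) (hu0 : u ≠ 0) :
    ∃ s₀ : ℝ, 0 < s₀ ∧ ∀ s, s₀ ≤ s → ∀ v ∈ E,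
      1 / 2 * inner ℝ (B (s • u + v)) (s • u + v) - ∫ x, primitive f x ((s • u + v).fn x) ≤ 0 := by
  have hd := hB.pos
  set b := inner ℝ (B u) u with hb
  have hb0 : 0 ≤ b := by
    have := hB.coercive u
    rw [hu] at this
    exact le_trans (by positivity) this
  set U := ‖u.fn‖ ^ 2 with hU
  have hU0 : 0 < U := by
    have : u.fn ≠ 0 := fun h => hu0 (H1.fn_injective h)
    have := norm_pos_iff.2 this
    positivity
  set Z := U + b / d with hZ
  have hZ0 : 0 < Z := by positivity
  -- ‖w‖² ≤ s²Z in L². The choice of η, and of I with tail below ηU/2, makes each of the two error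
  -- terms at most s²ΛU/8.
  set η := U / (8 * Z) with hη
  have hη0 : 0 < η := by positivity
  have hηZ : η * Z = U / 8 := by rw [hη]; field_simp
  obtain ⟨I, hI, hIfin, hIc⟩ := exists_setIntegral_compl_lt (H1.integrable_sq_L2 u.fn)
    (show 0 < η * U / 2 by positivity)
  set τ := ∫ x in Iᶜ, u.fn x ^ 2 with hτ
  -- Of the main term ¾ s²ΛU, half of s²ΛU survives the errors; this is ½ s²b + s², enough for the
  -- quadratic part and, once s² ≥ C|I|, for the constant.
  set Λ := (b + 2) / U with hΛ
  have hΛ0 : 0 < Λ := by positivity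
  have hΛU : Λ * U = b + 2 := by rw [hΛ]; field_simp
  obtain ⟨C, hC, hquad⟩ := hf.exists_quadratic_le hF Λ hΛ0
  set m := (volume I).toReal with hm
  have hm0 : 0 ≤ m := ENNReal.toReal_nonneg
  refine ⟨Real.sqrt (C * m) + 1, by positivity, fun s hs v hv => ?_⟩
  have hs2 : C * m ≤ s ^ 2 := by
    have h1 : Real.sqrt (C * m) ≤ s := by linarith
    calc C * m = Real.sqrt (C * m) ^ 2 := (Real.sq_sqrt (by positivity)).symm
      _ ≤ s ^ 2 := by gcongr
  have hTv := (hE v).1 hv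
  have hneg := hB.neg_of_apply_eq_neg hTv
  rw [hB.inner_smul_add hu hTv, ← hb]
  have hFnn := integral_primitive_nonneg hf (s • u + v)
  -- Either v dominates and the quadratic part is nonpositive, or ‖v‖² ≤ s²b/d.
  rcases le_total (s ^ 2 * b) (d * ‖v‖ ^ 2) with hcase | hcase
  · linarith
  set w := s • u + v with hw
  have hort := hB.inner_fn_eq_zero hu hTv
  have hwfn : w.fn = s • u.fn + v.fn := rfl
  have hwu : ∫ x, w.fn x * u.fn x = s * U := by
    rw [← H1.inner_L2, hwfn, inner_add_left, inner_smul_L2, real_inner_self_eq_norm_sq,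
      real_inner_comm, hort, add_zero]
  have hww : ∫ x, w.fn x ^ 2 ≤ s ^ 2 * Z := by
    rw [← H1.norm_sq_L2, hwfn, norm_add_sq_real, inner_smul_L2, hort, norm_smul, mul_pow,
      Real.norm_eq_abs, sq_abs, ← hU]
    have h1 : ‖v.fn‖ ^ 2 ≤ ‖v‖ ^ 2 := by
      gcongr
      exact v.norm_fn_le
    have h2 : ‖v‖ ^ 2 ≤ s ^ 2 * (b / d) := by
      rw [mul_div_assoc', le_div_iff₀ hd]
      linarith
    rw [hZ]
    linarith
  have i1 : Integrable fun x => w.fn x * u.fn x := H1.integrable_mul_L2 w.fn u.fn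
  have i2 := H1.integrable_sq_L2 u.fn
  have i3 := H1.integrable_sq_L2 w.fn
  have i4 : Integrable fun x => Iᶜ.indicator (fun x => u.fn x ^ 2) x := i2.indicator hI.compl
  have i5 : Integrable fun x => I.indicator (fun _ => C) x :=
    (integrable_indicator_iff hI).2 (integrableOn_const hIfin.ne)
  have e4 : ∫ x, Iᶜ.indicator (fun x => u.fn x ^ 2) x = τ := integral_indicator hI.compl
  have e5 : ∫ x, I.indicator (fun _ => C) x = C * m := by
    rw [integral_indicator_const _ hI, smul_eq_mul, mul_comm]
    rfl
  have j1 : Integrable fun x => Λ * s * (w.fn x * u.fn x) := i1.const_mul _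
  have j2 : Integrable fun x => Λ * s ^ 2 / 4 * u.fn x ^ 2 := i2.const_mul _
  have j3 : Integrable fun x => Λ * η * w.fn x ^ 2 := i3.const_mul _
  have j4 : Integrable fun x =>
      Λ * s ^ 2 / (4 * η) * Iᶜ.indicator (fun x => u.fn x ^ 2) x := i4.const_mul _
  have k1 : Integrable fun x => Λ * s * (w.fn x * u.fn x) - Λ * s ^ 2 / 4 * u.fn x ^ 2 := j1.sub j2
  have k2 : Integrable fun x => Λ * s * (w.fn x * u.fn x) - Λ * s ^ 2 / 4 * u.fn x ^ 2 -
      Λ * η * w.fn x ^ 2 := k1.sub j3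
  have k3 : Integrable fun x => Λ * s * (w.fn x * u.fn x) - Λ * s ^ 2 / 4 * u.fn x ^ 2 -
      Λ * η * w.fn x ^ 2 - Λ * s ^ 2 / (4 * η) * Iᶜ.indicator (fun x => u.fn x ^ 2) x := k2.sub j4
  -- Pointwise: on I from (w − su/2)² ≥ 0; off I, where only F ≥ 0 is used, from (w − su/(2η))² ≥ 0.
  have key : Λ * s * (s * U) - Λ * s ^ 2 / 4 * U - Λ * η * (∫ x, w.fn x ^ 2) -
      Λ * s ^ 2 / (4 * η) * τ - C * m ≤ ∫ x, primitive f x (w.fn x) := by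
    rw [← hwu, hU, H1.norm_sq_L2, ← e4, ← e5, ← integral_const_mul, ← integral_const_mul,
      ← integral_const_mul, ← integral_const_mul, ← integral_sub j1 j2, ← integral_sub k1 j3,
      ← integral_sub k2 j4, ← integral_sub k3 i5]
    refine integral_mono_ae (k3.sub i5) (hf.integrable_primitive w) ?_
    filter_upwards [hquad, hf.ae_bounds] with x hx hx'
    have h2 := mul_nonneg hΛ0.le (sq_nonneg (w.fn x - s * u.fn x / 2))
    have h3 := mul_nonneg (mul_nonneg hΛ0.le hη0.le) (sq_nonneg (w.fn x))
    by_cases hxI : x ∈ I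
    · rw [indicator_of_notMem (by simpa using hxI), indicator_of_mem hxI]
      have h1 := hx (w.fn x)
      linarith
    · rw [indicator_of_mem (by simpa using hxI), indicator_of_notMem hxI]
      have h1 := (hx' (w.fn x)).2.2.2.1
      have h4 := mul_nonneg (mul_nonneg hΛ0.le hη0.le)
        (sq_nonneg (w.fn x - s * u.fn x / (2 * η)))
      have h5 : Λ * η * (w.fn x - s * u.fn x / (2 * η)) ^ 2 = Λ * η * w.fn x ^ 2 -
          Λ * s * (w.fn x * u.fn x) + Λ * s ^ 2 / (4 * η) * u.fn x ^ 2 := by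
        field_simp
        ring
      have h6 : 0 ≤ Λ * s ^ 2 / 4 * u.fn x ^ 2 := by positivity
      linarith
  have h1 : Λ * η * (∫ x, w.fn x ^ 2) ≤ s ^ 2 * (Λ * U) / 8 := by
    calc _ ≤ Λ * η * (s ^ 2 * Z) := by gcongr
      _ = Λ * s ^ 2 * (η * Z) := by ring
      _ = _ := by rw [hηZ]; ring
  have h2 : Λ * s ^ 2 / (4 * η) * τ ≤ s ^ 2 * (Λ * U) / 8 := by
    calc _ ≤ Λ * s ^ 2 / (4 * η) * (η * U / 2) := by gcongr
      _ = _ := by field_simp; ring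
  have h3 : Λ * s * (s * U) - Λ * s ^ 2 / 4 * U = 3 / 4 * (s ^ 2 * (Λ * U)) := by ring
  have h4 : s ^ 2 * (Λ * U) = s ^ 2 * b + 2 * s ^ 2 := by rw [hΛU]; ring
  have h5 : 0 ≤ d * ‖v‖ ^ 2 := by positivity
  nlinarith

include hf hB in
-- For small su the quadratic part is at least a multiple of its norm squared, while F ≤ f s is
-- cubic near 0.
theorem exists_energy_pos {u : H1} (hu : T u = u) (hu0 : u ≠ 0) :
    ∃ s : ℝ, 0 < s ∧
      0 < 1 / 2 * inner ℝ (B (s • u)) (s • u) - ∫ x, primitive f x ((s • u).fn x) := by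
  have hd := hB.pos
  have hθ := hf.pos
  have hun := norm_pos_iff.2 hu0
  obtain ⟨K, hK, h⟩ := hf.exists_growth 2 two_pos
  set r := min 1 (d / (8 * K)) with hr
  have hr0 : 0 < r := by positivity
  have hr1 : r ≤ 1 := min_le_left _ _
  have hrK : r * (8 * K) ≤ d := by
    rw [← le_div_iff₀ (by positivity)]
    exact min_le_right _ _
  refine ⟨r / ‖u‖, by positivity, ?_⟩
  set w := (r / ‖u‖) • u with hw
  have hTw : T w = w := by rw [hw, map_smul, hu]
  have hwn : ‖w‖ = r := by
    rw [hw, norm_smul, Real.norm_of_nonneg (by positivity)]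
    field_simp
  have h1 := hB.coercive w
  rw [hTw, hwn] at h1
  have h2 : ∫ x, primitive f x (w.fn x) ≤ 2 * K * r * ‖w.fn‖ ^ 2 := by
    rw [H1.norm_sq_L2, ← integral_const_mul]
    refine integral_mono_ae (hf.integrable_primitive w) ((H1.integrable_sq_L2 w.fn).const_mul _) ?_
    filter_upwards [h, hf.ae_bounds, w.ae_abs_le] with x hx hx' hle
    rw [hwn] at hle
    have h3 := (hx (w.fn x) (by linarith)).2.2.1
    obtain ⟨hp, -, -, hFn, hAR⟩ := hx' (w.fn x)
    have h4 : primitive f x (w.fn x) ≤ f x (w.fn x) * w.fn x := by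
      have : θ * primitive f x (w.fn x) ≤ θ * (f x (w.fn x) * w.fn x) := by nlinarith
      exact le_of_mul_le_mul_left this hθ
    calc _ ≤ f x (w.fn x) * w.fn x := h4
      _ ≤ |f x (w.fn x)| * |w.fn x| := by rw [← abs_mul]; exact le_abs_self _
      _ ≤ (K * w.fn x ^ 2) * (2 * r) := by gcongr
      _ = _ := by ring
  have h3 : ‖w.fn‖ ^ 2 ≤ r ^ 2 := by
    rw [← hwn]
    gcongr
    exact w.norm_fn_le
  have h4 : 2 * K * r * ‖w.fn‖ ^ 2 ≤ 2 * K * r * r ^ 2 := by gcongr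
  have h5 : r * (8 * K) * r ^ 2 ≤ d * r ^ 2 := by gcongr
  have h6 : 0 < d * r ^ 2 := by positivity
  linarith

include hf in
/-- The functional `∫ F(x, u)` is convex. -/
theorem integral_primitive_midpoint_le (v w : H1) :
    ∫ x, primitive f x (((1 / 2 : ℝ) • (v + w)).fn x) ≤
      1 / 2 * (∫ x, primitive f x (v.fn x)) + 1 / 2 * ∫ x, primitive f x (w.fn x) := by
  have i1 : Integrable fun x => 1 / 2 * primitive f x (v.fn x) :=
    (hf.integrable_primitive v).const_mul _
  have i2 : Integrable fun x => 1 / 2 * primitive f x (w.fn x) :=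
    (hf.integrable_primitive w).const_mul _
  rw [← integral_const_mul, ← integral_const_mul, ← integral_add i1 i2]
  refine integral_mono_ae (hf.integrable_primitive _) (i1.add i2) ?_
  filter_upwards [hf.ae_bounds, hf.smooth, Lp.coeFn_smul (1 / 2 : ℝ) (v.fn + w.fn),
    Lp.coeFn_add v.fn w.fn] with x hx hsm e1 e2
  have e3 : ((1 / 2 : ℝ) • (v + w)).fn x = 1 / 2 * v.fn x + 1 / 2 * w.fn x := by
    refine (show ((1 / 2 : ℝ) • (v + w)).fn x = ((1 / 2 : ℝ) • (v.fn + w.fn)) x from rfl).trans ?_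
    rw [e1, Pi.smul_apply, e2, Pi.add_apply, smul_eq_mul, mul_add]
  rw [e3]
  have hFd := hasDerivAt_primitive (f := f) hsm.continuous
  have hder : deriv (primitive f x) = f x := funext fun s => (hFd s).deriv
  have hconv : ConvexOn ℝ univ (primitive f x) := by
    refine Monotone.convexOn_univ_of_deriv (fun s => (hFd s).differentiableAt) ?_
    rw [hder]
    exact monotone_of_deriv_nonneg (hsm.differentiable one_ne_zero) fun s => (hx s).2.2.1
  exact hconv.2 (mem_univ _) (mem_univ _) (by norm_num : (0 : ℝ) ≤ 1 / 2)
    (by norm_num : (0 : ℝ) ≤ 1 / 2) (by norm_num)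

include hf in
-- Parallelogram identity for the quadratic part, convexity for F. For v − w in E the form of v − w
-- is at most −d‖v − w‖², which makes J uniformly concave along E.
theorem SplitForm.energy_midpoint (hB : SplitForm B T d) (v w : H1) :
    1 / 2 * (1 / 2 * inner ℝ (B v) v - ∫ x, primitive f x (v.fn x)) +
      1 / 2 * (1 / 2 * inner ℝ (B w) w - ∫ x, primitive f x (w.fn x)) -
      1 / 8 * inner ℝ (B (v - w)) (v - w) ≤
    1 / 2 * inner ℝ (B ((1 / 2 : ℝ) • (v + w))) ((1 / 2 : ℝ) • (v + w)) -
      ∫ x, primitive f x (((1 / 2 : ℝ) • (v + w)).fn x) := by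
  have h1 := integral_primitive_midpoint_le hf v w
  rw [map_smul, H1.inner_smul_l, H1.inner_smul_r, map_add, map_sub, inner_add_left, inner_add_right,
    inner_add_right, inner_sub_left, inner_sub_right, inner_sub_right, hB.symm w v,
    real_inner_comm (B v) w]
  linarith

include hf hB hE in
-- J attains a positive maximum over {su + v : s ≥ 0, v ∈ E}, at a point with s > 0. The derivative
-- there vanishes on u and on E, hence also at the point itself.
theorem nehariSet_nonempty
    (hF : ∀ s : ℝ, s ≠ 0 → ∃ δ : ℝ, 0 < δ ∧ ∀ᵐ x : ℝ, δ ≤ primitive f x s) {g : H1 → H1}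
    (hg : ∀ u, HasGradientAt (fun u : H1 => 1 / 2 * inner ℝ (B u) u - ∫ x, primitive f x (u.fn x))
      (g u) u)
    {u : H1} (hu : T u = u) (hu0 : u ≠ 0) : (nehariSet E g).Nonempty := by
  obtain ⟨s₀, hs₀, hneg⟩ := exists_forall_energy_nonpos hf hB hE hF hu hu0
  obtain ⟨s₁, hs₁, hpos⟩ := exists_energy_pos hf hB hu hu0
  set J := fun u : H1 => 1 / 2 * inner ℝ (B u) u - ∫ x, primitive f x (u.fn x) with hJ
  have hd := hB.pos
  set b := inner ℝ (B u) u with hb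
  have hb0 : 0 ≤ b := by
    have := hB.coercive u
    rw [hu] at this
    exact le_trans (by positivity) this
  have hJle : ∀ s : ℝ, ∀ v ∈ E, J (s • u + v) ≤ 1 / 2 * s ^ 2 * b := by
    intro s v hv
    have h1 := hB.neg_of_apply_eq_neg ((hE v).1 hv)
    have h2 := integral_primitive_nonneg hf (s • u + v)
    have h3 : 0 ≤ d * ‖v‖ ^ 2 := by positivity
    simp only [hJ]
    rw [hB.inner_smul_add hu ((hE v).1 hv)]
    linarith
  set A : Set ℝ := {y | ∃ s : ℝ, 0 ≤ s ∧ ∃ v ∈ E, J (s • u + v) = y} with hA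
  have hbdd : BddAbove A := by
    refine ⟨1 / 2 * s₀ ^ 2 * b, ?_⟩
    rintro y ⟨s, hs, v, hv, rfl⟩
    rcases le_total s₀ s with h | h
    · exact (hneg s h v hv).trans (by positivity)
    · exact (hJle s v hv).trans (by gcongr)
  set M := sSup A with hM
  have hleM : ∀ s : ℝ, 0 ≤ s → ∀ v ∈ E, J (s • u + v) ≤ M := fun s hs v hv =>
    le_csSup hbdd ⟨s, hs, v, hv, rfl⟩
  have hJs₁ : 0 < J (s₁ • u + 0) := by rwa [add_zero]
  have hM0 : 0 < M := hJs₁.trans_le (hleM s₁ hs₁.le 0 E.zero_mem)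
  have hAne : A.Nonempty := ⟨_, s₁, hs₁.le, 0, E.zero_mem, rfl⟩
  have hex : ∀ n : ℕ, ∃ s : ℝ, s ∈ Icc 0 s₀ ∧ ∃ v ∈ E, M - M / (n + 2) < J (s • u + v) := by
    intro n
    obtain ⟨y, ⟨s, hs, v, hv, rfl⟩, hy⟩ := exists_lt_of_lt_csSup hAne
      (show M - M / ((n : ℝ) + 2) < M by linarith [show 0 < M / ((n : ℝ) + 2) by positivity])
    refine ⟨s, ⟨hs, ?_⟩, v, hv, hy⟩
    by_contra! hlt
    have h1 := hneg s hlt.le v hv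
    have h2 : M / ((n : ℝ) + 2) ≤ M := div_le_self hM0.le (by linarith [n.cast_nonneg (α := ℝ)])
    exact absurd (hy.trans_le h1) (by linarith)
  choose s hs v hv hsv using hex
  obtain ⟨σ, hσ, φ, hφ, hlim⟩ := isCompact_Icc.tendsto_subseq hs
  have he : Tendsto (fun n => M - J (s (φ n) • u + v (φ n))) atTop (𝓝 0) := by
    have h1 : Tendsto (fun n : ℕ => M / ((n : ℝ) + 2)) atTop (𝓝 0) :=
      tendsto_const_nhds.div_atTop
        (tendsto_atTop_add_const_right _ _ tendsto_natCast_atTop_atTop)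
    refine squeeze_zero (fun n => sub_nonneg.2 (hleM _ (hs _).1 _ (hv _))) (fun n => ?_)
      (h1.comp hφ.tendsto_atTop)
    have := hsv (φ n)
    simp only [Function.comp_apply]
    linarith
  -- Midpoints are admissible, so their energy is at most M; uniform concavity then bounds ‖v' −
  -- w'‖² by the defects of the two points and the distances of their parameters s from σ.
  have hcau : CauchySeq fun n => v (φ n) := by
    refine cauchySeq_of_norm_sub_sq_le (a := fun n => 8 / d *
      (1 / 2 * (M - J (s (φ n) • u + v (φ n))) + 1 / 4 * b * (s (φ n) - σ) ^ 2)) (fun m n => ?_) ?_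
    · set s' := s (φ m)
      set t' := s (φ n)
      set v' := v (φ m)
      set w' := v (φ n)
      have h1 := hB.energy_midpoint hf (s' • u + v') (t' • u + w')
      have h2 : (1 / 2 : ℝ) • (s' • u + v' + (t' • u + w')) =
          (1 / 2 * (s' + t')) • u + (1 / 2 : ℝ) • (v' + w') := by module
      have h3 : s' • u + v' - (t' • u + w') = (s' - t') • u + (v' - w') := by module
      have hmem : v' - w' ∈ E := E.sub_mem (hv _) (hv _)
      rw [h2, h3, hB.inner_smul_add hu ((hE _).1 hmem)] at h1
      have h4 := hleM (1 / 2 * (s' + t')) (by linarith [(hs (φ m)).1, (hs (φ n)).1])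
        ((1 / 2 : ℝ) • (v' + w')) (E.smul_mem _ (E.add_mem (hv _) (hv _)))
      have h5 := hB.neg_of_apply_eq_neg ((hE _).1 hmem)
      have h6 : (s' - t') ^ 2 * b ≤ (2 * (s' - σ) ^ 2 + 2 * (t' - σ) ^ 2) * b := by
        refine mul_le_mul_of_nonneg_right ?_ hb0
        nlinarith [sq_nonneg (s' - σ + (t' - σ))]
      have h7 : d / 8 * ‖v' - w'‖ ^ 2 ≤
          1 / 2 * (M - J (s' • u + v')) + 1 / 4 * b * (s' - σ) ^ 2 +
          (1 / 2 * (M - J (t' • u + w')) + 1 / 4 * b * (t' - σ) ^ 2) := by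
        simp only [hJ] at h4 ⊢
        linarith
      calc ‖v' - w'‖ ^ 2 = 8 / d * (d / 8 * ‖v' - w'‖ ^ 2) := by field_simp
        _ ≤ _ := mul_le_mul_of_nonneg_left h7 (by positivity)
        _ = _ := by ring
    · have h1 : Tendsto (fun n => s (φ n) - σ) atTop (𝓝 0) := by
        simpa using hlim.sub_const σ
      have h2 := ((he.const_mul (1 / 2)).add ((h1.pow 2).const_mul (1 / 4 * b))).const_mul (8 / d)
      simpa using h2
  obtain ⟨v₀, hv₀⟩ := cauchySeq_tendsto_of_complete hcau
  have hEclosed : IsClosed (E : Set H1) := by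
    have : (E : Set H1) = {v | T v = -v} := Set.ext hE
    rw [this]
    exact isClosed_eq T.continuous continuous_neg
  have hv₀E : v₀ ∈ E := hEclosed.mem_of_tendsto hv₀ (Eventually.of_forall fun n => hv _)
  set w := σ • u + v₀ with hw
  have hJc : Continuous J := continuous_iff_continuousAt.2 fun x => (hg x).hasFDerivAt.continuousAt
  have hJw : J w = M := by
    have h1 : Tendsto (fun n => J (s (φ n) • u + v (φ n))) atTop (𝓝 (J w)) :=
      (hJc.tendsto w).comp ((hlim.smul_const u).add hv₀)
    have h2 : Tendsto (fun n => J (s (φ n) • u + v (φ n))) atTop (𝓝 M) := by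
      simpa using he.const_sub M
    exact tendsto_nhds_unique h1 h2
  -- J ≤ 0 on E but M > 0. So σ is interior to the half-line, and variation in the direction u is
  -- allowed both ways.
  have hσ0 : 0 < σ := by
    refine hσ.1.lt_of_ne fun h => ?_
    have := hJle σ v₀ hv₀E
    rw [← hw, hJw, ← h] at this
    linarith
  have hcrit : ∀ x : H1, (∀ᶠ t : ℝ in 𝓝 0, J (w + t • x) ≤ M) → inner ℝ (g w) x = 0 := by
    intro x hx
    have hline : HasDerivAt (fun t : ℝ => w + t • x) x 0 := by
      simpa using ((hasDerivAt_id (0 : ℝ)).smul_const x).const_add w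
    have hgw : HasFDerivAt J (InnerProductSpace.toDual ℝ H1 (g w)) (w + (0 : ℝ) • x) := by
      rw [zero_smul, add_zero]
      exact (hg w).hasFDerivAt
    have h1 := hgw.comp_hasDerivAt 0 hline
    have h2 : IsLocalMax (J ∘ fun t : ℝ => w + t • x) 0 := by
      filter_upwards [hx] with t ht
      simpa [hJw] using ht
    exact h2.hasDerivAt_eq_zero h1
  have hcE : ∀ x ∈ E, inner ℝ (g w) x = 0 := fun x hx => hcrit x (Eventually.of_forall fun t => by
    rw [hw, add_assoc]
    exact hleM σ hσ.1 _ (E.add_mem hv₀E (E.smul_mem _ hx)))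
  have hcu : inner ℝ (g w) u = 0 := hcrit u (by
    filter_upwards [Ioi_mem_nhds (show -σ < 0 by linarith)] with t ht
    have h1 : w + t • u = (σ + t) • u + v₀ := by rw [hw]; module
    rw [h1]
    exact hleM _ (by linarith [mem_Ioi.1 ht]) _ hv₀E)
  refine ⟨w, ?_, ?_, hcE⟩
  · rintro h
    rw [h] at hJw
    have := hJle 0 0 E.zero_mem
    rw [zero_smul, add_zero, hJw] at this
    linarith
  · rw [hw] at hcu hcE ⊢
    rw [inner_add_right, H1.inner_smul_r, hcu, hcE _ hv₀E, mul_zero, add_zero]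

end Linking

end GapSoliton

/-! ### The main theorem -/

theorem hasGradientAt_half_inner {H : Type*} [NormedAddCommGroup H] [InnerProductSpace ℝ H]
    [CompleteSpace H] {B : H →L[ℝ] H} (hB : SymmOp B) (u : H) :
    HasGradientAt (fun u => 1 / 2 * inner ℝ (B u) u) (B u) u := by
  rw [hasGradientAt_iff_hasFDerivAt]
  refine hasFDerivAt_of_norm_sub_le (C := 1 / 2 * ‖B‖) fun v _ => ?_
  have h1 : 1 / 2 * inner ℝ (B (u + v)) (u + v) - 1 / 2 * inner ℝ (B u) u - inner ℝ (B u) v =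
      1 / 2 * inner ℝ (B v) v := by
    rw [map_add, inner_add_left, inner_add_right, inner_add_right, hB v u, real_inner_comm (B u) v]
    ring
  rw [InnerProductSpace.toDual_apply_apply, h1, norm_mul, Real.norm_of_nonneg (by norm_num),
    mul_assoc]
  refine mul_le_mul_of_nonneg_left ((abs_real_inner_le_norm _ _).trans ?_) (by norm_num)
  rw [pow_two, ← mul_assoc]
  exact mul_le_mul_of_nonneg_right (B.le_opNorm v) (norm_nonneg v)

theorem HasGradientAt.sub_gradient {H : Type*} [NormedAddCommGroup H] [InnerProductSpace ℝ H]
    [CompleteSpace H] {φ ψ : H → ℝ} {a b u : H} (hφ : HasGradientAt φ a u)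
    (hψ : HasGradientAt ψ b u) : HasGradientAt (fun u => φ u - ψ u) (a - b) u := by
  rw [hasGradientAt_iff_hasFDerivAt, map_sub]
  exact hφ.hasFDerivAt.sub hψ.hasFDerivAt

theorem tendsto_toDual_zero {H : Type*} [NormedAddCommGroup H] [InnerProductSpace ℝ H]
    [CompleteSpace H] {w : ℕ → H} (hw : Tendsto w atTop (𝓝 0)) :
    Tendsto (fun n => InnerProductSpace.toDual ℝ H (w n)) atTop (𝓝 0) := by
  have h1 := ((InnerProductSpace.toDual ℝ H).continuous.tendsto 0).comp hw
  rwa [map_zero] at h1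

theorem LipBdd.neg {H X : Type*} [NormedAddCommGroup H] [NormedAddCommGroup X] {f : H → X}
    {D : Set H} (hf : LipBdd f D) : LipBdd (fun u => -f u) D := by
  obtain ⟨B, K, hB, hK, h1, h2⟩ := hf
  refine ⟨B, K, hB, hK, fun u hu => by rw [norm_neg]; exact h1 u hu, fun u hu v hv => ?_⟩
  rw [neg_sub_neg, norm_sub_rev]
  exact h2 u hu v hv

namespace GapSoliton

/-- The splitting of `H¹(ℝ)` that belongs to the Nehari manifold. -/
theorem exists_splitForm {V : ℝ → ℝ} {χ : ℝ} (hχ : χ = 1 ∨ χ = -1) (hV : StepanovBounded V)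
    (h0 : (0 : ℝ) ∉ schrodingerSpectrum V)
    (hneg : χ = -1 → ∃ r ∈ schrodingerSpectrum V, r < 0) :
    ∃ (B T : H1 →L[ℝ] H1) (d : ℝ), SplitForm B T d ∧
      (∀ u v, inner ℝ (B u) v = χ * schrodingerForm V u v) ∧
      (∀ v, v ∈ signSubspace V (-χ) ↔ T v = -v) ∧ ∃ u, T u = u ∧ u ≠ 0 := by
  obtain ⟨A, hA, hAf⟩ := exists_formOp hV
  obtain ⟨S, hSS, hSA, hSk, ⟨d, hd, hSd⟩, hSs⟩ := exists_spectral_involution hV h0 hA hAf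
  have hχ2 : χ * χ = 1 := by rcases hχ with rfl | rfl <;> norm_num
  have hB : ∀ u v, inner ℝ ((χ • A) u) v = χ * inner ℝ (A u) v := fun u v => by
    rw [smul_apply, H1.inner_smul_l]
  have hsplit : SplitForm (χ • A) (χ • S) d := by
    refine ⟨fun u v => ?_, fun u => ?_, fun u v => ?_, fun u v => ?_, hd, fun u => ?_⟩
    · rw [hB, smul_apply, H1.inner_smul_r, hA]
    · rw [smul_apply, smul_apply, map_smul, hSS, smul_smul, hχ2, one_smul]
    · rw [hB, hB, smul_apply, smul_apply, map_smul, H1.inner_smul_l, H1.inner_smul_r, hSA]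
    · rw [smul_apply, smul_apply]
      have h1 : (χ • S u).fn = χ • (S u).fn := rfl
      have h2 : (χ • S v).fn = χ • (S v).fn := rfl
      rw [h1, h2, inner_smul_L2, real_inner_comm (χ • (S v).fn), inner_smul_L2,
        real_inner_comm u.fn, hSk]
    · rw [hB, smul_apply, map_smul, H1.inner_smul_l, ← mul_assoc, hχ2, one_mul]
      exact hSd u
  have hBf : ∀ u v, inner ℝ ((χ • A) u) v = χ * schrodingerForm V u v := fun u v => by
    rw [hB, hAf]
  refine ⟨χ • A, χ • S, d, hsplit, hBf, fun v => ?_, ?_⟩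
  · rw [hSs (-χ) (by rcases hχ with rfl | rfl <;> simp), smul_apply, neg_smul]
    constructor
    · intro h
      rw [h, smul_neg, smul_smul, hχ2, one_smul]
    · intro h
      rw [← smul_neg, ← h, smul_smul, hχ2, one_smul]
  · obtain ⟨e, he⟩ : ∃ e : H1, 0 < inner ℝ ((χ • A) e) e := by
      simp only [hBf]
      rcases hχ with rfl | rfl
      · simpa using exists_schrodingerForm_pos hV
      · obtain ⟨u, hu⟩ := exists_schrodingerForm_neg hV (hneg rfl)
        exact ⟨u, by linarith⟩
    -- Twice the positive component of e. If it vanished, e would lie in the negative space,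
    -- contrary to ⟨Be, e⟩ > 0.
    refine ⟨e + (χ • S) e, ?_, fun h => ?_⟩
    · rw [map_add, hsplit.invol, add_comm]
    · have h1 := hsplit.neg_of_apply_eq_neg (eq_neg_of_add_eq_zero_right h)
      have h2 : 0 ≤ d * ‖e‖ ^ 2 := by positivity
      linarith

end GapSoliton

theorem proposition5p4
    (V : ℝ → ℝ) (f : ℝ → ℝ → ℝ) (χ : ℝ) (hχ : χ = 1 ∨ χ = -1)
    -- the potential and the spectrum of the linear part
    (hV : StepanovAlmostPeriodic V)
    (h0 : (0 : ℝ) ∉ schrodingerSpectrum V)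
    (hneg : χ = -1 → ∃ r ∈ schrodingerSpectrum V, r < 0)
    -- regularity and almost periodicity of the nonlinearity
    (hf : ∀ᵐ x : ℝ, ContDiff ℝ 1 (f x))
    (hFap : StrictlyStepanovAlmostPeriodic (primitive f))
    (hfap : StrictlyStepanovAlmostPeriodic f)
    (hfuap : StrictlyStepanovAlmostPeriodic (fun x s => deriv (f x) s))
    (hFpos : ∀ s : ℝ, s ≠ 0 → ∃ δ : ℝ, 0 < δ ∧ ∀ᵐ x : ℝ, δ ≤ primitive f x s)
    -- behaviour at zero and local Lipschitz continuity of the derivative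
    (hf0 : ∀ᵐ x : ℝ, f x 0 = 0)
    (hfu0 : ∀ᵐ x : ℝ, deriv (f x) 0 = 0)
    (hLip : ∀ R : ℝ, 0 < R → ∃ μ : ℝ, 0 < μ ∧ ∀ᵐ x : ℝ, ∀ s t : ℝ, |s| ≤ R → |t| ≤ R →
      |deriv (f x) s - deriv (f x) t| ≤ μ * |s - t|)
    -- superlinearity
    (hθ : ∃ θ : ℝ, 0 < θ ∧ θ < 1 ∧ ∀ᵐ x : ℝ, ∀ s : ℝ, s ≠ 0 →
      0 < f x s * s ∧ f x s * s ≤ θ * (deriv (f x) s * s ^ 2)) :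
    Differentiable ℝ (signedEnergy V f χ) ∧
    IsGLB (signedEnergy V f χ '' nehariManifold V f χ) (groundLevel V f χ) ∧
    ∀ ε : ℝ, 0 < ε →
      ∃ c ∈ Set.Icc (groundLevel V f χ) (groundLevel V f χ + ε), ∃ u : ℕ → H1,
        IsPalaisSmaleOn (signedEnergy V f χ) (nehariManifold V f χ) c u ∧
        IsPalaisSmale (signedEnergy V f χ) c u ∧
        Tendsto (fun n => ‖u (n + 1) - u n‖) atTop (𝓝 0) ∧
        ∃ (ζ : ℝ → H1) (t : ℕ → ℝ),
          IsNegativeGradientTrajectory (signedEnergy V f χ) (nehariManifold V f χ) ζ ∧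
          (∀ n, 0 ≤ t n) ∧ Tendsto t atTop atTop ∧ ∀ n, u n = ζ (t n) := by
  obtain ⟨θ, hθ0, hθ1, hsl⟩ := hθ
  have hfs : SuperlinearNonlinearity f θ :=
    ⟨⟨hf, hFap.1, hfap.1, hfuap.1, hf0, hfu0, hLip⟩, hθ0, hθ1, hsl⟩
  obtain ⟨B, T, d, hB, hBf, hE, u₁, hu₁, hu₁0⟩ := exists_splitForm hχ hV.1 h0 hneg
  obtain ⟨G, D, hG, hD, hΨ, hGD, hGb, hDb⟩ := hfs.exists_gradient_hessian
  have hχ2 : χ * χ = 1 := by rcases hχ with rfl | rfl <;> norm_num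
  set E := signSubspace V (-χ) with hEdef
  set g : H1 → H1 := fun u => B u - G u with hg
  -- As χ² = 1, the sign in front of F cancels and both cases reduce to one functional; the sign of
  -- the quadratic part is absorbed in `B`.
  have hJeq : signedEnergy V f χ =
      fun u : H1 => 1 / 2 * inner ℝ (B u) u - ∫ x, primitive f x (u.fn x) := by
    funext u
    rw [hBf, signedEnergy, energy]
    linear_combination (-(∫ x, primitive f x (u.fn x))) * hχ2
  have hJ : ∀ u, HasGradientAt (signedEnergy V f χ) (g u) u := fun u => by
    rw [hJeq]
    exact (hasGradientAt_half_inner hB.symm u).sub_gradient (hΨ u)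
  have hfd : ∀ u, fderiv ℝ (signedEnergy V f χ) u = InnerProductSpace.toDual ℝ H1 (g u) := fun u =>
    (hJ u).hasFDerivAt.fderiv
  have hN : nehariManifold V f χ = nehariSet E g := by
    simp only [nehariManifold, nehariSet, hfd, InnerProductSpace.toDual_apply_apply]
    rfl
  have hEclosed : IsClosed (E : Set H1) := by
    have : (E : Set H1) = {v | T v = -v} := Set.ext hE
    rw [this]
    exact isClosed_eq T.continuous continuous_neg
  have : CompleteSpace E := hEclosed.completeSpace_coe
  have hne : (nehariSet E g).Nonempty :=
    nehariSet_nonempty hfs hB hE hFpos (fun u => by rw [← hJeq]; exact hJ u) hu₁ hu₁0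
  have hnn : ∀ u ∈ nehariSet E g, 0 ≤ signedEnergy V f χ u := by
    intro u hu
    have h1 := integral_apply_mul_self_le hfs hG hu
    have h2 := mul_nonneg (sub_nonneg.2 hθ1.le) (integral_apply_mul_self_nonneg hfs u)
    rw [hJeq]
    exact nonneg_of_mul_nonneg_right (h2.trans h1) (by positivity)
  refine ⟨fun u => (hJ u).hasFDerivAt.differentiableAt, ?_, fun ε hε => ?_⟩
  · rw [groundLevel, hN]
    exact isGLB_csInf (hne.image _) ⟨0, by rintro _ ⟨u, hu, rfl⟩; exact hnn u hu⟩
  obtain ⟨c, hc, ζ, t, hζ, ht0, ht, hJc, hτ, hgt, hstep⟩ := exists_palaisSmale_flow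
    (D := fun u => B - D u) hJ (fun u => B.hasFDerivAt.sub (hGD u))
    (fun R => by
      have := ((lipBdd_id_closedBall (H := H1) R).clm B).add (hGb R).neg
      simpa only [← sub_eq_add_neg] using this)
    (fun R => by
      have := (LipBdd.const (D := Metric.closedBall (0 : H1) R) B).add (hDb R).neg
      simpa only [← sub_eq_add_neg] using this)
    hne hnn (fun C => by
      rw [hJeq]
      exact exists_level_bounds hfs hB hE hG hD C) hε
  have htan : ∀ u, tangentialGradient (signedEnergy V f χ) (nehariManifold V f χ) u =
      (tangentSpan (nehariSet E g) u).starProjection (g u) := by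
    intro u
    rw [tangentialGradient, hN, (hJ u).gradient]
    rfl
  refine ⟨c, ?_, fun n => ζ (t n), ⟨fun n => ?_, hJc, ?_⟩, ⟨hJc, ?_⟩, hstep, ζ, t, fun s hs => ?_,
    ht0, ht, fun n => rfl⟩
  · rw [groundLevel, hN]
    exact hc
  · rw [hN]
    exact (hζ _ (ht0 n)).1
  · simpa only [htan] using hτ
  · simp only [hfd]
    exact tendsto_toDual_zero hgt
  · rw [htan, hN]
    exact hζ s hs
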